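/- Let $\mathfrak o$ be a compact discrete valuation ring (that is, a complete discrete valuation ring with finite residue field) with maximal ideal $\wp$, whose residue field $\mathfrak o/\wp$ has characteristic $2$ and cardinality $q$. Put $\mathfrak o_k=\mathfrak o/\wp^k$. Let $\mathbf R_{\mathfrak o}=4\mathrm e$ if $\mathfrak o$ has characteristic $0$ and ramification index $\mathrm e$ (so $2\mathfrak o=\wp^{\mathrm e}$), and $\mathbf R_{\mathfrak o}=2$ if $\mathfrak o$ has characteristic $2$. Let $r\ge\mathbf R_{\mathfrak o}$, $\ell=\lceil r/2\rceil$, $\ell'=\lfloor r/2\rfloor$. Let $M^\ell$ and $K^\ell$ be the kernels of the reduction maps $\mathrm{GL}_2(\mathfrak o_r)\to\mathrm{GL}_2(\mathfrak o_\ell)$ and $\mathrm{SL}_2(\mathfrak o_r)\to\mathrm{SL}_2(\mathfrak o_\ell)$. Fix a uniformizer $\pi$ of $\mathfrak o$ and an additive character $\psi:\mathfrak o_r\to\mathbb C^\times$ with $\psi(\pi^{r-1})\ne1$. For $A\in M_2(\mathfrak o_{\ell'})$ let $\psi_A:M^\ell\to\mathbb C^\times$ be the character $\psi_A(I+\pi^\ell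 B)=\psi(\pi^\ell\,\mathrm{trace}(\hat AB))$, where $\hat A\in M_2(\mathfrak o_r)$ is any lift of $A$, and let $\psi_{[A]}=\psi_A|_{K^\ell}$. Let $C_{\mathrm{SL}_2(\mathfrak o_r)}(\psi_A)$ be the stabilizer of $\psi_A$ in $\mathrm{SL}_2(\mathfrak o_r)$, acting by conjugation, and let $\mathrm{Irr}(\mathrm{SL}_2(\mathfrak o_r)\mid\psi_{[A]})$ be the set of equivalence classes of irreducible complex constituents of $\mathrm{Ind}_{K^\ell}^{\mathrm{SL}_2(\mathfrak o_r)}\psi_{[A]}$. Let $A\in M_2(\mathfrak o_{\ell'})$ be cyclic, i.e. for some vector $v$ the vectors $v,Av$ generate $\mathfrak o_{\ell'}^2$, and let $\tilde A\in M_2(\mathfrak o_r)$ be any lift of $A$. Put $C_S^\ell(\tilde A)=\bigl(C_{\mathrm{GL}_2(\mathfrak o_r)}(\tilde A)\,M^\ell\bigr)\cap\mathrm{SL}_2(\mathfrak o_r)$. The matrix $\tilde A$ is conjugate under $\mathrm{SL}_2(\mathfrak o_r)$ to a matrix $\begin{pmatrix}0&\tilde a^{-1}\tilde\alpha\\ \tilde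 a&\tilde\beta\end{pmatrix}$ with $\tilde a\in\mathfrak o_r^\times$; for any such form put $$\mathrm H_{\tilde A}^{\ell'}=\left\{\begin{pmatrix}1&\tilde a^{-1}x\\0&1\end{pmatrix}\;:\;x\in\mathfrak o_r,\ 2x\equiv0,\ x(x+\tilde\beta)\equiv0 \pmod{\wp^{\ell'}}\right\}.$$ Then the following hold. 1. Every $\rho\in\mathrm{Irr}(\mathrm{SL}_2(\mathfrak o_r)\mid\psi_{[A]})$ satisfies $$\frac1{q^5}\cdot\frac{|\mathrm{SL}_2(\mathfrak o_r)|}{|C_{\mathrm{SL}_2(\mathfrak o_r)}(\psi_A)|}\ \le\ \dim\rho\ \le\ \frac{|\mathrm{SL}_2(\mathfrak o_r)|}{|C_S^\ell(\tilde A)|}.$$ 2. $$\frac{|C_S^\ell(\tilde A)|^2\,q^\ell}{|C_{\mathrm{SL}_2(\mathfrak o_r)}(\psi_A)|\,|\mathrm H_{\tilde A}^{\ell'}|\,|K^\ell|}\ \le\ \bigl|\mathrm{Irr}(\mathrm{SL}_2(\mathfrak o_r)\mid\psi_{[A]})\bigr|\ \le\ \frac{|C_{\mathrm{SL}_2(\mathfrak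 o_r)}(\psi_A)|\,q^{\ell+10}}{|\mathrm H_{\tilde A}^{\ell'}|\,|K^\ell|}.$$ -/

import Mathlib

open scoped Matrix MatrixGroups

namespace SL2Growth

open IsLocalRing Matrix

section Ring

variable (o : Type*) [CommRing o] [IsLocalRing o]

/-- The finite quotient `o_k = o / ℘^k`, where `℘` is the maximal ideal of `o`. -/
abbrev OMod (k : ℕ) : Type _ := o ⧸ (maximalIdeal o) ^ k

/-- The natural projection `o_r → o_m` for `m ≤ r`. -/
abbrev red {m r : ℕ} (h : m ≤ r) : OMod o r →+* OMod o m :=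
  Ideal.Quotient.factorPow (maximalIdeal o) h

end Ring

/-- `ℓ = ⌈r / 2⌉`. -/
abbrev ellUp (r : ℕ) : ℕ := (r + 1) / 2

/-- `ℓ' = ⌊r / 2⌋`. -/
abbrev ellDown (r : ℕ) : ℕ := r / 2

theorem ellUp_le (r : ℕ) : ellUp r ≤ r := by unfold ellUp; omega

theorem ellDown_le (r : ℕ) : ellDown r ≤ r := by unfold ellDown; omega

/-- The number `𝐑_o`: it is `4 e` if `o` has characteristic zero and `e` is its ramification index
(the valuation of `2`, that is `2 o = ℘ ^ e`), and it is `2` otherwise. -/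
noncomputable def levelBound (o : Type*) [CommRing o] [IsDomain o] [IsDiscreteValuationRing o] :
    ℕ :=
  if ringChar o = 0 then 4 * (IsDiscreteValuationRing.addVal o (2 : o)).toNat else 2

/-- In characteristic zero the number `e` in `levelBound` satisfies `2 o = ℘ ^ e`. -/
theorem span_two_eq (o : Type*) [CommRing o] [IsDomain o] [IsDiscreteValuationRing o]
    (h : (2 : o) ≠ 0) :
    Ideal.span {(2 : o)} =
      maximalIdeal o ^ (IsDiscreteValuationRing.addVal o (2 : o)).toNat := by
  obtain ⟨ϖ, hϖ⟩ := IsDiscreteValuationRing.exists_irreducible o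
  obtain ⟨n, u, hu⟩ := IsDiscreteValuationRing.eq_unit_mul_pow_irreducible h hϖ
  rw [IsDiscreteValuationRing.addVal_def 2 u hϖ n hu, hϖ.maximalIdeal_eq, Ideal.span_singleton_pow,
    hu]
  exact Ideal.span_singleton_mul_left_unit u.isUnit _

section Cyclic

variable {S : Type*} [CommRing S]

/-- A `2 × 2` matrix `A` is cyclic if `{v, A v}` generates the free module of rank `2`
for some vector `v`. -/
def IsCyclicMatrix (A : Matrix (Fin 2) (Fin 2) S) : Prop :=
  ∃ v : Fin 2 → S, Submodule.span S {v, A *ᵥ v} = ⊤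

/-- The matrix with rows `(0, a⁻¹ α)` and `(a, β)`. -/
def normalForm (a : Sˣ) (α β : S) : Matrix (Fin 2) (Fin 2) S :=
  !![0, (↑a⁻¹ : S) * α; (a : S), β]

/-- The centralizer of a matrix `B` in `GL₂(S)`. -/
def glCentralizer (B : Matrix (Fin 2) (Fin 2) S) : Subgroup (GL (Fin 2) S) where
  carrier := {g | (g : Matrix (Fin 2) (Fin 2) S) * B = B * (g : Matrix (Fin 2) (Fin 2) S)}
  mul_mem' {g h} hg hh := by
    simp only [Set.mem_ofPred_eq, Units.val_mul] at *
    rw [Matrix.mul_assoc, hh, ← Matrix.mul_assoc, hg, Matrix.mul_assoc]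
  one_mem' := by simp
  inv_mem' {g} hg := by
    simp only [Set.mem_ofPred_eq] at *
    exact (Units.inv_mul_eq_iff_eq_mul g).2
      (by rw [← Matrix.mul_assoc, hg, Matrix.mul_assoc, Units.mul_inv, Matrix.mul_one])

end Cyclic

section Inertia

variable {G : Type*} [Group G]

/-- The inertia group (stabilizer) in `G` of a one-dimensional representation `χ` of a normal
subgroup `N`. -/
def inertia (N : Subgroup G) [N.Normal] (χ : N →* ℂ) : Subgroup G where
  carrier := {g | ∀ n : N, χ (MulAut.conjNormal g n) = χ n}
  mul_mem' {g h} hg hh n := by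
    rw [map_mul, MulAut.mul_apply, hg, hh]
  one_mem' n := by simp
  inv_mem' {g} hg n := by
    have := hg (MulAut.conjNormal g⁻¹ n)
    rw [← MulAut.mul_apply, ← map_mul, mul_inv_cancel, map_one, MulAut.one_apply] at this
    exact this.symm

/-- The one-dimensional representation on `ℂ` given by a multiplicative character. -/
noncomputable def oneDimRep {K : Type*} [Group K] (φ : K →* ℂ) : Representation ℂ K ℂ :=
  (algebraMap ℂ (Module.End ℂ ℂ)).toMonoidHom.comp φ

/-- `ρ` is an irreducible representation of `G` that is a constituent of the representation
induced from the one-dimensional representation `φ` of the subgroup `K`, that is,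
`⟨Ind φ, ρ⟩ ≠ 0`. -/
def LiesOver {K : Subgroup G} (φ : K →* ℂ) {V : Type*} [AddCommGroup V] [Module ℂ V]
    (ρ : Representation ℂ G V) : Prop :=
  ρ.IsIrreducible ∧
    ∃ f : (Representation.ind K.subtype (oneDimRep φ)).IntertwiningMap ρ, f ≠ 0

/-- Equivalence of finite-dimensional representations (on the spaces `ℂ ^ n`) lying over `φ`. -/
def irrSetoid {K : Subgroup G} (φ : K →* ℂ) :
    Setoid {x : Σ n : ℕ, Representation ℂ G (Fin n → ℂ) // LiesOver φ x.2} where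
  r x y := Nonempty (x.1.2.Equiv y.1.2)
  iseqv :=
    { refl := fun x => ⟨Representation.Equiv.refl x.1.2⟩
      symm := fun ⟨e⟩ => ⟨e.symm⟩
      trans := fun ⟨e⟩ ⟨f⟩ => ⟨e.trans f⟩ }

/-- `Irr(G | φ)`: the equivalence classes of irreducible representations of `G` lying over the
one-dimensional representation `φ` of a subgroup. -/
def IrrOver {K : Subgroup G} (φ : K →* ℂ) : Type _ := Quotient (irrSetoid φ)

end Inertia

section Congruence

variable (o : Type*) [CommRing o] [IsLocalRing o] (r : ℕ)

/-- The congruence subgroup `M^i` of `GL₂(o_r)`. -/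
abbrev congGL {i : ℕ} (h : i ≤ r) : Subgroup (GL (Fin 2) (OMod o r)) :=
  (Matrix.GeneralLinearGroup.map (n := Fin 2) (red o h)).ker

/-- The congruence subgroup `K^i` of `SL₂(o_r)`. -/
abbrev congSL {i : ℕ} (h : i ≤ r) : Subgroup (SL(2, OMod o r)) :=
  (Matrix.SpecialLinearGroup.map (n := Fin 2) (red o h)).ker

variable {o r}

/-- The inclusion of `K^i` in `M^i`. -/
def congIncl {i : ℕ} (h : i ≤ r) : congSL o r h →* congGL o r h :=
  (Matrix.SpecialLinearGroup.toGL.comp (congSL o r h).subtype).codRestrict _ fun g => by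
    have hg := g.2
    rw [MonoidHom.mem_ker] at hg ⊢
    have h2 := congrArg Matrix.SpecialLinearGroup.toGL hg
    rw [map_one] at h2
    rw [← h2]
    ext i j
    rfl

theorem red_mul_eq_zero {m n : ℕ} (hm : m ≤ r) (hn : n ≤ r) (hmn : r ≤ m + n) {x y : OMod o r}
    (hx : red o hm x = 0) (hy : red o hn y = 0) : x * y = 0 := by
  obtain ⟨x, rfl⟩ := Ideal.Quotient.mk_surjective x
  obtain ⟨y, rfl⟩ := Ideal.Quotient.mk_surjective y
  have hx' : x ∈ maximalIdeal o ^ m := Ideal.Quotient.eq_zero_iff_mem.1 hx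
  have hy' : y ∈ maximalIdeal o ^ n := Ideal.Quotient.eq_zero_iff_mem.1 hy
  rw [← map_mul, Ideal.Quotient.eq_zero_iff_mem]
  exact Ideal.pow_le_pow_right hmn (by rw [pow_add]; exact Ideal.mul_mem_mul hx' hy')

theorem red_matrix_mul_eq_zero {m n : ℕ} (hm : m ≤ r) (hn : n ≤ r) (hmn : r ≤ m + n)
    {X Y : Matrix (Fin 2) (Fin 2) (OMod o r)} (hX : X.map (red o hm) = 0)
    (hY : Y.map (red o hn) = 0) : X * Y = 0 := by
  ext i j
  rw [Matrix.mul_apply]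
  refine Finset.sum_eq_zero fun k _ => red_mul_eq_zero hm hn hmn ?_ ?_
  · exact congrFun (congrFun hX i) k
  · exact congrFun (congrFun hY k) j

theorem congGL_sub_one {i : ℕ} (h : i ≤ r) (g : congGL o r h) :
    ((g : GL (Fin 2) (OMod o r)) - 1 : Matrix (Fin 2) (Fin 2) (OMod o r)).map (red o h) = 0 := by
  have hg := congrArg Units.val (MonoidHom.mem_ker.1 g.2)
  have h1 : ((g : GL (Fin 2) (OMod o r)) : Matrix (Fin 2) (Fin 2) (OMod o r)).map (red o h) = 1 :=
    hg
  rw [Matrix.map_sub _ (map_sub _), h1, Matrix.map_one _ (map_zero _) (map_one _), sub_self]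

/-- For a matrix `Â` over `o_r`, the one-dimensional representation
`I + π^ℓ B ↦ ψ (π^ℓ trace (Â B))` of `M^ℓ`. -/
noncomputable def psiLift (ψ : AddChar (OMod o r) ℂ) (A' : Matrix (Fin 2) (Fin 2) (OMod o r)) :
    congGL o r (ellUp_le r) →* ℂ where
  toFun g := ψ (A' * ((g : GL (Fin 2) (OMod o r)) - 1 : Matrix (Fin 2) (Fin 2) (OMod o r))).trace
  map_one' := by simp
  map_mul' g h := by
    have h0 := red_matrix_mul_eq_zero (ellUp_le r) (ellUp_le r) (by unfold ellUp; omega)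
      (congGL_sub_one (ellUp_le r) g) (congGL_sub_one (ellUp_le r) h)
    rw [← AddChar.map_add_eq_mul, ← Matrix.trace_add, ← Matrix.mul_add]
    congr 3
    simp only [Subgroup.coe_mul, Units.val_mul]
    rw [Matrix.sub_mul, Matrix.mul_sub, Matrix.mul_one, Matrix.one_mul] at h0
    rw [← sub_eq_zero, ← h0]
    abel

theorem psiLift_congr (ψ : AddChar (OMod o r) ℂ) {A' B' : Matrix (Fin 2) (Fin 2) (OMod o r)}
    (h : A'.map (red o (ellDown_le r)) = B'.map (red o (ellDown_le r))) :
    psiLift ψ A' = psiLift ψ B' := by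
  ext g
  have h0 : (A' - B') * ((g : GL (Fin 2) (OMod o r)) - 1 : Matrix (Fin 2) (Fin 2) (OMod o r)) = 0 :=
    red_matrix_mul_eq_zero (ellDown_le r) (ellUp_le r) (by unfold ellUp ellDown; omega)
      (by rw [Matrix.map_sub _ (map_sub _), h, sub_self]) (congGL_sub_one (ellUp_le r) g)
  rw [Matrix.sub_mul, sub_eq_zero] at h0
  change ψ _ = ψ _
  rw [h0]

theorem exists_lift (A : Matrix (Fin 2) (Fin 2) (OMod o (ellDown r))) :
    ∃ A' : Matrix (Fin 2) (Fin 2) (OMod o r), A'.map (red o (ellDown_le r)) = A := by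
  have hs : Function.Surjective (red o (ellDown_le r)) := Ideal.Quotient.factor_surjective _
  choose f hf using hs
  exact ⟨A.map f, by ext i j; simp [hf]⟩

/-- The one-dimensional representation `ψ_A` of `M^ℓ` attached to a matrix `A` over `o_{ℓ'}`. -/
noncomputable def psi (ψ : AddChar (OMod o r) ℂ)
    (A : Matrix (Fin 2) (Fin 2) (OMod o (ellDown r))) : congGL o r (ellUp_le r) →* ℂ :=
  psiLift ψ (exists_lift A).choose

/-- `ψ_A` may be computed with any lift of `A`. -/
theorem psi_eq_psiLift (ψ : AddChar (OMod o r) ℂ)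
    {A : Matrix (Fin 2) (Fin 2) (OMod o (ellDown r))} {A' : Matrix (Fin 2) (Fin 2) (OMod o r)}
    (h : A'.map (red o (ellDown_le r)) = A) : psi ψ A = psiLift ψ A' :=
  psiLift_congr ψ ((exists_lift A).choose_spec.trans h.symm)

/-- The restriction `ψ_[A]` of `ψ_A` to `K^ℓ`. -/
noncomputable def psiBracket (ψ : AddChar (OMod o r) ℂ)
    (A : Matrix (Fin 2) (Fin 2) (OMod o (ellDown r))) : congSL o r (ellUp_le r) →* ℂ :=
  (psi ψ A).comp (congIncl (ellUp_le r))

/-- The stabilizer of `ψ_A` in `SL₂(o_r)`. -/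
noncomputable def stabSL (ψ : AddChar (OMod o r) ℂ)
    (A : Matrix (Fin 2) (Fin 2) (OMod o (ellDown r))) : Subgroup (SL(2, OMod o r)) :=
  (inertia _ (psi ψ A)).comap Matrix.SpecialLinearGroup.toGL

/-- The group `C_S^ℓ(Ã) = (C_{GL₂(o_r)}(Ã) M^ℓ) ∩ SL₂(o_r)`. -/
noncomputable def centSL (A' : Matrix (Fin 2) (Fin 2) (OMod o r)) : Subgroup (SL(2, OMod o r)) :=
  (glCentralizer A' ⊔ congGL o r (ellUp_le r)).comap Matrix.SpecialLinearGroup.toGL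

/-- The group of the matrices with rows `(1, a⁻¹ x)` and `(0, 1)`, where `2 x = 0` and
`x (x + β) = 0` modulo `℘^ℓ'`. -/
def groupH (a : (OMod o r)ˣ) (β : OMod o r) : Subgroup (SL(2, OMod o r)) where
  carrier := {g | ∃ x : OMod o r, red o (ellDown_le r) (2 * x) = 0 ∧
    red o (ellDown_le r) (x * (x + β)) = 0 ∧
    (g : Matrix (Fin 2) (Fin 2) (OMod o r)) = !![1, (↑a⁻¹ : OMod o r) * x; 0, 1]}
  mul_mem' := by
    rintro g h ⟨x, hx, hx', hg⟩ ⟨y, hy, hy', hh⟩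
    refine ⟨x + y, ?_, ?_, ?_⟩
    · rw [mul_add, map_add, hx, hy, add_zero]
    · have : (x + y) * (x + y + β) = x * (x + β) + y * (y + β) + 2 * x * y := by ring
      rw [this, map_add, map_add, map_mul _ (2 * x), hx, hx', hy']
      simp
    · refine (Matrix.SpecialLinearGroup.coe_mul g h).trans ?_
      refine (congrArg₂ (· * ·) hg hh).trans ?_
      ext i j
      fin_cases i <;> fin_cases j <;> simp [mul_add, add_comm]
  one_mem' := ⟨0, by simp, by simp, by simp [Matrix.one_fin_two]⟩
  inv_mem' := by
    rintro g ⟨x, hx, hx', hg⟩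
    refine ⟨-x, ?_, ?_, ?_⟩
    · rw [mul_neg, map_neg, hx, neg_zero]
    · have : -x * (-x + β) = 2 * x * x - x * (x + β) := by ring
      rw [this, map_sub, map_mul, hx, hx']
      simp
    · refine (Matrix.SpecialLinearGroup.coe_inv g).trans ?_
      refine (congrArg Matrix.adjugate hg).trans ?_
      rw [Matrix.adjugate_fin_two]
      simp

/-- Every lift of a cyclic matrix is conjugate under `SL₂` to a matrix in normal form. -/
theorem exists_conj_normalForm (hr : 2 ≤ r) {A : Matrix (Fin 2) (Fin 2) (OMod o (ellDown r))}
    (hA : IsCyclicMatrix A) {A' : Matrix (Fin 2) (Fin 2) (OMod o r)}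
    (h : A'.map (red o (ellDown_le r)) = A) :
    ∃ (g : SL(2, OMod o r)) (a : (OMod o r)ˣ) (α β : OMod o r),
      (g : Matrix (Fin 2) (Fin 2) (OMod o r)) * A' = normalForm a α β * g := by
  have hnt : ∀ k : ℕ, 1 ≤ k → Nontrivial (OMod o k) := fun k hk =>
    Ideal.Quotient.nontrivial_iff.2 fun htop =>
      (maximalIdeal.isMaximal o).ne_top (top_le_iff.1 (htop ▸ Ideal.pow_le_self (by omega)))
  have hs : Function.Surjective (red o (ellDown_le r)) := Ideal.Quotient.factor_surjective _
  have n1 := hnt (ellDown r) (by unfold ellDown; omega)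
  have n2 := hnt r (by omega)
  have hloc : IsLocalRing (OMod o r) :=
    IsLocalRing.of_surjective' (Ideal.Quotient.mk _) Ideal.Quotient.mk_surjective
  have hlh : IsLocalHom (red o (ellDown_le r)) := IsLocalHom.of_surjective _ hs
  obtain ⟨v, hv⟩ := hA
  choose f hf using hs
  have hA00 : ∀ i j, red o (ellDown_le r) (A' i j) = A i j := fun i j => by rw [← h]; rfl
  have e1 : (![1, 0] : Fin 2 → OMod o (ellDown r)) ∈
      Submodule.span (OMod o (ellDown r)) {v, A *ᵥ v} := by
    rw [hv]; trivial
  have e2 : (![0, 1] : Fin 2 → OMod o (ellDown r)) ∈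
      Submodule.span (OMod o (ellDown r)) {v, A *ᵥ v} := by
    rw [hv]; trivial
  obtain ⟨x, y, hxy⟩ := Submodule.mem_span_pair.1 e1
  obtain ⟨z, w, hzw⟩ := Submodule.mem_span_pair.1 e2
  have h1 := congrFun hxy 0
  have h2 := congrFun hxy 1
  have h3 := congrFun hzw 0
  have h4 := congrFun hzw 1
  simp at h1 h2 h3 h4
  set p := f (v 0) with hp
  set s := f (v 1) with hs'
  have hu : IsUnit (p * (A' 1 0 * p + A' 1 1 * s) - s * (A' 0 0 * p + A' 0 1 * s)) := by
    refine isUnit_of_map_unit (red o (ellDown_le r)) _ ?_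
    simp only [map_sub, map_mul, map_add, hA00, hp, hs', hf]
    refine IsUnit.of_mul_eq_one (x * w - y * z) ?_
    linear_combination (z * v 1 + w * (A 1 0 * v 0 + A 1 1 * v 1)) * h1 + h4 -
      (z * v 0 + w * (A 0 0 * v 0 + A 0 1 * v 1)) * h2
  obtain ⟨d, hd⟩ := hu
  have hdi : (↑d⁻¹ : OMod o r) *
      (p * (A' 1 0 * p + A' 1 1 * s) - s * (A' 0 0 * p + A' 0 1 * s)) = 1 := by
    rw [← hd, Units.inv_mul]
  have hdd : (d : OMod o r) * (↑d⁻¹ : OMod o r) = 1 := Units.mul_inv d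
  have key : !![A' 1 0 * p + A' 1 1 * s, -(A' 0 0 * p + A' 0 1 * s);
      -(↑d⁻¹ : OMod o r) * s, (↑d⁻¹ : OMod o r) * p] * A' = normalForm d⁻¹ (-A'.det) A'.trace *
      !![A' 1 0 * p + A' 1 1 * s, -(A' 0 0 * p + A' 0 1 * s);
      -(↑d⁻¹ : OMod o r) * s, (↑d⁻¹ : OMod o r) * p] := by
    rw [Matrix.det_fin_two, Matrix.trace_fin_two]
    ext i j
    fin_cases i <;> fin_cases j <;>
      simp [normalForm, Matrix.mul_apply, Fin.sum_univ_two]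
    · linear_combination s * (A' 0 1 * A' 1 0 - A' 0 0 * A' 1 1) * hdd
    · linear_combination (-p) * (A' 0 1 * A' 1 0 - A' 0 0 * A' 1 1) * hdd
    · ring
    · ring
  refine ⟨⟨_, ?_⟩, d⁻¹, -A'.det, A'.trace, key⟩
  rw [Matrix.det_fin_two_of]
  linear_combination hdi

end Congruence

end SL2Growth

open SL2Growth IsLocalRing

/-! Write G = SL₂(o_r), K = K^ℓ, φ = ψ_[A], and let T be the inertia group of φ in G. By Clifford,
dim ρ = [G : T] · dim ρ_φ, where ρ_φ is the φ-isotypic part, and everything reduces to the order of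
T and the size of ρ_φ. All quantities are invariant under SL₂-conjugation, so à may be taken in
normal form B, with trace β (`exists_conj_normalForm` and the section on conjugation).

Order of T: characters of K^ℓ see matrices only up to scalars, so g lies in T exactly when g⁻¹Bg ≡ B
+ x modulo ℘^ℓ' for some scalar x. Comparing traces and determinants gives 2x ≡ 0 and x(x + β) ≡ 0,
and unipotent matrices realise every such x. Hence |T| = |C_S(ψ_A)| · t, where t is the number of
these x modulo ℘^ℓ' (`card_inertia`), and |H| = t q^ℓ.

Upper bound for dim ρ: commutators of C_S^ℓ(B) lie in K and are killed by φ, so ρ_φ contains an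
eigenvector of C_S^ℓ(B), whose G-orbit spans ρ (`exists_eigenvector`, `finrank_le_index`).

Lower bound: this amounts to t ≤ q⁵ dim ρ_φ (`card_map_translations_le_finrank`). The eigencharacter
χ of C_S^ℓ(B) is moved by the unipotent elements of T, and distinct restrictions of its conjugates
have independent eigenvectors in ρ_φ. So dim ρ_φ is at least |X| / |P|, where X is a group of
translations, P is the stabilizer of χ inside X, and both are counted modulo ℘^ℓ'
(`exists_extension_card_le`). It remains to bound P. If 2 ≠ 0, scalar matrices 1 + 2w already force
P into ℘^(ℓ'-1). If 2 = 0, χ is evaluated on conjugates of 1 + vB, which yields the relation ψ(svx +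
vx² + v²x(t + det B)) = 1 for x in P, now with s ≡ β and t ≡ β² modulo ℘^ℓ'
(`addChar_eq_one_of_conj`). For β of small valuation this forces x ≡ 0 modulo ℘^ℓ'. For β of large
valuation, splitting the ring over its squares turns it into a quartic congruence in a root of x
with three terms of known valuation, so that only three valuations of x survive and |P| ≤ q³
(`exists_valuations_of_trace_large`).

Number of representations: the regular representation gives Σ dim ρ · dim ρ_φ = [G : K], the sum
running over Irr(G | φ). Each term is (dim ρ)² / [G : T], so the two dimension bounds give the two
counting bounds (`card_irrOver_bounds`, `card_irrOver_normalForm`). -/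

namespace SL2Growth

/-! ### Joint eigenvectors of families of operators. -/

section Eigen

variable {V : Type*} [AddCommGroup V] [Module ℂ V]

/-- The space of joint eigenvectors of a family of operators with prescribed eigenvalues. -/
def jointEigen {ι : Type*} (f : ι → Module.End ℂ V) (ξ : ι → ℂ) : Submodule ℂ V where
  carrier := {v | ∀ i, f i v = ξ i • v}
  add_mem' {a b} ha hb i := by rw [map_add, ha, hb, smul_add]
  zero_mem' i := by simp
  smul_mem' c v hv i := by rw [map_smul, hv, smul_comm]

/-- The usual argument for one operator: if two eigenvalue systems differ at `i`, applying `f i - a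
i` to a relation removes the term of `a` and rescales the others. -/
theorem iSupIndep_jointEigen {ι : Type*} (f : ι → Module.End ℂ V) :
    iSupIndep fun ξ : ι → ℂ => jointEigen f ξ := by
  classical
  rw [iSupIndep_iff_finsetSum_eq_zero_imp_eq_zero]
  intro s
  induction s using Finset.induction_on with
  | empty => simp
  | insert a s ha ih =>
    intro v hv hsum
    have hs : ∀ ξ ∈ s, v ξ = 0 := by
      intro ξ hξ
      by_contra hne
      obtain ⟨i, hi⟩ : ∃ i, ξ i ≠ a i := by
        by_contra! hcon
        exact ha (funext hcon ▸ hξ)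
      have h0 := congrArg (fun w => f i w - a i • w) hsum
      simp only [map_sum, Finset.smul_sum, ← Finset.sum_sub_distrib, map_zero, smul_zero,
        sub_zero] at h0
      rw [Finset.sum_insert ha, hv a (Finset.mem_insert_self a s) i, sub_self, zero_add] at h0
      have h1 := ih (fun η => (η i - a i) • v η)
        (fun η hη => Submodule.smul_mem _ _ (hv η (Finset.mem_insert_of_mem hη))) (by
          rw [← h0]
          refine Finset.sum_congr rfl fun η hη => ?_
          rw [hv η (Finset.mem_insert_of_mem hη) i, sub_smul]) ξ hξ
      rcases smul_eq_zero.1 h1 with h | h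
      · exact hi (sub_eq_zero.1 h)
      · exact hne h
    intro ξ hξ
    rcases Finset.mem_insert.1 hξ with rfl | h
    · rw [Finset.sum_insert ha, Finset.sum_eq_zero hs, add_zero] at hsum
      exact hsum
    · exact hs ξ h

/-- Nonzero joint eigenvectors in a subspace with pairwise distinct eigenvalue systems are at most
as many as its dimension. -/
theorem card_le_finrank_of_jointEigen [FiniteDimensional ℂ V] {ι J : Type*} [Finite J]
    (f : ι → Module.End ℂ V) (ξ : J → ι → ℂ) (hξ : Function.Injective ξ) (W : Submodule ℂ V)
    (hne : ∀ j, ∃ v ∈ jointEigen f (ξ j), v ∈ W ∧ v ≠ 0) : Nat.card J ≤ Module.finrank ℂ W := by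
  have := Fintype.ofFinite J
  choose v hv hvW hv0 using hne
  have h := ((iSupIndep_jointEigen f).comp hξ).linearIndependent _ hv hv0
  have h2 : LinearIndependent ℂ fun j => (⟨v j, hvW j⟩ : W) :=
    LinearIndependent.of_comp W.subtype h
  rw [Nat.card_eq_fintype_card]
  exact h2.fintype_card_le_finrank

/-- A commuting family of operators on a nonzero finite-dimensional invariant subspace has a
joint eigenvector there. -/
theorem exists_jointEigen_of_commute [FiniteDimensional ℂ V] {ι : Type*}
    (f : ι → Module.End ℂ V) (W : Submodule ℂ V) (hW : W ≠ ⊥)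
    (hinv : ∀ i, ∀ w ∈ W, f i w ∈ W)
    (hcomm : ∀ i j, ∀ w ∈ W, f i (f j w) = f j (f i w)) :
    ∃ ξ : ι → ℂ, ∃ w ∈ W, w ≠ 0 ∧ ∀ i, f i w = ξ i • w := by
  induction hn : Module.finrank ℂ W using Nat.strong_induction_on generalizing W with
  | _ n ih =>
    have hnt : Nontrivial W := Submodule.nontrivial_iff_ne_bot.2 hW
    have key : ∀ i, ∃ μ : ℂ, ∃ w ∈ W, w ≠ 0 ∧ f i w = μ • w := by
      intro i
      obtain ⟨μ, hμ⟩ := Module.End.exists_eigenvalue ((f i).restrict (hinv i))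
      obtain ⟨w, hw⟩ := hμ.exists_hasEigenvector
      refine ⟨μ, w, w.2, fun h => hw.2 (Subtype.ext h), ?_⟩
      have := congrArg Subtype.val hw.apply_eq_smul
      simpa using this
    choose μ w hwW hw0 hw using key
    by_cases hall : ∀ i, ∀ x ∈ W, f i x = μ i • x
    · obtain ⟨x, hx, hx0⟩ := (Submodule.ne_bot_iff _).1 hW
      exact ⟨μ, x, hx, hx0, fun i => hall i x hx⟩
    push Not at hall
    obtain ⟨i, x, hx, hxi⟩ := hall
    -- An operator that is not scalar on `W` has an eigenspace strictly smaller than `W`;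
    -- commutation makes it invariant, so the induction on the dimension applies.
    let W' : Submodule ℂ V := W ⊓ LinearMap.ker (f i - μ i • LinearMap.id)
    have hmem : ∀ y, y ∈ W' ↔ y ∈ W ∧ f i y = μ i • y := fun y => by
      simp [W', sub_eq_zero]
    have hlt : W' < W := lt_of_le_of_ne inf_le_left fun h => hxi ((hmem x).1 (h ▸ hx)).2
    obtain ⟨ξ, y, hy, hy0, hyξ⟩ := ih _ (hn ▸ Submodule.finrank_lt_finrank_of_lt hlt) W'
      ((Submodule.ne_bot_iff _).2 ⟨w i, (hmem _).2 ⟨hwW i, hw i⟩, hw0 i⟩)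
      (fun j y hy => by
        obtain ⟨h1, h2⟩ := (hmem y).1 hy
        exact (hmem _).2 ⟨hinv j y h1, by rw [hcomm i j y h1, h2, map_smul]⟩)
      (fun j k y hy => hcomm j k y hy.1) rfl
    exact ⟨ξ, y, hy.1, hy0, hyξ⟩

end Eigen

/-! ### Frobenius reciprocity and Clifford theory for one-dimensional characters. -/

section Constituents

variable {G : Type*} [Group G] {K : Subgroup G} (φ : K →* ℂ)
  {V : Type*} [AddCommGroup V] [Module ℂ V] (ρ : Representation ℂ G V)

/-- The `φ`-isotypic part of a representation restricted to the subgroup `K`. -/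
def isoPart : Submodule ℂ V := jointEigen (fun k : K => ρ (k : G)) φ

variable {φ ρ}

theorem conj_mem_isoPart {g : G} {k : K} {v : V} (k' : K)
    (hk : (k : G) * g = g * k') (hv : v ∈ isoPart φ ρ) :
    ρ (k : G) (ρ g v) = φ k' • ρ g v := by
  rw [← Module.End.mul_apply, ← map_mul, hk, map_mul, Module.End.mul_apply, hv, map_smul]

theorem oneDimRep_apply (k : K) (z : ℂ) : oneDimRep φ k z = φ k * z := by
  simp [oneDimRep, Algebra.algebraMap_eq_smul_one]

/-- Frobenius reciprocity for one-dimensional representations. -/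
theorem liesOver_iff : LiesOver φ ρ ↔ ρ.IsIrreducible ∧ isoPart φ ρ ≠ ⊥ := by
  refine and_congr_right fun hirr => ⟨?_, ?_⟩
  · rintro ⟨f, hf⟩ hbot
    apply hf
    -- The induced representation is generated by the class of `1 ⊗ 1`, on which `K` acts through
    -- `φ`; its image under `f` is therefore in the isotypic part and determines `f`.
    have h1 : ∀ k : K, ρ (k : G) (f (Representation.IndV.mk K.subtype (oneDimRep φ) 1 1)) =
        φ k • f (Representation.IndV.mk K.subtype (oneDimRep φ) 1 1) := by
      intro k
      rw [← Representation.IntertwiningMap.isIntertwining, Representation.ind_mk, ← map_smul]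
      congr 1
      rw [← map_smul]
      have := Representation.Coinvariants.mk_self_apply
        (Representation.tprod ((Representation.leftRegular ℂ G).comp K.subtype) (oneDimRep φ)) k
        (TensorProduct.tmul ℂ (MonoidAlgebra.single (k⁻¹ : G) (1 : ℂ)) (1 : ℂ))
      simp only [Representation.tprod_apply, TensorProduct.map_tmul, oneDimRep_apply] at this
      simp only [one_mul, smul_eq_mul]
      simp at this
      simpa using this.symm
    have h2 : f (Representation.IndV.mk K.subtype (oneDimRep φ) 1 1) = 0 := by
      have : f (Representation.IndV.mk K.subtype (oneDimRep φ) 1 1) ∈ isoPart φ ρ := h1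
      rwa [hbot, Submodule.mem_bot] at this
    apply Representation.IntertwiningMap.ext
    apply Representation.IndV.hom_ext
    intro g
    apply LinearMap.ext_ring
    have h3 : Representation.IndV.mk K.subtype (oneDimRep φ) g 1 =
        Representation.ind K.subtype (oneDimRep φ) g⁻¹
          (Representation.IndV.mk K.subtype (oneDimRep φ) 1 1) := by
      rw [Representation.ind_mk, inv_inv, one_mul]
    change f (Representation.IndV.mk K.subtype (oneDimRep φ) g 1) = 0
    rw [h3, Representation.IntertwiningMap.isIntertwining, h2, map_zero]
  · intro hne
    obtain ⟨v, hv, hv0⟩ := (Submodule.ne_bot_iff _).1 hne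
    -- The map `g ⊗ z ↦ z • ρ g⁻¹ v` descends to coinvariants precisely because `v` is a
    -- `φ`-eigenvector.
    let F : Representation.IndV K.subtype (oneDimRep φ) →ₗ[ℂ] V :=
      Representation.Coinvariants.lift _
        (TensorProduct.lift ((LinearMap.lsmul ℂ V).flip.comp
          (Finsupp.linearCombination ℂ (fun g : G => ρ g⁻¹ v) ∘ₗ
            (MonoidAlgebra.coeffLinearEquiv ℂ).toLinearMap))) (by
          intro k
          ext g
          have h1 : ρ (k : G)⁻¹ v = φ k⁻¹ • v := hv k⁻¹
          have h2 : φ k * φ k⁻¹ = 1 := by rw [← map_mul, mul_inv_cancel, map_one]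
          simp [oneDimRep_apply, h1, smul_smul, left_ne_zero_of_mul_eq_one h2])
    have hF : ∀ g : G, F (Representation.IndV.mk K.subtype (oneDimRep φ) g 1) = ρ g⁻¹ v := by
      intro g
      simp [F]
    refine ⟨⟨F, ?_⟩, ?_⟩
    · intro g
      apply Representation.IndV.hom_ext
      intro x
      apply LinearMap.ext_ring
      change F (Representation.ind K.subtype (oneDimRep φ) g
        (Representation.IndV.mk K.subtype (oneDimRep φ) x 1)) =
        ρ g (F (Representation.IndV.mk K.subtype (oneDimRep φ) x 1))
      rw [Representation.ind_mk, hF, hF]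
      simp
    · intro h
      have h1 := hF 1
      have h2 : F = 0 := congrArg Representation.IntertwiningMap.toLinearMap h
      rw [h2] at h1
      simp at h1
      exact hv0 h1.symm

theorem eq_top_of_irreducible (hρ : ρ.IsIrreducible) (W : Submodule ℂ V)
    (hW : ∀ g, ∀ w ∈ W, ρ g w ∈ W) (hne : W ≠ ⊥) : W = ⊤ := by
  let σ : Subrepresentation ρ := ⟨W, fun g w hw => hW g w hw⟩
  rcases hρ.eq_bot_or_eq_top σ with h | h
  · exact absurd (congrArg Subrepresentation.toSubmodule h) hne
  · exact congrArg Subrepresentation.toSubmodule h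

theorem span_orbit_eq_top (hρ : ρ.IsIrreducible) {v : V} (hv : v ≠ 0) :
    Submodule.span ℂ (Set.range fun g => ρ g v) = ⊤ := by
  refine eq_top_of_irreducible hρ _ (fun g w hw => ?_) ?_
  · refine Submodule.span_induction ?_ ?_ ?_ ?_ hw
    · rintro _ ⟨x, rfl⟩
      exact Submodule.subset_span ⟨g * x, by simp⟩
    · simp
    · intro a b _ _ ha hb
      rw [map_add]
      exact Submodule.add_mem _ ha hb
    · intro c a _ ha
      rw [map_smul]
      exact Submodule.smul_mem _ _ ha
  · intro h
    have h1 : v ∈ Submodule.span ℂ (Set.range fun g => ρ g v) :=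
      Submodule.subset_span ⟨1, by simp⟩
    rw [h, Submodule.mem_bot] at h1
    exact hv h1

theorem finiteDimensional_of_irreducible [Finite G] (hρ : ρ.IsIrreducible) :
    FiniteDimensional ℂ V := by
  by_cases h : ∃ v : V, v ≠ 0
  · obtain ⟨v, hv⟩ := h
    exact Module.finite_def.2 (span_orbit_eq_top hρ hv ▸ Submodule.fg_span (Set.finite_range _))
  · push Not at h
    have : Subsingleton V := ⟨fun a b => by rw [h a, h b]⟩
    infer_instance

/-- If an irreducible representation contains an eigenvector of a subgroup `C`, its dimension is
at most the index of `C`. -/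
theorem finrank_le_index [Finite G] (hρ : ρ.IsIrreducible) (C : Subgroup G) {v : V} (hv : v ≠ 0)
    (hC : ∀ c ∈ C, ∃ z : ℂ, ρ c v = z • v) : Module.finrank ℂ V ≤ C.index := by
  have := finiteDimensional_of_irreducible hρ
  have h1 : Submodule.span ℂ (Set.range fun q : G ⧸ C => ρ q.out v) = ⊤ := by
    rw [eq_top_iff, ← span_orbit_eq_top hρ hv, Submodule.span_le]
    rintro _ ⟨g, rfl⟩
    obtain ⟨c, hc⟩ := QuotientGroup.mk_out_eq_mul C g
    obtain ⟨z, hz⟩ := hC c⁻¹ (C.inv_mem c.2)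
    have h2 : ρ g v = z • ρ ((g : G ⧸ C).out) v := by
      rw [hc, map_mul, Module.End.mul_apply, ← map_smul, ← map_smul, ← hz,
        ← Module.End.mul_apply (ρ (c : G)), ← map_mul, mul_inv_cancel, map_one,
        Module.End.one_apply]
    simp only [h2]
    exact Submodule.smul_mem _ _ (Submodule.subset_span ⟨_, rfl⟩)
  have := Fintype.ofFinite (G ⧸ C)
  rw [Subgroup.index, Nat.card_eq_fintype_card]
  have h2 := finrank_range_le_card (R := ℂ) (b := fun q : G ⧸ C => ρ q.out v)
  rwa [Set.finrank, h1, finrank_top] at h2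

/-- Clifford's theorem for a one-dimensional representation of a normal subgroup. -/
theorem finrank_eq_index_mul [Finite G] [K.Normal] (hρ : ρ.IsIrreducible)
    (hφ : isoPart φ ρ ≠ ⊥) :
    Module.finrank ℂ V = (inertia K φ).index * Module.finrank ℂ (isoPart φ ρ) := by
  have := finiteDimensional_of_irreducible hρ
  let ξ : G → K → ℂ := fun g k => φ (MulAut.conjNormal g⁻¹ k)
  let f : K → Module.End ℂ V := fun k => ρ (k : G)
  -- `ρ g` carries the `φ`-part onto the part of the conjugate character `ξ g`. The parts attached
  -- to the cosets of the inertia group are thus permuted by `G`, independent and of equal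
  -- dimension.
  have hmem : ∀ g v, ρ g v ∈ jointEigen f (ξ g) ↔ v ∈ isoPart φ ρ := by
    intro g v
    constructor
    · intro h k
      have h1 := congrArg (ρ g⁻¹) (h (MulAut.conjNormal g k))
      simp only [f, ξ, map_smul, ← Module.End.mul_apply, ← map_mul, MulAut.conjNormal_apply,
        inv_mul_cancel, map_one, Module.End.one_apply] at h1
      rw [← MulAut.mul_apply, ← map_mul, inv_mul_cancel, map_one, MulAut.one_apply] at h1
      rw [← h1]
      congr 2
      group
    · intro h k
      exact conj_mem_isoPart _ (by simp [mul_assoc]) h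
  have hξ : ∀ g g', ξ g = ξ g' ↔ (g : G ⧸ inertia K φ) = g' := by
    intro g g'
    rw [QuotientGroup.eq]
    constructor
    · intro h n
      have := congrFun h (MulAut.conjNormal g' n)
      simp only [ξ] at this
      rw [← MulAut.mul_apply, ← map_mul, ← MulAut.mul_apply, ← map_mul, inv_mul_cancel, map_one,
        MulAut.one_apply] at this
      exact this
    · intro h
      funext k
      have := h (MulAut.conjNormal g'⁻¹ k)
      rw [← MulAut.mul_apply, ← map_mul, mul_inv_cancel_right] at this
      exact this
  let W : G ⧸ inertia K φ → Submodule ℂ V := fun q => jointEigen f (ξ q.out)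
  have hind : iSupIndep W := (iSupIndep_jointEigen f).comp (f := fun q : G ⧸ inertia K φ => ξ q.out)
    (fun q q' h => by simpa using (hξ _ _).1 h)
  have hWmk : ∀ g : G, W (g : G ⧸ inertia K φ) = jointEigen f (ξ g) := fun g => by
    simp only [W]
    congr 1
    exact (hξ _ _).2 (by simp)
  have htop : iSup W = ⊤ := by
    refine eq_top_of_irreducible hρ _ (fun g w hw => ?_) (fun h => hφ ?_)
    · refine Submodule.iSup_induction W (motive := fun w => ρ g w ∈ iSup W) hw ?_ (by simp) ?_
      · intro q x hx
        refine Submodule.mem_iSup_of_mem ((g * q.out : G) : G ⧸ inertia K φ) ?_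
        change ρ g x ∈ W _
        rw [hWmk]
        have h1 : x = ρ q.out (ρ q.out⁻¹ x) := by
          rw [← Module.End.mul_apply, ← map_mul, mul_inv_cancel, map_one, Module.End.one_apply]
        simp only [W] at hx
        rw [h1, hmem] at hx
        rw [h1, ← Module.End.mul_apply, ← map_mul, hmem]
        exact hx
      · intro x y hx hy
        rw [map_add]
        exact Submodule.add_mem _ hx hy
    · rw [iSup_eq_bot] at h
      have h1 := h ((1 : G) : G ⧸ inertia K φ)
      rw [hWmk] at h1
      rw [eq_bot_iff] at h1 ⊢
      intro v hv
      have h2 := h1 ((hmem 1 v).2 hv)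
      simpa using h2
  have hdim : ∀ q, Module.finrank ℂ (W q) = Module.finrank ℂ (isoPart φ ρ) := by
    intro q
    have h1 : Function.Injective (ρ (q.out : G)) := by
      intro a b h
      have := congrArg (ρ q.out⁻¹) h
      simpa only [← Module.End.mul_apply, ← map_mul, inv_mul_cancel, map_one,
        Module.End.one_apply] using this
    have h2 : W q = (isoPart φ ρ).map (ρ q.out) := by
      ext x
      have h3 : x = ρ q.out (ρ q.out⁻¹ x) := by
        rw [← Module.End.mul_apply, ← map_mul, mul_inv_cancel, map_one, Module.End.one_apply]
      constructor
      · intro hx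
        exact ⟨ρ q.out⁻¹ x, by rw [SetLike.mem_coe, ← hmem q.out, ← h3]; exact hx, h3.symm⟩
      · rintro ⟨y, hy, rfl⟩
        exact (hmem _ _).2 hy
    rw [h2]
    exact (Submodule.equivMapOfInjective _ h1 _).finrank_eq.symm
  classical
  have := Fintype.ofFinite (G ⧸ inertia K φ)
  have hint := (DirectSum.isInternal_submodule_iff_iSupIndep_and_iSup_eq_top W).2 ⟨hind, htop⟩
  rw [← (LinearEquiv.ofBijective (DirectSum.coeLinearMap W) hint).finrank_eq,
    Module.finrank_directSum, Finset.sum_congr rfl fun q _ => hdim q]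
  simp [Subgroup.index]

end Constituents

end SL2Growth

namespace SL2Growth

/-! ### Decomposition of the regular representation and counting of irreducibles over a character.
-/

section Decomposition

open scoped MonoidAlgebra

variable {G : Type*} [Group G]

theorem isIrreducible_of_equiv {V W : Type*} [AddCommGroup V] [Module ℂ V] [AddCommGroup W]
    [Module ℂ W] {ρ : Representation ℂ G V} {σ : Representation ℂ G W} (e : ρ.Equiv σ)
    (hρ : ρ.IsIrreducible) : σ.IsIrreducible := by
  rw [Representation.irreducible_iff_isSimpleModule_asModule] at hρ ⊢
  exact IsSimpleModule.congr (LinearEquiv.ofBijective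
    (Representation.IntertwiningMap.equivLinearMapAsModule _ _ e.symm.toIntertwiningMap)
    e.symm.toLinearEquiv.bijective)

/-- Complete reducibility in coordinates. -/
theorem exists_decomposition [Finite G] {W : Type*} [AddCommGroup W] [Module ℂ W]
    [FiniteDimensional ℂ W] (ρ : Representation ℂ G W) :
    ∃ (n : ℕ) (d : Fin n → ℕ) (σ : ∀ i, Representation ℂ G (Fin (d i) → ℂ))
      (e : W ≃ₗ[ℂ] ∀ i, Fin (d i) → ℂ),
      (∀ i, (σ i).IsIrreducible) ∧ ∀ g w i, e (ρ g w) i = σ i g (e w i) := by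
  have hfin : Module.Finite ℂ ρ.asModule := ‹FiniteDimensional ℂ W›
  have : Module.Finite ℂ[G] ρ.asModule := Module.Finite.of_restrictScalars_finite ℂ _ _
  have : NeZero (Nat.card G : ℂ) := ⟨Nat.cast_ne_zero.2 Nat.card_pos.ne'⟩
  obtain ⟨n, S, e, hS⟩ := IsSemisimpleModule.exists_linearEquiv_fin_dfinsupp ℂ[G] ρ.asModule
  have hfd : ∀ i, FiniteDimensional ℂ (S i) := fun i =>
    (inferInstance : FiniteDimensional ℂ ((S i).restrictScalars ℂ))
  let b : ∀ i, S i ≃ₗ[ℂ] (Fin (Module.finrank ℂ (S i)) → ℂ) := fun i =>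
    (Module.finBasis ℂ (S i)).equivFun
  let τ : ∀ i, Representation ℂ G (S i) := fun i =>
    { toFun := fun g =>
        { toFun := fun x => MonoidAlgebra.single g (1 : ℂ) • x
          map_add' := smul_add _
          map_smul' := fun c x => smul_comm _ _ _ }
      map_one' := by
        ext x
        simp [← MonoidAlgebra.one_def]
      map_mul' := fun g h => by
        ext x
        simp [smul_smul]
        rfl }
  let σ : ∀ i, Representation ℂ G (Fin (Module.finrank ℂ (S i)) → ℂ) := fun i =>
    (b i).conjRingEquiv.toMonoidHom.comp (τ i)
  have hσ : ∀ i g x, σ i g (b i x) = b i (τ i g x) := fun i g x => by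
    simp [σ]
  have hτ : ∀ i, (τ i).IsIrreducible := fun i => by
    rw [Representation.irreducible_iff_isSimpleModule_asModule]
    have h := hS i
    refine IsSimpleModule.congr (N := S i) (LinearEquiv.ofBijective
      ({ toFun := fun x => (τ i).asModuleEquiv x
         map_add' := fun _ _ => rfl
         map_smul' := fun m x => ?_ } : (τ i).asModule →ₗ[ℂ[G]] S i)
      (τ i).asModuleEquiv.bijective)
    induction m using MonoidAlgebra.induction_linear with
    | zero => simp
    | add a b ha hb => rw [add_smul, map_add, ha, hb, RingHom.id_apply, RingHom.id_apply,
        RingHom.id_apply, add_smul]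
    | single g a =>
      have h1 : (MonoidAlgebra.single g a : ℂ[G]) = a • MonoidAlgebra.single g 1 := by simp
      rw [h1, RingHom.id_apply, smul_assoc, smul_assoc, map_smul]
      congr 1
      exact Representation.asModuleEquiv_map_smul _ _ _ |>.trans (by simp; rfl)
  let E : W ≃ₗ[ℂ] ∀ i, Fin (Module.finrank ℂ (S i)) → ℂ :=
    ρ.asModuleEquiv.symm ≪≫ₗ e.restrictScalars ℂ ≪≫ₗ
      (DFinsupp.linearEquivFunOnFintype (R := ℂ) (M := fun i => S i)) ≪≫ₗ LinearEquiv.piCongrRight b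
  have hE : ∀ w i, E w i = b i (e (ρ.asModuleEquiv.symm w) i) := fun w i => rfl
  refine ⟨n, _, σ, E, fun i => isIrreducible_of_equiv
    (Representation.Equiv.mk (b i) fun g => LinearMap.ext fun x => (hσ i g x).symm) (hτ i), ?_⟩
  intro g w i
  rw [hE, hE, hσ]
  congr 1
  have h1 : ρ.asModuleEquiv.symm (ρ g w) =
      (MonoidAlgebra.single g (1 : ℂ)) • ρ.asModuleEquiv.symm w := by
    simp
    rfl
  rw [h1, map_smul]
  rfl

/-- The regular representation on functions. -/
def regRep (G : Type*) [Group G] : Representation ℂ G (G → ℂ) where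
  toFun g :=
    { toFun := fun f x => f (g⁻¹ * x)
      map_add' := fun _ _ => rfl
      map_smul' := fun _ _ => rfl }
  map_one' := by
    ext f x
    simp
  map_mul' g h := by
    ext f x
    simp [mul_assoc]

theorem regRep_apply (g : G) (f : G → ℂ) (x : G) : regRep G g f x = f (g⁻¹ * x) := rfl

/-- A function in the isotypic part is freely determined by its values at the inverses of coset
representatives of `K`; the left side of the sum formula for `dim ρ · dim ρ_φ` comes from here. -/
theorem finrank_isoPart_regRep [Finite G] {K : Subgroup G} (φ : K →* ℂ) :
    Module.finrank ℂ (isoPart φ (regRep G)) = K.index := by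
  let F : isoPart φ (regRep G) →ₗ[ℂ] (G ⧸ K → ℂ) :=
    { toFun := fun f q => (f : G → ℂ) q.out⁻¹
      map_add' := fun _ _ => rfl
      map_smul' := fun _ _ => rfl }
  have hmem : ∀ f : G → ℂ, f ∈ isoPart φ (regRep G) ↔
      ∀ (k : K) (x : G), f ((x * k)⁻¹) = φ k * f x⁻¹ := by
    intro f
    constructor
    · intro h k x
      have := congrFun (h k) x⁻¹
      rw [regRep_apply] at this
      rw [mul_inv_rev, this]
      rfl
    · intro h k
      funext x
      have := h k x⁻¹
      rw [mul_inv_rev, inv_inv] at this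
      rw [regRep_apply, this]
      rfl
  have hinj : Function.Injective F := by
    intro f f' h
    ext x
    obtain ⟨k, hk⟩ := QuotientGroup.mk_out_eq_mul K x⁻¹
    have h1 := congrFun h (x⁻¹ : G)
    change (f : G → ℂ) _ = (f' : G → ℂ) _ at h1
    rw [hk, (hmem _).1 f.2, (hmem _).1 f'.2, inv_inv] at h1
    have h2 : φ k ≠ 0 := fun h0 => by
      have h3 : φ k * φ k⁻¹ = 1 := by rw [← map_mul, mul_inv_cancel, map_one]
      rw [h0, zero_mul] at h3
      exact zero_ne_one h3
    exact mul_left_cancel₀ h2 h1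
  have hsurj : Function.Surjective F := by
    intro c
    have hout : ∀ x : G, ((x : G ⧸ K).out)⁻¹ * x ∈ K := fun x =>
      QuotientGroup.eq.1 (Quotient.out_eq' (x : G ⧸ K))
    let s : G → K := fun x => ⟨_, hout x⟩
    have hcoe : ∀ (x : G) (k : K), ((x * k : G) : G ⧸ K) = x := fun x k => by
      rw [QuotientGroup.eq]
      simp
    have hs : ∀ (x : G) (k : K), s (x * k) = s x * k := fun x k => by
      ext
      simp only [s, hcoe, Subgroup.coe_mul, mul_assoc]
    have hs1 : ∀ q : G ⧸ K, s q.out = 1 := fun q => by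
      ext
      simp [s]
    refine ⟨⟨fun x => φ (s x⁻¹) * c (x⁻¹ : G), (hmem _).2 fun k x => ?_⟩, ?_⟩
    · simp only [inv_inv, hcoe, hs, map_mul]
      ring
    · funext q
      change φ (s q.out⁻¹⁻¹) * c (q.out⁻¹⁻¹ : G) = c q
      rw [inv_inv, hs1, map_one, one_mul, QuotientGroup.out_eq']
  rw [(LinearEquiv.ofBijective F ⟨hinj, hsurj⟩).finrank_eq]
  have := Fintype.ofFinite (G ⧸ K)
  simp [Subgroup.index]

theorem finrank_isoPart_eq_sum [Finite G] {K : Subgroup G} (φ : K →* ℂ) {W : Type*}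
    [AddCommGroup W] [Module ℂ W] (ρ : Representation ℂ G W) {n : ℕ} {d : Fin n → ℕ}
    (σ : ∀ i, Representation ℂ G (Fin (d i) → ℂ)) (e : W ≃ₗ[ℂ] ∀ i, Fin (d i) → ℂ)
    (he : ∀ g w i, e (ρ g w) i = σ i g (e w i)) :
    Module.finrank ℂ (isoPart φ ρ) = ∑ i, Module.finrank ℂ (isoPart φ (σ i)) := by
  have hmem : ∀ w, w ∈ isoPart φ ρ ↔ ∀ i, e w i ∈ isoPart φ (σ i) := by
    intro w
    constructor
    · intro h i k
      rw [← he, h k, map_smul]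
      rfl
    · intro h k
      apply e.injective
      funext i
      rw [he, h i k, map_smul]
      rfl
  let F : isoPart φ ρ ≃ₗ[ℂ] ∀ i, isoPart φ (σ i) :=
    { toFun := fun w i => ⟨e w i, (hmem w).1 w.2 i⟩
      map_add' := fun a b => by
        ext i : 2
        simp
      map_smul' := fun a b => by
        ext i : 2
        simp
      invFun := fun f => ⟨e.symm fun i => f i, (hmem _).2 fun i => by simp⟩
      left_inv := fun w => by
        ext
        simp
      right_inv := fun f => by
        ext i : 2
        simp }
  rw [F.finrank_eq, Module.finrank_pi_fintype]

/-- Schur's lemma in both cases. -/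
theorem finrank_intertwiningMap_eq_ite {V W : Type*} [AddCommGroup V] [Module ℂ V]
    [AddCommGroup W] [Module ℂ W] [FiniteDimensional ℂ V] [FiniteDimensional ℂ W]
    {ρ : Representation ℂ G V} {σ : Representation ℂ G W}
    (hρ : ρ.IsIrreducible) (hσ : σ.IsIrreducible) [Decidable (Nonempty (σ.Equiv ρ))] :
    Module.finrank ℂ (Representation.IntertwiningMap σ ρ) =
      if Nonempty (σ.Equiv ρ) then 1 else 0 := by
  split_ifs with h
  · obtain ⟨e⟩ := h
    let L : Representation.IntertwiningMap σ ρ ≃ₗ[ℂ] Representation.IntertwiningMap ρ ρ :=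
      { toFun := fun f => f.comp e.symm.toIntertwiningMap
        map_add' := fun _ _ => rfl
        map_smul' := fun _ _ => rfl
        invFun := fun f => f.comp e.toIntertwiningMap
        left_inv := fun f => by
          apply Representation.IntertwiningMap.ext
          ext x
          change f (e.symm (e x)) = f x
          simp
        right_inv := fun f => by
          apply Representation.IntertwiningMap.ext
          ext x
          change f (e (e.symm x)) = f x
          simp }
    rw [L.finrank_eq]
    exact Representation.IsIrreducible.finrank_intertwiningMap_self ρ
  · have : IsEmpty (σ.Equiv ρ) := not_nonempty_iff.1 h
    exact Module.finrank_zero_of_subsingleton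

open Classical in
/-- The multiplicity of an irreducible representation in the regular representation. -/
theorem finrank_eq_card_regRep [Finite G] {n : ℕ} {d : Fin n → ℕ}
    (σ : ∀ i, Representation ℂ G (Fin (d i) → ℂ)) (e : (G → ℂ) ≃ₗ[ℂ] ∀ i, Fin (d i) → ℂ)
    (hσ : ∀ i, (σ i).IsIrreducible)
    (he : ∀ g w i, e (regRep G g w) i = σ i g (e w i)) {V : Type*} [AddCommGroup V] [Module ℂ V]
    [FiniteDimensional ℂ V] {τ : Representation ℂ G V} (hτ : τ.IsIrreducible) :
    Module.finrank ℂ V = (Finset.univ.filter fun i => Nonempty ((σ i).Equiv τ)).card := by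
  have := Fintype.ofFinite G
  let δ : G → G → ℂ := fun g => Pi.single g 1
  have hδ : ∀ g, regRep G g (δ 1) = δ g := by
    intro g
    funext x
    simp [regRep_apply, δ, Pi.single_apply, inv_mul_eq_one, eq_comm]
  -- An intertwining map from the regular representation to `τ` is the same as a vector of `V`,
  -- namely its value at the delta function at `1`. Splitting the source into irreducibles and
  -- applying Schur's lemma counts the summands of type `τ`.
  let F : (∀ i, Representation.IntertwiningMap (σ i) τ) →ₗ[ℂ] V :=
    { toFun := fun f => ∑ i, f i (e (δ 1) i)
      map_add' := fun a b => by simp [Finset.sum_add_distrib]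
      map_smul' := fun a b => by simp [Finset.smul_sum] }
  have hinj : Function.Injective F := by
    rw [injective_iff_map_eq_zero]
    intro f hf
    have h1 : ∀ w : G → ℂ, ∑ i, f i (e w i) = 0 := by
      intro w
      have hw : w = ∑ g, w g • δ g := by
        funext x
        simp [δ, Pi.single_apply]
      rw [hw]
      simp only [map_sum, map_smul, Finset.sum_apply, Pi.smul_apply]
      rw [Finset.sum_comm]
      refine Finset.sum_eq_zero fun g _ => ?_
      rw [← Finset.smul_sum, ← hδ g]
      simp only [he, Representation.IntertwiningMap.isIntertwining]
      rw [← map_sum]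
      have : ∑ i, f i (e (δ 1) i) = 0 := hf
      rw [this, map_zero, smul_zero]
    funext i
    apply Representation.IntertwiningMap.ext
    refine LinearMap.ext fun x => ?_
    have h2 := h1 (e.symm (Pi.single i x))
    rw [LinearEquiv.apply_symm_apply, Finset.sum_eq_single i] at h2
    · simpa using h2
    · intro j _ hj
      rw [Pi.single_eq_of_ne hj, map_zero]
    · simp
  have hsurj : Function.Surjective F := by
    intro v
    let Φ : (G → ℂ) →ₗ[ℂ] V := Fintype.linearCombination ℂ fun g => τ g v
    have hΦ : ∀ g w, Φ (regRep G g w) = τ g (Φ w) := by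
      intro g w
      simp only [Φ, Fintype.linearCombination_apply, map_sum, map_smul, regRep_apply]
      refine Fintype.sum_equiv (Equiv.mulLeft g⁻¹) _ _ fun x => ?_
      simp [← Module.End.mul_apply, ← map_mul]
    have hs : ∀ g i x, e.symm (Pi.single i (σ i g x)) = regRep G g (e.symm (Pi.single i x)) := by
      intro g i x
      rw [LinearEquiv.symm_apply_eq]
      funext j
      rw [he, LinearEquiv.apply_symm_apply]
      by_cases hj : j = i
      · subst hj
        simp
      · simp [Pi.single_eq_of_ne hj]
    refine ⟨fun i => ⟨Φ ∘ₗ e.symm.toLinearMap ∘ₗ LinearMap.single ℂ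
        (fun i => Fin (d i) → ℂ) i, fun g => ?_⟩, ?_⟩
    · refine LinearMap.ext fun x => ?_
      change Φ (e.symm (Pi.single i (σ i g x))) = τ g (Φ (e.symm (Pi.single i x)))
      rw [hs, hΦ]
    · change ∑ i, Φ (e.symm (Pi.single i (e (δ 1) i))) = v
      rw [← map_sum, ← map_sum, Finset.univ_sum_single, LinearEquiv.symm_apply_apply]
      simp [Φ, δ]
  rw [← (LinearEquiv.ofBijective F ⟨hinj, hsurj⟩).finrank_eq, Module.finrank_pi_fintype,
    Finset.sum_congr rfl fun i _ => finrank_intertwiningMap_eq_ite hτ (hσ i), Finset.sum_boole]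
  simp

theorem finrank_isoPart_congr {K : Subgroup G} (φ : K →* ℂ) {V W : Type*} [AddCommGroup V]
    [Module ℂ V] [AddCommGroup W] [Module ℂ W] {ρ : Representation ℂ G V}
    {σ : Representation ℂ G W} (e : ρ.Equiv σ) :
    Module.finrank ℂ (isoPart φ ρ) = Module.finrank ℂ (isoPart φ σ) := by
  have h : (isoPart φ ρ).map e.toLinearEquiv.toLinearMap = isoPart φ σ := by
    have he : ∀ g v, e (ρ g v) = σ g (e v) := fun g v =>
      Representation.IntertwiningMap.isIntertwining _ _ e.toIntertwiningMap g v
    ext w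
    constructor
    · rintro ⟨v, hv, rfl⟩ k
      change σ k (e v) = φ k • e v
      rw [← he, hv k, map_smul]
    · intro hw
      refine ⟨e.symm w, fun k => ?_, e.apply_symm_apply w⟩
      apply e.toLinearEquiv.injective
      change e (ρ k (e.symm w)) = e (φ k • e.symm w)
      rw [he, map_smul, e.apply_symm_apply, hw k]
  rw [← h]
  exact (LinearEquiv.finrank_map_eq e.toLinearEquiv _).symm

open Classical in
/-- The number of irreducible representations over `φ`, bounded in terms of bounds for
`dim ρ * dim ρ_φ`. -/
theorem card_irrOver_bounds [Finite G] {K : Subgroup G} (φ : K →* ℂ) (A B : ℝ)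
    (h : ∀ (n : ℕ) (ρ : Representation ℂ G (Fin n → ℂ)), LiesOver φ ρ →
      A ≤ n * Module.finrank ℂ (isoPart φ ρ) ∧ n * Module.finrank ℂ (isoPart φ ρ) ≤ B) :
    A * Nat.card (IrrOver φ) ≤ K.index ∧ K.index ≤ B * Nat.card (IrrOver φ) := by
  obtain ⟨n, d, σ, e, hσ, he⟩ := exists_decomposition (regRep G)
  let I := {i : Fin n // isoPart φ (σ i) ≠ ⊥}
  let X := {x : Σ n : ℕ, Representation ℂ G (Fin n → ℂ) // LiesOver φ x.2}
  let s : Setoid X := irrSetoid φ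
  let cls : I → Quotient s := fun i =>
    Quotient.mk s ⟨⟨d i, σ i⟩, liesOver_iff.2 ⟨hσ i, i.2⟩⟩
  have hcls : ∀ (i : I) (x : X), cls i = Quotient.mk s x ↔ Nonempty ((σ i).Equiv x.1.2) :=
    fun i x => Quotient.eq
  have hmult : ∀ x : X, (x.1.1 : ℕ) =
      (Finset.univ.filter fun i => Nonempty ((σ i).Equiv x.1.2)).card := by
    intro x
    have := finrank_eq_card_regRep σ e hσ he x.2.1
    rwa [Module.finrank_fin_fun] at this
  have hne : ∀ (x : X) i, Nonempty ((σ i).Equiv x.1.2) → isoPart φ (σ i) ≠ ⊥ := by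
    rintro x i ⟨f⟩ hbot
    have h1 := finrank_isoPart_congr φ f
    rw [hbot, finrank_bot] at h1
    exact (liesOver_iff.1 x.2).2 (Submodule.finrank_eq_zero.1 h1.symm)
  -- A class over `φ` occurs in the regular representation as often as its dimension, so summing
  -- `dim ρ_φ` over all summands gives the sum of `dim ρ · dim ρ_φ` over the classes.
  have hfiber : ∀ x : X, (Finset.univ.filter fun i => cls i = Quotient.mk s x).card = x.1.1 := by
    intro x
    rw [hmult]
    refine Finset.card_bij (fun i _ => i.1) ?_ ?_ ?_
    · intro i hi
      simpa [hcls] using hi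
    · intro i _ j _ hij
      exact Subtype.ext hij
    · intro i hi
      have hi' : Nonempty ((σ i).Equiv x.1.2) := by simpa using hi
      exact ⟨⟨i, hne x i hi'⟩, by simpa [hcls] using hi', rfl⟩
  have hpos : ∀ x : X, 0 < x.1.1 := by
    intro x
    rw [Nat.pos_iff_ne_zero]
    intro h0
    apply (liesOver_iff.1 x.2).2
    have : IsEmpty (Fin x.1.1) := by rw [h0]; infer_instance
    have : Subsingleton (Fin x.1.1 → ℂ) := inferInstance
    exact Subsingleton.elim _ _
  have hsurj : Function.Surjective cls := by
    intro c
    induction c using Quotient.inductionOn with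
    | _ x =>
      have h1 : 0 < (Finset.univ.filter fun i => cls i = Quotient.mk s x).card := by
        rw [hfiber]
        exact hpos x
      obtain ⟨i, hi⟩ := Finset.card_pos.1 h1
      exact ⟨i, (Finset.mem_filter.1 hi).2⟩
  have hfin : Finite (Quotient s) := Finite.of_surjective cls hsurj
  have := Fintype.ofFinite (Quotient s)
  have hcard : Nat.card (IrrOver φ) = Fintype.card (Quotient s) :=
    (Nat.card_eq_fintype_card : Nat.card (Quotient s) = _)
  have hsum : (K.index : ℝ) = ∑ c : Quotient s,
      (c.out.1.1 : ℝ) * Module.finrank ℂ (isoPart φ c.out.1.2) := by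
    rw [← finrank_isoPart_regRep φ, finrank_isoPart_eq_sum φ (regRep G) σ e he]
    have h1 : ∑ i, Module.finrank ℂ (isoPart φ (σ i)) =
        ∑ i : I, Module.finrank ℂ (isoPart φ (σ i)) := by
      rw [← Finset.sum_filter_of_ne (p := fun i => isoPart φ (σ i) ≠ ⊥)
        fun i _ h0 hbot => h0 (by rw [hbot, finrank_bot])]
      exact Finset.sum_subtype _ (by simp) _
    rw [h1, ← Finset.sum_fiberwise_of_maps_to (g := cls) (t := Finset.univ) (by simp)]
    push_cast
    refine Finset.sum_congr rfl fun c _ => ?_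
    have hc : c = Quotient.mk s c.out := (Quotient.out_eq c).symm
    have h2 : ∀ i ∈ Finset.univ.filter (fun i => cls i = c),
        (Module.finrank ℂ (isoPart φ (σ i.1)) : ℝ) =
          Module.finrank ℂ (isoPart φ c.out.1.2) := by
      intro i hi
      obtain ⟨f⟩ := (hcls i c.out).1 ((Finset.mem_filter.1 hi).2.trans hc)
      rw [finrank_isoPart_congr φ f]
    rw [Finset.sum_congr rfl h2, Finset.sum_const, nsmul_eq_mul]
    congr 2
    conv_lhs => rw [hc]
    exact hfiber c.out
  rw [hcard, hsum]
  constructor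
  · rw [mul_comm, ← nsmul_eq_mul, ← Finset.card_univ, ← Finset.sum_const]
    exact Finset.sum_le_sum fun c _ => (h _ _ c.out.2).1
  · rw [mul_comm, ← nsmul_eq_mul, ← Finset.card_univ, ← Finset.sum_const]
    exact Finset.sum_le_sum fun c _ => (h _ _ c.out.2).2

end Decomposition

end SL2Growth

namespace SL2Growth

/-! ### Extensions of the character and the number of their conjugates in a representation. -/

section Extension

variable {G : Type*} [Group G] {K : Subgroup G} [K.Normal] {φ : K →* ℂ}
  {V : Type*} [AddCommGroup V] [Module ℂ V] {ρ : Representation ℂ G V}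

theorem map_mem_isoPart {g : G} (hg : g ∈ inertia K φ) {v : V} (hv : v ∈ isoPart φ ρ) :
    ρ g v ∈ isoPart φ ρ := by
  intro k
  rw [conj_mem_isoPart (MulAut.conjNormal g⁻¹ k) (by simp [mul_assoc]) hv,
    (inertia K φ).inv_mem hg k]

/-- A subgroup of the inertia group whose commutators are killed by `φ` has an eigenvector in the
`φ`-isotypic part. -/
theorem exists_eigenvector [FiniteDimensional ℂ V] (hne : isoPart φ ρ ≠ ⊥) (C : Subgroup G)
    (hC : C ≤ inertia K φ)
    (hcomm : ∀ c ∈ C, ∀ c' ∈ C, ∃ k : K, c * c' = c' * c * k ∧ φ k = 1) :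
    ∃ v ∈ isoPart φ ρ, v ≠ 0 ∧ ∃ χ : C →* ℂ, ∀ c : C, ρ (c : G) v = χ c • v := by
  obtain ⟨ξ, v, hv, hv0, hξ⟩ := exists_jointEigen_of_commute (fun c : C => ρ (c : G))
    (isoPart φ ρ) hne (fun c w hw => map_mem_isoPart (hC c.2) hw) (by
      intro c c' w hw
      obtain ⟨k, hk, hk1⟩ := hcomm c c.2 c' c'.2
      rw [← Module.End.mul_apply, ← Module.End.mul_apply, ← map_mul, ← map_mul, hk, map_mul,
        Module.End.mul_apply, hw k, hk1, one_smul])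
  refine ⟨v, hv, hv0, ⟨⟨ξ, ?_⟩, ?_⟩, hξ⟩
  · have h := hξ 1
    rw [Subgroup.coe_one, map_one, Module.End.one_apply] at h
    exact smul_left_injective ℂ hv0 (by simp only [one_smul]; exact h.symm)
  · intro c c'
    have h := hξ (c * c')
    rw [Subgroup.coe_mul, map_mul, Module.End.mul_apply, hξ c', map_smul, hξ c, smul_smul] at h
    exact smul_left_injective ℂ hv0 (by simp only [mul_comm (ξ c)]; exact h.symm)

/-- A lower bound for the dimension of the `φ`-isotypic part in terms of the stabilizer of an
extension of `φ` in an abelian group of translations. -/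
theorem exists_extension_card_le [Finite G] [FiniteDimensional ℂ V] (hne : isoPart φ ρ ≠ ⊥)
    (C : Subgroup G) (hC : C ≤ inertia K φ) (hK : K ≤ C)
    (hcomm : ∀ c ∈ C, ∀ c' ∈ C, ∃ k : K, c * c' = c' * c * k ∧ φ k = 1)
    {X Y : Type*} [AddCommGroup X] [AddCommGroup Y] [Finite Y] (h : X → G)
    (hmul : ∀ x y, h (x + y) = h x * h y) (hT : ∀ x, h x ∈ inertia K φ) (p : X →+ Y) :
    ∃ (χ : C →* ℂ) (P : AddSubgroup X), (∀ k : K, χ ⟨k, hK k.2⟩ = φ k) ∧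
      (∀ x ∈ P, ∀ d (hd : ∀ y, h y * d * (h y)⁻¹ ∈ C), ∀ hd' : d ∈ C,
        χ ⟨_, hd x⟩ = χ ⟨d, hd'⟩) ∧
      Nat.card p.range ≤ Nat.card (P.map p) * Module.finrank ℂ (isoPart φ ρ) := by
  classical
  obtain ⟨v, hv, hv0, χ, hχ⟩ := exists_eigenvector hne C hC hcomm
  have h0 : h 0 = 1 := by
    have := hmul 0 0
    rw [add_zero] at this
    exact left_eq_mul.1 this
  have hneg : ∀ x, h (-x) = (h x)⁻¹ := fun x => by
    rw [eq_inv_iff_mul_eq_one, ← hmul, neg_add_cancel, h0]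
  -- The translations need not normalize `C`. The conjugates of `χ` are compared only on the
  -- elements all of whose translates stay in `C`.
  let D := {d : G // ∀ y, h y * d * (h y)⁻¹ ∈ C}
  let ξ : X → D → ℂ := fun x d => χ ⟨_, d.2 (-x)⟩
  have hfinξ : (Set.range ξ).Finite := by
    let F : G → D → ℂ := fun g d => if hd : g⁻¹ * d * g ∈ C then χ ⟨_, hd⟩ else 0
    refine (Set.finite_range F).subset ?_
    rintro _ ⟨x, rfl⟩
    refine ⟨h x, funext fun d => ?_⟩
    have hd : (h x)⁻¹ * d * h x ∈ C := by
      have := d.2 (-x)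
      rwa [hneg, inv_inv] at this
    simp only [F, hd, dif_pos, ξ, hneg, inv_inv]
  have hfin : Finite (Set.range ξ) := hfinξ
  have hle : Nat.card (Set.range ξ) ≤ Module.finrank ℂ (isoPart φ ρ) := by
    refine card_le_finrank_of_jointEigen (fun d : D => ρ (d : G)) (fun j => j.1)
      Subtype.val_injective _ ?_
    -- `ρ (h x) v` is an eigenvector of `D` for the conjugate system `ξ x`, and it stays in the
    -- isotypic part because `h x` lies in the inertia group.
    rintro ⟨_, x, rfl⟩
    refine ⟨ρ (h x) v, fun d => ?_, map_mem_isoPart (hT x) hv, fun h1 => hv0 ?_⟩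
    · have h2 := hχ ⟨_, d.2 (-x)⟩
      simp only [hneg, inv_inv] at h2
      have h3 : ρ (d : G) (ρ (h x) v) = ρ (h x) (ρ ((h x)⁻¹ * d * h x) v) := by
        rw [← Module.End.mul_apply, ← Module.End.mul_apply, ← map_mul, ← map_mul]
        congr 2
        group
      rw [h3, h2, map_smul]
      simp only [ξ, hneg, inv_inv]
    · have := congrArg (ρ (h x)⁻¹) h1
      rwa [← Module.End.mul_apply, ← map_mul, inv_mul_cancel, map_one, Module.End.one_apply,
        map_zero] at this
  have hshift : ∀ d, (∀ y, h y * d * (h y)⁻¹ ∈ C) → ∀ x y,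
      h y * (h x * d * (h x)⁻¹) * (h y)⁻¹ ∈ C := fun d hd x y => by
    have := hd (y + x)
    rw [hmul] at this
    convert this using 1
    group
  let P : AddSubgroup X :=
    { carrier := {x : X | ∀ d (hd : ∀ y, h y * d * (h y)⁻¹ ∈ C), ∀ hd' : d ∈ C,
        χ ⟨_, hd x⟩ = χ ⟨d, hd'⟩}
      zero_mem' := fun d hd hd' => by
        congr 1
        simp [h0]
      add_mem' := fun {x y} hx hy d hd hd' => by
        rw [← hy d hd hd', ← hx _ (hshift d hd y) (hd y)]
        congr 1
        ext
        change h (x + y) * d * (h (x + y))⁻¹ = h x * (h y * d * (h y)⁻¹) * (h x)⁻¹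
        rw [hmul]
        group
      neg_mem' := fun {x} hx d hd hd' => by
        rw [← hx _ (hshift d hd (-x)) (hd (-x))]
        congr 1
        ext
        change h x * (h (-x) * d * (h (-x))⁻¹) * (h x)⁻¹ = d
        rw [hneg]
        group }
  refine ⟨χ, P, fun k => smul_left_injective ℂ hv0 ?_, fun x hx => hx, ?_⟩
  · change χ _ • v = φ k • v
    rw [← hχ, ← hv k]
  have hsub : ∀ x y, ξ x = ξ y → y - x ∈ P := by
    intro x y hxy d hd hd'
    have hd2 : ∀ z, h z * (h y * d * (h y)⁻¹) * (h z)⁻¹ ∈ C := fun z => by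
      exact hshift d hd y z
    have := congrFun hxy ⟨_, hd2⟩
    simp only [ξ] at this
    have e1 : (⟨_, hd (y - x)⟩ : C) = ⟨_, hd2 (-x)⟩ := by
      ext
      change h (y - x) * d * (h (y - x))⁻¹ = h (-x) * (h y * d * (h y)⁻¹) * (h (-x))⁻¹
      rw [sub_eq_neg_add, hmul]
      group
    have e2 : (⟨d, hd'⟩ : C) = ⟨_, hd2 (-y)⟩ := by
      ext
      change d = h (-y) * (h y * d * (h y)⁻¹) * (h (-y))⁻¹
      rw [hneg]
      group
    rw [e1, e2, this]
  have := Fintype.ofFinite p.range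
  have := Fintype.ofFinite (Set.range ξ)
  have hs : ∀ y : p.range, ∃ x, p x = y := fun y => y.2
  choose s hs using hs
  let f : p.range → Set.range ξ := fun y => ⟨ξ (s y), s y, rfl⟩
  -- Two points with the same system differ by an element of `P`, so a fibre has at most as many
  -- points as the image of `P` under `p`.
  have hfib : ∀ b ∈ Finset.univ.image f, (Finset.univ.filter fun a => f a = b).card ≤
      Nat.card (P.map p) := by
    intro b hb
    obtain ⟨a, -, rfl⟩ := Finset.mem_image.1 hb
    rw [← Fintype.card_subtype, ← Nat.card_eq_fintype_card]
    refine Nat.card_le_card_of_injective (fun y => ⟨(y.1 : Y) - a, s y.1 - s a,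
      hsub _ _ (congrArg Subtype.val y.2).symm, by rw [map_sub, hs, hs]⟩) fun y y' hyy => ?_
    have h1 := congrArg Subtype.val hyy
    exact Subtype.ext (Subtype.ext (sub_left_injective h1))
  calc Nat.card p.range = Finset.univ.card := Nat.card_eq_fintype_card
    _ ≤ Nat.card (P.map p) * (Finset.univ.image f).card :=
      Finset.card_le_mul_card_image _ _ hfib
    _ ≤ _ := by
      refine Nat.mul_le_mul_left _ (le_trans (Finset.card_le_univ _) ?_)
      rwa [← Nat.card_eq_fintype_card]

end Extension

end SL2Growth

namespace SL2Growth

/-! ### Finite chain rings and characters nontrivial on the socle. -/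

section ChainRing

/-- `p` generates the maximal ideal of a chain ring of length `r`. -/
structure IsChainRing {R : Type*} [CommRing R] (p : R) (r : ℕ) : Prop where
  pow_eq_zero : p ^ r = 0
  pow_ne_zero : ∀ n < r, p ^ n ≠ 0
  exists_unit : ∀ x : R, ∃ n ≤ r, ∃ u : Rˣ, x = u * p ^ n

namespace IsChainRing

variable {R : Type*} [CommRing R] {p : R} {r : ℕ} (h : IsChainRing p r)

include h

theorem dvd_unit_mul_iff {m n : ℕ} (hm : m ≤ r) (u : Rˣ) : p ^ m ∣ u * p ^ n ↔ m ≤ n := by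
  refine ⟨fun ⟨c, hc⟩ => ?_, fun hmn => (pow_dvd_pow p hmn).mul_left _⟩
  by_contra! hlt
  refine h.pow_ne_zero (r - 1) (by omega) ?_
  have h1 : (u : R) * p ^ (r - 1) = 0 := by
    rw [show r - 1 = n + (r - 1 - n) by omega, pow_add, ← mul_assoc, hc, mul_right_comm, ← pow_add,
      show m + (r - 1 - n) = r + (m - 1 - n) by omega, pow_add, h.pow_eq_zero, zero_mul, zero_mul]
  rwa [Units.mul_right_eq_zero] at h1

theorem eq_zero_of_dvd {x : R} {n : ℕ} (hn : r ≤ n) (hx : p ^ n ∣ x) : x = 0 := by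
  have := (pow_dvd_pow p hn).trans hx
  rwa [h.pow_eq_zero, zero_dvd_iff] at this

theorem exists_unit_of_dvd {x : R} {m : ℕ} (hm : m ≤ r) (hx : p ^ m ∣ x) :
    ∃ n, m ≤ n ∧ n ≤ r ∧ ∃ u : Rˣ, x = u * p ^ n := by
  obtain ⟨n, hn, u, rfl⟩ := h.exists_unit x
  exact ⟨n, (h.dvd_unit_mul_iff hm u).1 hx, hn, u, rfl⟩

theorem exists_unit_of_not_dvd {x : R} {m : ℕ} (hm : m ≤ r) (hx : ¬ p ^ m ∣ x) :
    ∃ n < m, ∃ u : Rˣ, x = u * p ^ n := by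
  obtain ⟨n, hn, u, rfl⟩ := h.exists_unit x
  exact ⟨n, lt_of_not_ge fun h' => hx ((h.dvd_unit_mul_iff hm u).2 h'), u, rfl⟩

theorem pow_dvd_of_mul_pow {x : R} {m n : ℕ} (hmn : m + n ≤ r) (hx : p ^ (m + n) ∣ x * p ^ n) :
    p ^ m ∣ x := by
  obtain ⟨k, hk, u, rfl⟩ := h.exists_unit x
  rw [mul_assoc, ← pow_add, h.dvd_unit_mul_iff hmn] at hx
  exact (h.dvd_unit_mul_iff (by omega) u).2 (by omega)

theorem isUnit_one_add {x : R} (hx : p ∣ x) : IsUnit (1 + x) := by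
  refine IsNilpotent.isUnit_one_add ?_
  obtain ⟨y, rfl⟩ := hx
  exact (Commute.all p y).isNilpotent_mul_right ⟨r, h.pow_eq_zero⟩

theorem isUnit_add {x y : R} (hx : p ∣ x) (hy : IsUnit y) : IsUnit (x + y) := by
  obtain ⟨u, rfl⟩ := hy
  have := (h.isUnit_one_add (hx.mul_left (↑u⁻¹ : R))).mul u.isUnit
  rwa [add_mul, one_mul, mul_comm (↑u⁻¹ : R), Units.inv_mul_cancel_right, add_comm] at this

theorem dvd_or_dvd_of_mul {x y : R} {k : ℕ} (hk : k ≤ r) (hxy : p ^ k ∣ x * y) :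
    ∃ i j, k ≤ i + j ∧ p ^ i ∣ x ∧ p ^ j ∣ y ∧ i ≤ r ∧ j ≤ r := by
  obtain ⟨i, hi, u, rfl⟩ := h.exists_unit x
  obtain ⟨j, hj, v, rfl⟩ := h.exists_unit y
  rw [mul_mul_mul_comm, ← pow_add, ← Units.val_mul, h.dvd_unit_mul_iff hk] at hxy
  exact ⟨i, j, hxy, dvd_mul_left _ _, dvd_mul_left _ _, hi, hj⟩

/-- Nondegeneracy of a character that is nontrivial on the socle. -/
theorem pow_dvd_of_addChar {ψ : AddChar R ℂ} (hψ : ψ (p ^ (r - 1)) ≠ 1) {z : R} {m : ℕ}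
    (hm : m ≤ r) (hz : ∀ y, ψ (z * (p ^ m * y)) = 1) : p ^ (r - m) ∣ z := by
  by_contra hnd
  obtain ⟨n, hn, u, rfl⟩ := h.exists_unit_of_not_dvd (by omega) hnd
  -- This argument makes the product equal to the generator `p ^ (r - 1)` of the socle; the exponent
  -- is a true difference because `n < r - m`.
  have := hz (↑u⁻¹ * p ^ (r - 1 - n - m))
  rw [show (u : R) * p ^ n * (p ^ m * (↑u⁻¹ * p ^ (r - 1 - n - m))) =
    (u * ↑u⁻¹) * p ^ (n + m + (r - 1 - n - m)) by ring, Units.mul_inv, one_mul,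
    show n + m + (r - 1 - n - m) = r - 1 by omega] at this
  exact hψ this

theorem isPrimitive {ψ : AddChar R ℂ} (hψ : ψ (p ^ (r - 1)) ≠ 1) : ψ.IsPrimitive := by
  intro a ha h1
  refine ha ?_
  have := h.pow_dvd_of_addChar hψ (z := a) (m := 0) (by omega) fun y => by
    have := DFunLike.congr_fun h1 y
    simpa using this
  exact h.eq_zero_of_dvd le_rfl this

/-- A primitive character embeds the ring into its character group; the two have equal cardinality,
so every character is a shift. -/
theorem exists_mulShift [Finite R] {ψ : AddChar R ℂ} (hψ : ψ (p ^ (r - 1)) ≠ 1) (θ : AddChar R ℂ) :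
    ∃ s, ∀ y, θ y = ψ (s * y) := by
  have := Fintype.ofFinite R
  have h1 : Function.Injective (AddChar.mulShift ψ) :=
    AddChar.to_mulShift_inj_of_isPrimitive (h.isPrimitive hψ)
  have h2 : Function.Bijective (AddChar.mulShift ψ) := by
    classical
    rw [Fintype.bijective_iff_injective_and_card]
    exact ⟨h1, (AddChar.card_eq (α := R)).symm⟩
  obtain ⟨s, hs⟩ := h2.2 θ
  exact ⟨s, fun y => by rw [← hs]; rfl⟩

/-- A function that is additive on the ideal generated by `p ^ m` is given by `ψ (s * ·)`. -/
theorem exists_mulShift_of_add [Finite R] {ψ : AddChar R ℂ} (hψ : ψ (p ^ (r - 1)) ≠ 1) (m : ℕ)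
    (θ : R → ℂ) (hθ0 : θ 0 = 1)
    (hθ : ∀ x y, p ^ m ∣ x → p ^ m ∣ y → θ (x + y) = θ x * θ y) :
    ∃ s, ∀ y, p ^ m ∣ y → θ y = ψ (s * y) := by
  obtain ⟨s, hs⟩ := h.exists_mulShift hψ
    { toFun := fun y => θ (p ^ m * y)
      map_zero_eq_one' := by rw [mul_zero, hθ0]
      map_add_eq_mul' := fun x y => by rw [mul_add, hθ _ _ (dvd_mul_right _ _) (dvd_mul_right _ _)] }
  have hs' : ∀ y, θ (p ^ m * y) = ψ (s * y) := hs
  by_cases hm : r ≤ m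
  · refine ⟨0, fun y hy => ?_⟩
    rw [h.eq_zero_of_dvd hm hy, hθ0, zero_mul, AddChar.map_zero_eq_one]
  -- The character `y ↦ θ (p ^ m * y)` is trivial on the annihilator of `p ^ m`, so its parameter is
  -- a multiple of `p ^ m`, and dividing by `p ^ m` gives the shift sought.
  have hd : p ^ m ∣ s := by
    have := h.pow_dvd_of_addChar hψ (z := s) (m := r - m) (by omega) fun y => by
      rw [← hs', ← mul_assoc, ← pow_add, show m + (r - m) = r by omega, h.pow_eq_zero, zero_mul,
        hθ0]
    rwa [show r - (r - m) = m by omega] at this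
  obtain ⟨s', rfl⟩ := hd
  refine ⟨s', ?_⟩
  rintro _ ⟨y, rfl⟩
  rw [hs']
  congr 1
  ring

end IsChainRing

end ChainRing

/-! ### The rings `o_k` as finite chain rings. -/

section OMod

variable {o : Type*} [CommRing o] [IsDomain o] [IsDiscreteValuationRing o] {ϖ : o}

theorem red_mk {k r : ℕ} (h : k ≤ r) (x : o) :
    red o h (Ideal.Quotient.mk _ x) = Ideal.Quotient.mk _ x := rfl

theorem red_surjective {k r : ℕ} (h : k ≤ r) : Function.Surjective (red o h) :=
  Ideal.Quotient.factor_surjective _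

theorem mk_eq_zero_iff (hϖ : Irreducible ϖ) {k : ℕ} {x : o} :
    (Ideal.Quotient.mk _ x : OMod o k) = 0 ↔ ϖ ^ k ∣ x := by
  rw [Ideal.Quotient.eq_zero_iff_mem, hϖ.maximalIdeal_eq, Ideal.span_singleton_pow,
    Ideal.mem_span_singleton]

theorem isChainRing_OMod (hϖ : Irreducible ϖ) (k : ℕ) :
    IsChainRing (Ideal.Quotient.mk _ ϖ : OMod o k) k where
  pow_eq_zero := by rw [← map_pow, mk_eq_zero_iff hϖ]
  pow_ne_zero n hn := by
    rw [← map_pow, Ne, mk_eq_zero_iff hϖ, pow_dvd_pow_iff hϖ.ne_zero hϖ.not_isUnit]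
    omega
  exists_unit x := by
    obtain ⟨x, rfl⟩ := Ideal.Quotient.mk_surjective x
    by_cases hx : ϖ ^ k ∣ x
    · refine ⟨k, le_rfl, 1, ?_⟩
      rw [(mk_eq_zero_iff hϖ).2 hx, ← map_pow, (mk_eq_zero_iff hϖ).2 dvd_rfl, mul_zero]
    · have hx0 : x ≠ 0 := by rintro rfl; exact hx (dvd_zero _)
      obtain ⟨n, u, rfl⟩ := IsDiscreteValuationRing.eq_unit_mul_pow_irreducible hx0 hϖ
      refine ⟨n, ?_, Units.map (Ideal.Quotient.mk _).toMonoidHom u, by simp⟩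
      by_contra! hlt
      exact hx ((pow_dvd_pow ϖ hlt.le).mul_left _)

theorem red_eq_zero_iff (hϖ : Irreducible ϖ) {k r : ℕ} (h : k ≤ r) {x : OMod o r} :
    red o h x = 0 ↔ (Ideal.Quotient.mk _ ϖ : OMod o r) ^ k ∣ x := by
  obtain ⟨x, rfl⟩ := Ideal.Quotient.mk_surjective x
  rw [red_mk, mk_eq_zero_iff hϖ]
  constructor
  · rintro ⟨y, rfl⟩
    rw [map_mul, map_pow]
    exact dvd_mul_right _ _
  · rintro ⟨y, hy⟩
    obtain ⟨y, rfl⟩ := Ideal.Quotient.mk_surjective y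
    rw [← map_pow, ← map_mul, ← sub_eq_zero, ← map_sub, mk_eq_zero_iff hϖ] at hy
    have h2 := dvd_add (dvd_mul_right (ϖ ^ k) y) ((pow_dvd_pow ϖ h).trans hy)
    rwa [add_sub_cancel] at h2

instance finite_OMod [Finite (ResidueField o)] (k : ℕ) : Finite (OMod o k) := by
  have : Finite (o ⧸ maximalIdeal o) := ‹Finite (ResidueField o)›
  exact Ideal.finite_quotient_pow (IsNoetherian.noetherian _) k

theorem card_OMod (k : ℕ) : Nat.card (OMod o k) = Nat.card (ResidueField o) ^ k := by
  have := cardQuot_pow_of_prime (S := o) (P := maximalIdeal o) (i := k)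
    (IsDiscreteValuationRing.not_a_field o)
  exact this

theorem card_dvd [Finite (ResidueField o)] (hϖ : Irreducible ϖ) {k r : ℕ} (h : k ≤ r) :
    Nat.card {x : OMod o r // (Ideal.Quotient.mk _ ϖ : OMod o r) ^ k ∣ x} =
      Nat.card (ResidueField o) ^ (r - k) := by
  have h1 := AddSubgroup.card_mul_index (red o h).toAddMonoidHom.ker
  rw [AddSubgroup.index_ker, card_OMod] at h1
  have h2 : Nat.card (red o h).toAddMonoidHom.range = Nat.card (ResidueField o) ^ k := by
    have : (red o h).toAddMonoidHom.range = ⊤ := AddMonoidHom.range_eq_top.2 (red_surjective h)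
    rw [← card_OMod, this]
    exact Nat.card_congr AddSubgroup.topEquiv.toEquiv
  have h3 : Nat.card (red o h).toAddMonoidHom.ker =
      Nat.card {x : OMod o r // (Ideal.Quotient.mk _ ϖ : OMod o r) ^ k ∣ x} :=
    Nat.card_congr (Equiv.subtypeEquivRight fun x => (red_eq_zero_iff hϖ h))
  rw [h2, h3, show Nat.card (ResidueField o) ^ r = Nat.card (ResidueField o) ^ (r - k) *
    Nat.card (ResidueField o) ^ k by rw [← pow_add]; congr 1; omega] at h1
  exact Nat.eq_of_mul_eq_mul_right (pow_pos Nat.card_pos _) h1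

theorem two_le_card [Finite (ResidueField o)] : 2 ≤ Nat.card (ResidueField o) :=
  Finite.one_lt_card

variable [CharP (ResidueField o) 2]

/-- A finite field of characteristic two is perfect, so residues have square roots. -/
theorem exists_sq_sub_dvd [Finite (ResidueField o)] (hϖ : Irreducible ϖ) (k : ℕ) (x : OMod o k) :
    ∃ y, (Ideal.Quotient.mk _ ϖ : OMod o k) ∣ x - y ^ 2 := by
  obtain ⟨x, rfl⟩ := Ideal.Quotient.mk_surjective x
  have : Finite (ResidueField o) := inferInstance
  have := Fintype.ofFinite (ResidueField o)
  obtain ⟨y, hy⟩ := FiniteField.isSquare_of_char_two (ringChar.eq (ResidueField o) 2)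
    (residue o x)
  obtain ⟨y, rfl⟩ := residue_surjective y
  refine ⟨Ideal.Quotient.mk _ y, ?_⟩
  rw [← map_pow, ← map_sub]
  refine map_dvd _ ?_
  rw [← Ideal.mem_span_singleton, ← hϖ.maximalIdeal_eq, ← residue_eq_zero_iff, map_sub, hy,
    map_pow, pow_two, sub_self]

theorem two_mem_maximalIdeal : (2 : o) ∈ maximalIdeal o := by
  rw [← residue_eq_zero_iff, map_ofNat]
  exact CharTwo.two_eq_zero

theorem ringChar_cases : ringChar o = 0 ∨ (2 : o) = 0 := by
  rcases CharP.exists o with ⟨c, hc⟩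
  obtain rfl := ringChar.eq o c
  rcases eq_or_ne (ringChar o) 0 with h | h
  · exact Or.inl h
  · right
    have h1 : ((ringChar o : ℕ) : ResidueField o) = 0 := by
      rw [← map_natCast (residue o), CharP.cast_eq_zero, map_zero]
    have h2 := (CharP.cast_eq_zero_iff (ResidueField o) 2 _).1 h1
    have h3 : (ringChar o).Prime := (CharP.char_is_prime_or_zero o _).resolve_right h
    have h4 := (Nat.prime_dvd_prime_iff_eq Nat.prime_two h3).1 h2
    have := CharP.cast_eq_zero o (ringChar o)
    rw [← h4] at this
    exact_mod_cast this

end OMod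

end SL2Growth

namespace SL2Growth

/-! ### Commutants, congruence subgroups and the characters `ψ_A`, `ψ_[A]`. -/

section Commutant

variable {S : Type*} [CommRing S]

/-- The commutant of a matrix with a unit below the diagonal is generated by the matrix. -/
theorem exists_eq_add_smul {B Z : Matrix (Fin 2) (Fin 2) S} (hB : IsUnit (B 1 0))
    (h : Z * B = B * Z) : ∃ u v : S, Z = u • (1 : Matrix (Fin 2) (Fin 2) S) + v • B := by
  obtain ⟨a, ha⟩ := hB
  have h00 := congrFun (congrFun h 0) 0
  have h10 := congrFun (congrFun h 1) 0
  simp only [Matrix.mul_apply, Fin.sum_univ_two, ← ha] at h00 h10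
  have hi : (↑a⁻¹ : S) * a = 1 := Units.inv_mul a
  refine ⟨Z 0 0 - ↑a⁻¹ * Z 1 0 * B 0 0, ↑a⁻¹ * Z 1 0, ?_⟩
  ext i j
  fin_cases i <;> fin_cases j <;> simp [← ha]
  · linear_combination (↑a⁻¹ : S) * h00 - Z 0 1 * hi
  · linear_combination -Z 1 0 * hi
  · linear_combination (↑a⁻¹ : S) * h10 + (Z 0 0 - Z 1 1) * hi

theorem commute_of_commute {B Z Z' : Matrix (Fin 2) (Fin 2) S} (hB : IsUnit (B 1 0))
    (h : Z * B = B * Z) (h' : Z' * B = B * Z') : Z * Z' = Z' * Z := by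
  obtain ⟨u, v, rfl⟩ := exists_eq_add_smul hB h
  simp only [Matrix.add_mul, Matrix.mul_add, Matrix.smul_mul, Matrix.mul_smul, Matrix.one_mul,
    Matrix.mul_one, h']

end Commutant

section Congruence

variable {o : Type*} [CommRing o] [IsLocalRing o] {r : ℕ}

theorem map_red_mul {m : ℕ} (h : m ≤ r) (X Y : Matrix (Fin 2) (Fin 2) (OMod o r)) :
    (X * Y).map (red o h) = X.map (red o h) * Y.map (red o h) := Matrix.map_mul

theorem mem_congGL_iff {i : ℕ} (h : i ≤ r) {g : GL (Fin 2) (OMod o r)} :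
    g ∈ congGL o r h ↔ (g - 1 : Matrix (Fin 2) (Fin 2) (OMod o r)).map (red o h) = 0 := by
  refine ⟨fun hg => congGL_sub_one h ⟨g, hg⟩, fun hg => ?_⟩
  rw [Matrix.map_sub _ (map_sub _), Matrix.map_one _ (map_zero _) (map_one _), sub_eq_zero] at hg
  exact Units.ext hg

theorem toGL_mem_congGL_iff {i : ℕ} (h : i ≤ r) {g : SL(2, OMod o r)} :
    Matrix.SpecialLinearGroup.toGL g ∈ congGL o r h ↔ g ∈ congSL o r h := by
  refine ⟨fun hg => ?_, fun hg => (congIncl h ⟨g, hg⟩).2⟩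
  have := congrArg Units.val (MonoidHom.mem_ker.1 hg)
  exact Subtype.ext this

theorem mem_congSL_iff {i : ℕ} (h : i ≤ r) {g : SL(2, OMod o r)} :
    g ∈ congSL o r h ↔ (g - 1 : Matrix (Fin 2) (Fin 2) (OMod o r)).map (red o h) = 0 := by
  rw [← toGL_mem_congGL_iff, mem_congGL_iff]
  rfl

variable (ψ : AddChar (OMod o r) ℂ)

theorem psiLift_apply (B : Matrix (Fin 2) (Fin 2) (OMod o r)) (m : congGL o r (ellUp_le r)) :
    psiLift ψ B m =
      ψ (B * ((m : GL (Fin 2) (OMod o r)) - 1 : Matrix (Fin 2) (Fin 2) (OMod o r))).trace := rfl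

theorem psiLift_ne_zero (B : Matrix (Fin 2) (Fin 2) (OMod o r)) (m : congGL o r (ellUp_le r)) :
    psiLift ψ B m ≠ 0 := by
  intro h
  have := map_mul (psiLift ψ B) m m⁻¹
  rw [h, zero_mul, mul_inv_cancel, map_one] at this
  exact one_ne_zero this

theorem psiLift_conj (B : Matrix (Fin 2) (Fin 2) (OMod o r)) (g : GL (Fin 2) (OMod o r))
    (m : congGL o r (ellUp_le r)) :
    psiLift ψ B (MulAut.conjNormal g m) =
      psiLift ψ ((g⁻¹ : GL (Fin 2) (OMod o r)) * B * (g : GL (Fin 2) (OMod o r))) m := by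
  rw [psiLift_apply, psiLift_apply, MulAut.conjNormal_apply]
  congr 1
  have : ((g * m * g⁻¹ : GL (Fin 2) (OMod o r)) : Matrix (Fin 2) (Fin 2) (OMod o r)) - 1 =
      g * ((m : GL (Fin 2) (OMod o r)) - 1 : Matrix (Fin 2) (Fin 2) (OMod o r)) *
        (g⁻¹ : GL (Fin 2) (OMod o r)) := by
    rw [Matrix.mul_sub, Matrix.sub_mul, Units.val_mul, Units.val_mul, Matrix.mul_one,
      ← Units.val_mul g g⁻¹, mul_inv_cancel, Units.val_one]
  rw [this, ← Matrix.mul_assoc, ← Matrix.mul_assoc, Matrix.trace_mul_comm, ← Matrix.mul_assoc,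
    ← Matrix.mul_assoc]

theorem psiLift_conj_of_mem_glCentralizer {B : Matrix (Fin 2) (Fin 2) (OMod o r)}
    {g : GL (Fin 2) (OMod o r)} (hg : g ∈ glCentralizer B) (m : congGL o r (ellUp_le r)) :
    psiLift ψ B (MulAut.conjNormal g m) = psiLift ψ B m := by
  have hg : (g : Matrix (Fin 2) (Fin 2) (OMod o r)) * B = B * g := hg
  rw [psiLift_conj, Matrix.mul_assoc, ← hg, ← Matrix.mul_assoc, ← Units.val_mul, inv_mul_cancel,
    Units.val_one, Matrix.one_mul]

theorem psiLift_conj_of_mem_congGL {B : Matrix (Fin 2) (Fin 2) (OMod o r)}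
    {g : GL (Fin 2) (OMod o r)} (hg : g ∈ congGL o r (ellUp_le r))
    (m : congGL o r (ellUp_le r)) :
    psiLift ψ B (MulAut.conjNormal g m) = psiLift ψ B m := by
  have : MulAut.conjNormal g m = (⟨g, hg⟩ : congGL o r (ellUp_le r)) * m * ⟨g, hg⟩⁻¹ := by
    ext1
    simp
  rw [this, map_mul, map_mul, mul_right_comm, ← map_mul, mul_inv_cancel, map_one, one_mul]

theorem psiLift_conj_of_mem_sup {B : Matrix (Fin 2) (Fin 2) (OMod o r)}
    {g : GL (Fin 2) (OMod o r)} (hg : g ∈ glCentralizer B ⊔ congGL o r (ellUp_le r))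
    (m : congGL o r (ellUp_le r)) :
    psiLift ψ B (MulAut.conjNormal g m) = psiLift ψ B m := by
  obtain ⟨z, hz, k, hk, rfl⟩ := Subgroup.mem_sup_of_normal_right.1 hg
  rw [map_mul, MulAut.mul_apply, psiLift_conj_of_mem_glCentralizer ψ hz,
    psiLift_conj_of_mem_congGL ψ hk]

theorem mem_stabSL_iff {B : Matrix (Fin 2) (Fin 2) (OMod o r)} {g : SL(2, OMod o r)} :
    g ∈ stabSL ψ (B.map (red o (ellDown_le r))) ↔ ∀ m : congGL o r (ellUp_le r),
      psiLift ψ B (MulAut.conjNormal (Matrix.SpecialLinearGroup.toGL g) m) = psiLift ψ B m := by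
  rw [← psi_eq_psiLift ψ (A := B.map (red o (ellDown_le r))) rfl]
  rfl

theorem psiBracket_apply (B : Matrix (Fin 2) (Fin 2) (OMod o r)) (k : congSL o r (ellUp_le r)) :
    psiBracket ψ (B.map (red o (ellDown_le r))) k = psiLift ψ B (congIncl _ k) := by
  rw [← psi_eq_psiLift ψ (A := B.map (red o (ellDown_le r))) rfl]
  rfl

theorem coe_congIncl (k : congSL o r (ellUp_le r)) :
    (congIncl (ellUp_le r) k : GL (Fin 2) (OMod o r)) =
      Matrix.SpecialLinearGroup.toGL (k : SL(2, OMod o r)) := rfl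

theorem congIncl_conj (g : SL(2, OMod o r)) (k : congSL o r (ellUp_le r)) :
    congIncl (ellUp_le r) (MulAut.conjNormal g k) =
      MulAut.conjNormal (Matrix.SpecialLinearGroup.toGL g) (congIncl _ k) := by
  refine Subtype.ext ?_
  rw [coe_congIncl, MulAut.conjNormal_apply, MulAut.conjNormal_apply, coe_congIncl, map_mul,
    map_mul, map_inv]

theorem mem_inertia_psiBracket_iff {B : Matrix (Fin 2) (Fin 2) (OMod o r)} {g : SL(2, OMod o r)} :
    g ∈ inertia _ (psiBracket ψ (B.map (red o (ellDown_le r)))) ↔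
      ∀ k : congSL o r (ellUp_le r),
      psiLift ψ B (MulAut.conjNormal (Matrix.SpecialLinearGroup.toGL g) (congIncl _ k)) =
        psiLift ψ B (congIncl _ k) := by
  refine forall_congr' fun k => ?_
  rw [psiBracket_apply, psiBracket_apply, congIncl_conj]

theorem stabSL_le_inertia (B : Matrix (Fin 2) (Fin 2) (OMod o r)) :
    stabSL ψ (B.map (red o (ellDown_le r))) ≤
      inertia _ (psiBracket ψ (B.map (red o (ellDown_le r)))) := fun g hg => by
  rw [mem_stabSL_iff] at hg
  rw [mem_inertia_psiBracket_iff]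
  exact fun k => hg _

theorem centSL_le_stabSL (B : Matrix (Fin 2) (Fin 2) (OMod o r)) :
    centSL B ≤ stabSL ψ (B.map (red o (ellDown_le r))) := fun g hg => by
  rw [mem_stabSL_iff]
  exact psiLift_conj_of_mem_sup ψ hg

theorem congSL_le_centSL (B : Matrix (Fin 2) (Fin 2) (OMod o r)) :
    congSL o r (ellUp_le r) ≤ centSL B := fun g hg => by
  rw [← toGL_mem_congGL_iff] at hg
  exact Subgroup.mem_sup_right hg

/-- Write the elements as `z m` and `z' m'` with `z`, `z'` in the commutant, which is commutative.
Their commutator is a product of conjugates of `m`, `m'` and their inverses; since `ψ_B` is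
invariant under `z` and `z'`, the values cancel. This is what lets φ extend to `centSL B` on an
eigenvector. -/
theorem exists_commutator_centSL {B : Matrix (Fin 2) (Fin 2) (OMod o r)} (hB : IsUnit (B 1 0)) :
    ∀ c ∈ centSL B, ∀ c' ∈ centSL B, ∃ k : congSL o r (ellUp_le r), c * c' = c' * c * k ∧
      psiBracket ψ (B.map (red o (ellDown_le r))) k = 1 := by
  intro c hc c' hc'
  obtain ⟨z, hz, m, hm, hzm⟩ := Subgroup.mem_sup_of_normal_right.1 hc
  obtain ⟨z', hz', m', hm', hzm'⟩ := Subgroup.mem_sup_of_normal_right.1 hc'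
  have hzz : z * z' = z' * z := Units.ext (commute_of_commute hB hz hz')
  set n : congGL o r (ellUp_le r) := ⟨m, hm⟩ with hn
  set n' : congGL o r (ellUp_le r) := ⟨m', hm'⟩ with hn'
  set j : congGL o r (ellUp_le r) :=
    n⁻¹ * (MulAut.conjNormal z⁻¹ n'⁻¹) * (MulAut.conjNormal z'⁻¹ n) * n' with hj
  have hjk : (j : GL (Fin 2) (OMod o r)) = Matrix.SpecialLinearGroup.toGL (c⁻¹ * c'⁻¹ * (c * c')) := by
    simp only [map_mul, map_inv]
    rw [← hzm, ← hzm']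
    simp only [hj, hn, hn', Subgroup.coe_mul, MulAut.conjNormal_apply, Subgroup.coe_inv]
    have h2 : z⁻¹ * z'⁻¹ * z = z'⁻¹ := by
      rw [(show Commute z z' from hzz).inv_inv.eq, mul_assoc, inv_mul_cancel, mul_one]
    calc m⁻¹ * (z⁻¹ * m'⁻¹ * z⁻¹⁻¹) * (z'⁻¹ * m * z'⁻¹⁻¹) * m'
        = m⁻¹ * z⁻¹ * m'⁻¹ * z * z'⁻¹ * m * z' * m' := by group
      _ = m⁻¹ * z⁻¹ * m'⁻¹ * z * (z⁻¹ * z'⁻¹ * z) * m * z' * m' := by rw [h2]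
      _ = _ := by group
  refine ⟨⟨c⁻¹ * c'⁻¹ * (c * c'), ?_⟩, ?_, ?_⟩
  · rw [← toGL_mem_congGL_iff, ← hjk]
    exact j.2
  · change c * c' = c' * c * (c⁻¹ * c'⁻¹ * (c * c'))
    group
  · have hk : congIncl (ellUp_le r) ⟨c⁻¹ * c'⁻¹ * (c * c'), by
        rw [← toGL_mem_congGL_iff, ← hjk]; exact j.2⟩ = j := by
      ext1
      exact hjk.symm
    rw [psiBracket_apply, hk, hj, map_mul, map_mul, map_mul,
      psiLift_conj_of_mem_glCentralizer ψ ((glCentralizer B).inv_mem hz),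
      psiLift_conj_of_mem_glCentralizer ψ ((glCentralizer B).inv_mem hz'),
      ← map_mul, ← map_mul, ← map_mul, show n⁻¹ * n'⁻¹ * n * n' = (n' * n)⁻¹ * (n * n') by group,
      map_mul, map_mul (psiLift ψ B) n, mul_comm (psiLift ψ B n), ← map_mul, ← map_mul,
      inv_mul_cancel, map_one]

/-- Products of two entries of `m - 1` lie in `℘^(2ℓ)`, which is zero in `o_r`, so the determinant
is linear on `M^ℓ`. -/
theorem trace_eq_det_sub_one {m : GL (Fin 2) (OMod o r)} (hm : m ∈ congGL o r (ellUp_le r)) :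
    (m - 1 : Matrix (Fin 2) (Fin 2) (OMod o r)).trace =
      (m : Matrix (Fin 2) (Fin 2) (OMod o r)).det - 1 := by
  rw [mem_congGL_iff] at hm
  have h : ∀ i j i' j', (m - 1 : Matrix (Fin 2) (Fin 2) (OMod o r)) i j *
      (m - 1 : Matrix (Fin 2) (Fin 2) (OMod o r)) i' j' = 0 := fun i j i' j' =>
    red_mul_eq_zero (ellUp_le r) (ellUp_le r) (by unfold ellUp; omega)
      (congrFun (congrFun hm i) j) (congrFun (congrFun hm i') j')
  have h1 := h 0 0 1 1
  have h2 := h 0 1 1 0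
  simp only [Matrix.sub_apply, Matrix.one_apply, zero_ne_one, one_ne_zero, if_true, if_false, sub_zero] at h1 h2
  rw [Matrix.trace_fin_two, Matrix.det_fin_two, Matrix.sub_apply, Matrix.sub_apply]
  simp only [Matrix.one_apply, if_true]
  linear_combination -h1 + h2

/-- Adding a scalar matrix does not change `ψ_[A]`. -/
theorem psiBracket_add_smul_one (B : Matrix (Fin 2) (Fin 2) (OMod o r)) (s : OMod o r) :
    psiBracket ψ ((B + s • (1 : Matrix (Fin 2) (Fin 2) (OMod o r))).map (red o (ellDown_le r))) =
      psiBracket ψ (B.map (red o (ellDown_le r))) := by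
  ext k
  rw [psiBracket_apply, psiBracket_apply, psiLift_apply, psiLift_apply, Matrix.add_mul,
    Matrix.trace_add, Matrix.smul_mul, Matrix.one_mul, Matrix.trace_smul,
    trace_eq_det_sub_one (congIncl (ellUp_le r) k).2]
  have : ((congIncl (ellUp_le r) k : GL (Fin 2) (OMod o r)) :
      Matrix (Fin 2) (Fin 2) (OMod o r)).det = 1 := (k : SL(2, OMod o r)).2
  rw [this, sub_self, smul_zero, add_zero]

end Congruence

end SL2Growth

namespace SL2Growth

/-! ### Explicit elements of the groups and the stabilizers of the characters. -/

section Elements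

variable {o : Type*} [CommRing o] [IsLocalRing o] {r : ℕ}

/-- The element `1 + Y` of `M^ℓ`. -/
def oneAddGL (Y : Matrix (Fin 2) (Fin 2) (OMod o r)) (hY : Y.map (red o (ellUp_le r)) = 0) :
    congGL o r (ellUp_le r) :=
  ⟨⟨1 + Y, 1 - Y, by
      have h := red_matrix_mul_eq_zero (ellUp_le r) (ellUp_le r) (by unfold ellUp; omega) hY hY
      rw [Matrix.add_mul, Matrix.mul_sub, Matrix.mul_sub, h]
      simp, by
      have h := red_matrix_mul_eq_zero (ellUp_le r) (ellUp_le r) (by unfold ellUp; omega) hY hY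
      rw [Matrix.sub_mul, Matrix.mul_add, Matrix.mul_add, h]
      simp⟩, by
    rw [mem_congGL_iff]
    simpa using hY⟩

theorem coe_oneAddGL (Y : Matrix (Fin 2) (Fin 2) (OMod o r))
    (hY : Y.map (red o (ellUp_le r)) = 0) :
    ((oneAddGL Y hY : GL (Fin 2) (OMod o r)) : Matrix (Fin 2) (Fin 2) (OMod o r)) = 1 + Y := rfl

/-- The element `1 + Y` of `K^ℓ` for `Y` of trace zero. -/
def oneAddSL (Y : Matrix (Fin 2) (Fin 2) (OMod o r)) (hY : Y.map (red o (ellUp_le r)) = 0)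
    (htr : Y.trace = 0) : congSL o r (ellUp_le r) :=
  ⟨(⟨1 + Y, by
      have h := trace_eq_det_sub_one (oneAddGL Y hY).2
      rw [coe_oneAddGL, add_sub_cancel_left, htr] at h
      exact (sub_eq_zero.1 h.symm)⟩ : SL(2, OMod o r)), (mem_congSL_iff _).2 (by
    change (1 + Y - 1 : Matrix (Fin 2) (Fin 2) (OMod o r)).map (red o (ellUp_le r)) = 0
    rwa [add_sub_cancel_left])⟩

theorem congIncl_oneAddSL (Y : Matrix (Fin 2) (Fin 2) (OMod o r))
    (hY : Y.map (red o (ellUp_le r)) = 0) (htr : Y.trace = 0) :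
    congIncl (ellUp_le r) (oneAddSL Y hY htr) = oneAddGL Y hY :=
  Subtype.ext (Units.ext rfl)

theorem psiLift_oneAddGL (ψ : AddChar (OMod o r) ℂ) (B Y : Matrix (Fin 2) (Fin 2) (OMod o r))
    (hY : Y.map (red o (ellUp_le r)) = 0) :
    psiLift ψ B (oneAddGL Y hY) = ψ (B * Y).trace := by
  rw [psiLift_apply, coe_oneAddGL, add_sub_cancel_left]

/-- The unipotent element with the entry `x` above the diagonal. -/
def unipotent {S : Type*} [CommRing S] (x : S) : SL(2, S) :=
  ⟨!![1, x; 0, 1], by simp [Matrix.det_fin_two]⟩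

theorem coe_unipotent {S : Type*} [CommRing S] (x : S) :
    (unipotent x : Matrix (Fin 2) (Fin 2) S) = !![1, x; 0, 1] := rfl

theorem unipotent_add {S : Type*} [CommRing S] (x y : S) :
    unipotent (x + y) = unipotent x * unipotent y := by
  ext i j
  rw [Matrix.SpecialLinearGroup.coe_mul, coe_unipotent, coe_unipotent, coe_unipotent]
  fin_cases i <;> fin_cases j <;> simp [Matrix.mul_apply, add_comm]

theorem unipotent_inv {S : Type*} [CommRing S] (x : S) :
    (unipotent x)⁻¹ = unipotent (-x) := by
  rw [inv_eq_iff_mul_eq_one, ← unipotent_add, add_neg_cancel]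
  ext i j
  rw [coe_unipotent]
  fin_cases i <;> fin_cases j <;> simp

theorem unipotent_inv_mul_mul {S : Type*} [CommRing S] (B : Matrix (Fin 2) (Fin 2) S) (a : Sˣ)
    (ha : B 1 0 = a) (x : S) :
    ((unipotent (↑a⁻¹ * x))⁻¹ : SL(2, S)) * B * (unipotent (↑a⁻¹ * x) : SL(2, S)) =
      B - x • (1 : Matrix (Fin 2) (Fin 2) S) -
        !![0, ↑a⁻¹ * (x * (x + (B 1 1 - B 0 0))); 0, -(2 * x)] := by
  have hi : (↑a⁻¹ : S) * a = 1 := Units.inv_mul a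
  rw [unipotent_inv, coe_unipotent, coe_unipotent]
  ext i j
  fin_cases i <;> fin_cases j <;> simp [Matrix.mul_apply, Matrix.vecMul, dotProduct, Fin.sum_univ_two, ha]
  · linear_combination -x * hi
  · linear_combination (-↑a⁻¹ * x ^ 2 : S) * hi
  · ring

end Elements

section Stabilizers

variable {o : Type*} [CommRing o] [IsDomain o] [IsDiscreteValuationRing o] {ϖ : o} {r : ℕ}
  {ψ : AddChar (OMod o r) ℂ}

/-- The annihilator of `℘^ℓ` under the pairing given by `ψ` is `℘^(r-ℓ) = ℘^ℓ'`. -/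
theorem red_eq_zero_of_addChar (hϖ : Irreducible ϖ)
    (hψ : ψ (Ideal.Quotient.mk _ (ϖ ^ (r - 1))) ≠ 1) {z : OMod o r}
    (hz : ∀ y, red o (ellUp_le r) y = 0 → ψ (z * y) = 1) : red o (ellDown_le r) z = 0 := by
  rw [map_pow] at hψ
  have := (isChainRing_OMod hϖ r).pow_dvd_of_addChar hψ (z := z) (ellUp_le r) fun y => hz _ (by
    rw [red_eq_zero_iff hϖ]
    exact dvd_mul_right _ _)
  rw [red_eq_zero_iff hϖ]
  rwa [show r - ellUp r = ellDown r by unfold ellUp ellDown; omega] at this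

theorem psiLift_eq_iff (B Z : Matrix (Fin 2) (Fin 2) (OMod o r)) (m : congGL o r (ellUp_le r)) :
    psiLift ψ Z m = psiLift ψ B m ↔ psiLift ψ (Z - B) m = 1 := by
  rw [psiLift_apply, psiLift_apply, psiLift_apply, Matrix.sub_mul, Matrix.trace_sub,
    AddChar.map_sub_eq_div, div_eq_one_iff_eq]
  exact psiLift_ne_zero ψ B m

theorem map_red_eq_of_psiLift (hϖ : Irreducible ϖ)
    (hψ : ψ (Ideal.Quotient.mk _ (ϖ ^ (r - 1))) ≠ 1) {B Z : Matrix (Fin 2) (Fin 2) (OMod o r)}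
    (h : ∀ m : congGL o r (ellUp_le r), psiLift ψ Z m = psiLift ψ B m) :
    Z.map (red o (ellDown_le r)) = B.map (red o (ellDown_le r)) := by
  rw [← sub_eq_zero, ← Matrix.map_sub _ (map_sub _)]
  ext i j
  refine red_eq_zero_of_addChar hϖ hψ fun y hy => ?_
  have := (psiLift_eq_iff B Z _).1 (h (oneAddGL (Matrix.single j i y) (by
    ext i' j'
    simp [Matrix.single_apply, apply_ite, hy])))
  rwa [psiLift_oneAddGL, Matrix.trace_mul_single] at this

/-- The trace form identifies the dual of the trace-zero matrices with matrices modulo scalars.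
Testing on the three standard trace-zero matrices shows that `Z - B` is scalar modulo `℘^ℓ'`. -/
theorem exists_map_red_eq_of_psiLift (hϖ : Irreducible ϖ)
    (hψ : ψ (Ideal.Quotient.mk _ (ϖ ^ (r - 1))) ≠ 1) {B Z : Matrix (Fin 2) (Fin 2) (OMod o r)}
    (h : ∀ k : congSL o r (ellUp_le r), psiLift ψ Z (congIncl _ k) = psiLift ψ B (congIncl _ k)) :
    ∃ x : OMod o r, Z.map (red o (ellDown_le r)) =
      (B + x • (1 : Matrix (Fin 2) (Fin 2) (OMod o r))).map (red o (ellDown_le r)) := by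
  have key : ∀ Y (hY : Y.map (red o (ellUp_le r)) = 0) (htr : Y.trace = 0),
      ψ ((Z - B) * Y).trace = 1 := fun Y hY htr => by
    have := (psiLift_eq_iff B Z _).1 (h (oneAddSL Y hY htr))
    rwa [congIncl_oneAddSL, psiLift_oneAddGL] at this
  have h01 : red o (ellDown_le r) ((Z - B) 0 1) = 0 := red_eq_zero_of_addChar hϖ hψ fun y hy => by
    have := key !![0, 0; y, 0] (by ext i j; fin_cases i <;> fin_cases j <;> simp [hy]) (by
      simp [Matrix.trace_fin_two])
    simpa [Matrix.trace_fin_two, Matrix.mul_apply] using this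
  have h10 : red o (ellDown_le r) ((Z - B) 1 0) = 0 := red_eq_zero_of_addChar hϖ hψ fun y hy => by
    have := key !![0, y; 0, 0] (by ext i j; fin_cases i <;> fin_cases j <;> simp [hy]) (by
      simp [Matrix.trace_fin_two])
    simpa [Matrix.trace_fin_two, Matrix.mul_apply] using this
  have h11 : red o (ellDown_le r) ((Z - B) 0 0 - (Z - B) 1 1) = 0 :=
    red_eq_zero_of_addChar hϖ hψ fun y hy => by
    have := key !![y, 0; 0, -y] (by ext i j; fin_cases i <;> fin_cases j <;> simp [hy]) (by
      simp [Matrix.trace_fin_two])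
    rw [sub_mul, sub_eq_add_neg, ← mul_neg]
    simpa [Matrix.trace_fin_two, Matrix.mul_apply] using this
  refine ⟨(Z - B) 0 0, ?_⟩
  rw [← sub_eq_zero, ← Matrix.map_sub _ (map_sub _)]
  simp only [Matrix.sub_apply, map_sub] at h01 h10 h11
  ext i j
  fin_cases i <;> fin_cases j <;> simp [h01, h10]
  linear_combination -h11

theorem coe_toGL_inv (g : SL(2, OMod o r)) :
    (((Matrix.SpecialLinearGroup.toGL g)⁻¹ : GL (Fin 2) (OMod o r)) :
      Matrix (Fin 2) (Fin 2) (OMod o r)) = (g⁻¹ : SL(2, OMod o r)) := by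
  rw [← map_inv]
  rfl

theorem mem_stabSL_iff_map (hϖ : Irreducible ϖ)
    (hψ : ψ (Ideal.Quotient.mk _ (ϖ ^ (r - 1))) ≠ 1) {B : Matrix (Fin 2) (Fin 2) (OMod o r)}
    {g : SL(2, OMod o r)} :
    g ∈ stabSL ψ (B.map (red o (ellDown_le r))) ↔
      ((g⁻¹ : SL(2, OMod o r)) * B * (g : SL(2, OMod o r)) :
        Matrix (Fin 2) (Fin 2) (OMod o r)).map (red o (ellDown_le r)) =
      B.map (red o (ellDown_le r)) := by
  rw [mem_stabSL_iff]
  simp only [psiLift_conj, coe_toGL_inv]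
  refine ⟨fun h => map_red_eq_of_psiLift hϖ hψ h, fun h m => ?_⟩
  exact DFunLike.congr_fun (psiLift_congr ψ h) m

theorem mem_inertia_iff_map (hϖ : Irreducible ϖ)
    (hψ : ψ (Ideal.Quotient.mk _ (ϖ ^ (r - 1))) ≠ 1) {B : Matrix (Fin 2) (Fin 2) (OMod o r)}
    {g : SL(2, OMod o r)} :
    g ∈ inertia _ (psiBracket ψ (B.map (red o (ellDown_le r)))) ↔
      ∃ x : OMod o r, ((g⁻¹ : SL(2, OMod o r)) * B * (g : SL(2, OMod o r)) :
        Matrix (Fin 2) (Fin 2) (OMod o r)).map (red o (ellDown_le r)) =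
      (B + x • (1 : Matrix (Fin 2) (Fin 2) (OMod o r))).map (red o (ellDown_le r)) := by
  rw [mem_inertia_psiBracket_iff]
  simp only [psiLift_conj, coe_toGL_inv]
  refine ⟨fun h => exists_map_red_eq_of_psiLift hϖ hψ h, fun ⟨x, h⟩ k => ?_⟩
  have := DFunLike.congr_fun (psiLift_congr ψ h) (congIncl _ k)
  refine this.trans ?_
  rw [← psiBracket_apply, psiBracket_add_smul_one, psiBracket_apply]

end Stabilizers

end SL2Growth

namespace SL2Growth

/-! ### The scalars `x` with B conjugate to `B + x`, and the order of the inertia group. -/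

section Translations

variable {o : Type*} [CommRing o] [IsLocalRing o] {r : ℕ}

/-- The additive group of the `x` with `2 x = 0` and `x (x + β) = 0` modulo `℘^ℓ'`. -/
def translations (β : OMod o r) : AddSubgroup (OMod o r) where
  carrier := {x | red o (ellDown_le r) (2 * x) = 0 ∧ red o (ellDown_le r) (x * (x + β)) = 0}
  add_mem' := by
    rintro x y ⟨hx, hx'⟩ ⟨hy, hy'⟩
    refine ⟨by rw [mul_add, map_add, hx, hy, add_zero], ?_⟩
    have : (x + y) * (x + y + β) = x * (x + β) + y * (y + β) + 2 * x * y := by ring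
    rw [this, map_add, map_add, map_mul _ (2 * x), hx, hx', hy']
    simp
  zero_mem' := by simp
  neg_mem' := by
    rintro x ⟨hx, hx'⟩
    refine ⟨by rw [mul_neg, map_neg, hx, neg_zero], ?_⟩
    have : -x * (-x + β) = 2 * x * x - x * (x + β) := by ring
    rw [this, map_sub, map_mul, hx, hx']
    simp

theorem mem_translations {β x : OMod o r} : x ∈ translations β ↔
    red o (ellDown_le r) (2 * x) = 0 ∧ red o (ellDown_le r) (x * (x + β)) = 0 := Iff.rfl

theorem card_groupH (a : (OMod o r)ˣ) (β : OMod o r) :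
    Nat.card (groupH a β) = Nat.card (translations β) := by
  symm
  refine Nat.card_congr (Equiv.ofBijective (fun x => ⟨unipotent ((↑a⁻¹ : OMod o r) * x),
    x.1, x.2.1, x.2.2, coe_unipotent _⟩) ⟨fun x y hxy => ?_, fun g => ?_⟩)
  · have h1 := congrArg (fun g : SL(2, OMod o r) => (g : Matrix (Fin 2) (Fin 2) (OMod o r)) 0 1)
      (congrArg Subtype.val hxy)
    have h2 : (↑a⁻¹ : OMod o r) * x = ↑a⁻¹ * y := h1
    exact Subtype.ext ((Units.mul_right_inj _).1 h2)
  · obtain ⟨g, x, hx, hx', hg⟩ := g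
    exact ⟨⟨x, hx, hx'⟩, Subtype.ext (Subtype.ext hg.symm)⟩

theorem ker_red_le_translations (β : OMod o r) :
    (red o (ellDown_le r)).toAddMonoidHom.ker ≤ translations β := fun x hx => by
  have hx : red o (ellDown_le r) x = 0 := hx
  exact ⟨by rw [map_mul, hx, mul_zero], by rw [map_mul, hx, zero_mul]⟩

theorem map_red_unipotent_conj {B : Matrix (Fin 2) (Fin 2) (OMod o r)}
    {a : (OMod o r)ˣ} (ha : B 1 0 = a) {x : OMod o r} (hx : x ∈ translations (B 1 1 - B 0 0)) :
    ((((unipotent (↑a⁻¹ * x))⁻¹ : SL(2, OMod o r)) : Matrix (Fin 2) (Fin 2) (OMod o r)) * B *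
      (unipotent (↑a⁻¹ * x) : SL(2, OMod o r))).map (red o (ellDown_le r)) =
      (B + (-x) • (1 : Matrix (Fin 2) (Fin 2) (OMod o r))).map (red o (ellDown_le r)) := by
  rw [unipotent_inv_mul_mul B a ha]
  rw [← sub_eq_zero, ← Matrix.map_sub _ (map_sub _)]
  obtain ⟨h1, h2⟩ := hx
  ext i j
  fin_cases i <;> fin_cases j <;> simp
  · ring
  · rw [← map_sub, ← map_add, ← map_mul, h2, mul_zero]
  · rw [map_mul] at h1
    linear_combination h1

/-- Conjugation preserves trace and determinant, while adding the scalar `x` changes them by `2x`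
and `x (x + tr B)`. -/
theorem mem_translations_of_map_eq {B : Matrix (Fin 2) (Fin 2) (OMod o r)} {g : SL(2, OMod o r)}
    {x : OMod o r} (h : ((g⁻¹ : SL(2, OMod o r)) * B * (g : SL(2, OMod o r)) :
        Matrix (Fin 2) (Fin 2) (OMod o r)).map (red o (ellDown_le r)) =
      (B + x • (1 : Matrix (Fin 2) (Fin 2) (OMod o r))).map (red o (ellDown_le r))) :
    x ∈ translations B.trace := by
  have hdet : ((g⁻¹ : SL(2, OMod o r)) * B * (g : SL(2, OMod o r)) :
        Matrix (Fin 2) (Fin 2) (OMod o r)).det = B.det := by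
    rw [Matrix.det_mul, Matrix.det_mul, Matrix.SpecialLinearGroup.det_coe,
      Matrix.SpecialLinearGroup.det_coe, one_mul, mul_one]
  have htr : ((g⁻¹ : SL(2, OMod o r)) * B * (g : SL(2, OMod o r)) :
        Matrix (Fin 2) (Fin 2) (OMod o r)).trace = B.trace := by
    rw [Matrix.trace_mul_comm, ← Matrix.mul_assoc, ← Matrix.SpecialLinearGroup.coe_mul,
      mul_inv_cancel, Matrix.SpecialLinearGroup.coe_one, Matrix.one_mul]
  have e1 := congrArg Matrix.det h
  have e2 := congrArg Matrix.trace h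
  have d : ∀ X : Matrix (Fin 2) (Fin 2) (OMod o r), (X.map (red o (ellDown_le r))).det =
    red o (ellDown_le r) X.det := fun X => (RingHom.map_det _ X).symm
  have t : ∀ X : Matrix (Fin 2) (Fin 2) (OMod o r), (X.map (red o (ellDown_le r))).trace =
    red o (ellDown_le r) X.trace := fun X => by simp [Matrix.trace_fin_two]
  rw [d, d, hdet] at e1
  rw [t, t, htr] at e2
  simp only [Matrix.det_fin_two, Matrix.trace_fin_two, Matrix.add_apply, Matrix.smul_apply,
    Matrix.one_apply, smul_eq_mul, if_true, zero_ne_one, one_ne_zero, if_false, mul_one, mul_zero,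
    add_zero] at e1 e2
  rw [← sub_eq_zero, ← map_sub] at e1 e2
  refine mem_translations.2 ⟨?_, ?_⟩
  · rw [← neg_eq_zero, ← map_neg, ← e2]
    congr 1
    ring
  · rw [← neg_eq_zero, ← map_neg, ← e1, Matrix.trace_fin_two]
    congr 1
    ring

end Translations

section Counting

variable {o : Type*} [CommRing o] [IsDomain o] [IsDiscreteValuationRing o]
  {ϖ : o} {r : ℕ} {ψ : AddChar (OMod o r) ℂ}

theorem card_eq_card_map_red_mul [Finite (ResidueField o)] (hϖ : Irreducible ϖ) {k : ℕ} (hk : k ≤ r)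
    (X : AddSubgroup (OMod o r)) (hX : (red o hk).toAddMonoidHom.ker ≤ X) :
    Nat.card X = Nat.card (X.map (red o hk).toAddMonoidHom) *
      Nat.card (ResidueField o) ^ (r - k) := by
  have h1 := AddSubgroup.card_mul_index ((red o hk).toAddMonoidHom.comp X.subtype).ker
  rw [AddSubgroup.index_ker, mul_comm] at h1
  have h2 : ((red o hk).toAddMonoidHom.comp X.subtype).range =
      X.map (red o hk).toAddMonoidHom := by
    rw [AddMonoidHom.range_comp, AddSubgroup.range_subtype]
  rw [← h1, h2, ← card_dvd hϖ hk]
  congr 1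
  refine Nat.card_congr
    { toFun := fun x => ⟨x.1, (red_eq_zero_iff hϖ hk).1 x.2⟩
      invFun := fun x => ⟨⟨x.1, hX ((red_eq_zero_iff hϖ hk).2 x.2)⟩,
        (red_eq_zero_iff hϖ hk).2 x.2⟩
      left_inv := fun x => rfl
      right_inv := fun x => rfl }

theorem card_translations [Finite (ResidueField o)] (hϖ : Irreducible ϖ) (β : OMod o r) :
    Nat.card (translations β) =
      Nat.card ((translations β).map (red o (ellDown_le r)).toAddMonoidHom) *
        Nat.card (ResidueField o) ^ ellUp r := by
  rw [card_eq_card_map_red_mul hϖ (ellDown_le r) _ (ker_red_le_translations β)]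
  congr 2
  unfold ellDown ellUp
  omega

instance finite_SL2 [Finite (ResidueField o)] : Finite (SL(2, OMod o r)) :=
  Finite.of_injective (fun g => (g : Matrix (Fin 2) (Fin 2) (OMod o r))) Subtype.val_injective

/-- Sending `g` to the scalar `x` with `g⁻¹ B g ≡ B + x` is a homomorphism on the inertia group. Its
kernel is the stabilizer of `ψ_A`, and its image consists of all translations, since unipotent
matrices realise each of them. -/
theorem card_inertia (hϖ : Irreducible ϖ)
    (hψ : ψ (Ideal.Quotient.mk _ (ϖ ^ (r - 1))) ≠ 1) {B : Matrix (Fin 2) (Fin 2) (OMod o r)}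
    (ha : IsUnit (B 1 0)) (hB : B 0 0 = 0) :
    Nat.card (inertia _ (psiBracket ψ (B.map (red o (ellDown_le r))))) =
      Nat.card (stabSL ψ (B.map (red o (ellDown_le r)))) *
        Nat.card ((translations (B 1 1)).map (red o (ellDown_le r)).toAddMonoidHom) := by
  obtain ⟨a, ha⟩ := ha
  set T := inertia _ (psiBracket ψ (B.map (red o (ellDown_le r)))) with hT
  have htr : B.trace = B 1 1 := by rw [Matrix.trace_fin_two, hB, zero_add]
  have hval : ∀ {g : SL(2, OMod o r)} {x : OMod o r},
      ((g⁻¹ : SL(2, OMod o r)) * B * (g : SL(2, OMod o r)) :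
        Matrix (Fin 2) (Fin 2) (OMod o r)).map (red o (ellDown_le r)) =
      (B + x • (1 : Matrix (Fin 2) (Fin 2) (OMod o r))).map (red o (ellDown_le r)) →
      red o (ellDown_le r) (((g⁻¹ : SL(2, OMod o r)) * B * (g : SL(2, OMod o r)) :
        Matrix (Fin 2) (Fin 2) (OMod o r)) 0 0) = red o (ellDown_le r) x := fun h => by
    have := congrFun (congrFun h 0) 0
    simp only [Matrix.map_apply, Matrix.add_apply, hB, zero_add, Matrix.smul_apply,
      Matrix.one_apply, if_true, smul_eq_mul, mul_one] at this
    exact this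
  -- As `B 0 0 = 0`, the scalar is read off from the upper left entry of the conjugate.
  let τ : T →* Multiplicative (OMod o (ellDown r)) :=
    MonoidHom.mk' (fun t => Multiplicative.ofAdd (red o (ellDown_le r)
      ((((t : SL(2, OMod o r))⁻¹ : SL(2, OMod o r)) * B * (t : SL(2, OMod o r)) :
        Matrix (Fin 2) (Fin 2) (OMod o r)) 0 0))) (by
      intro t t'
      obtain ⟨x, hx⟩ := (mem_inertia_iff_map hϖ hψ).1 t.2
      obtain ⟨x', hx'⟩ := (mem_inertia_iff_map hϖ hψ).1 t'.2
      have h : ((((t * t' : T) : SL(2, OMod o r))⁻¹ : SL(2, OMod o r)) * B *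
          ((t * t' : T) : SL(2, OMod o r)) :
          Matrix (Fin 2) (Fin 2) (OMod o r)).map (red o (ellDown_le r)) =
          (B + (x + x') • (1 : Matrix (Fin 2) (Fin 2) (OMod o r))).map (red o (ellDown_le r)) := by
        rw [Subgroup.coe_mul, mul_inv_rev, Matrix.SpecialLinearGroup.coe_mul,
          Matrix.SpecialLinearGroup.coe_mul]
        have e : ∀ P Q X Y : Matrix (Fin 2) (Fin 2) (OMod o r),
          P * Q * B * (X * Y) = P * (Q * B * X) * Y := fun P Q X Y => by
            simp only [Matrix.mul_assoc]
        rw [e, map_red_mul, map_red_mul, hx, ← map_red_mul, ← map_red_mul, Matrix.mul_add,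
          Matrix.add_mul, Matrix.map_add _ (map_add _), hx', Matrix.mul_smul, Matrix.smul_mul,
          Matrix.mul_one, ← Matrix.SpecialLinearGroup.coe_mul, inv_mul_cancel,
          Matrix.SpecialLinearGroup.coe_one, ← Matrix.map_add _ (map_add _), add_smul]
        congr 1
        abel
      change Multiplicative.ofAdd _ = Multiplicative.ofAdd _ * Multiplicative.ofAdd _
      rw [hval h, hval hx, hval hx', map_add, ofAdd_add])
  have h1 := Subgroup.card_mul_index τ.ker
  rw [Subgroup.index_ker] at h1
  rw [← h1]
  congr 1
  · have hk : τ.ker = (stabSL ψ (B.map (red o (ellDown_le r)))).subgroupOf T := by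
      ext t
      obtain ⟨x, hx⟩ := (mem_inertia_iff_map hϖ hψ).1 t.2
      rw [MonoidHom.mem_ker, Subgroup.mem_subgroupOf, mem_stabSL_iff_map hϖ hψ, hx]
      change Multiplicative.ofAdd _ = Multiplicative.ofAdd 0 ↔ _
      rw [Multiplicative.ofAdd.injective.eq_iff, hval hx]
      constructor
      · intro h
        ext i j
        simp [h]
      · intro h
        have := congrFun (congrFun h 0) 0
        simpa using this
    rw [hk]
    exact Nat.card_congr (Subgroup.subgroupOfEquivOfLe (stabSL_le_inertia ψ B)).toEquiv
  · refine Nat.card_congr (Equiv.subtypeEquiv Multiplicative.toAdd fun y => ?_)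
    constructor
    · rintro ⟨t, rfl⟩
      obtain ⟨x, hx⟩ := (mem_inertia_iff_map hϖ hψ).1 t.2
      refine ⟨x, htr ▸ mem_translations_of_map_eq hx, (hval hx).symm⟩
    · rintro ⟨x, hx, hxy⟩
      -- Conjugation by the unipotent with entry `a⁻¹ x` shifts by `-x`, hence the change of sign.
      have hx' := (translations (B 1 1)).neg_mem hx
      have h := map_red_unipotent_conj ha.symm (x := -x) (by rw [hB, sub_zero]; exact hx')
      rw [neg_neg] at h
      refine ⟨⟨_, (mem_inertia_iff_map hϖ hψ).2 ⟨x, h⟩⟩, ?_⟩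
      have h2 : Multiplicative.ofAdd _ = Multiplicative.ofAdd _ :=
        congrArg Multiplicative.ofAdd (hval h)
      refine h2.trans (congrArg Multiplicative.ofAdd hxy)

end Counting

end SL2Growth

namespace SL2Growth

/-! ### Enlarging the extended character beyond determinant one. -/

section Glue

variable {G Γ : Type*} [Group G] [Group Γ]

/-- Characters of two subgroups, one of them normal, glue to their product if they agree on the
intersection and the second one is invariant. -/
theorem exists_glue (f : G →* Γ) (C : Subgroup G) (M : Subgroup Γ) [M.Normal] (χ : C →* ℂ)
    (θ : M →* ℂ) (hag : ∀ (k : C) (hk : f k ∈ M), χ k = θ ⟨f k, hk⟩) :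
    ∃ Ψ : Γ → ℂ, ∀ (c : C) (m : M), Ψ (f c * m) = χ c * θ m := by
  classical
  let Ψ : Γ → ℂ := fun g => if h : ∃ c : C, ∃ m : M, f c * m = g then
    χ h.choose * θ h.choose_spec.choose else 0
  refine ⟨Ψ, fun c m => ?_⟩
  have h : ∃ c' : C, ∃ m' : M, f c' * m' = f c * m := ⟨c, m, rfl⟩
  simp only [Ψ, dif_pos h]
  have hs := h.choose_spec.choose_spec
  set c' := h.choose
  set m' := h.choose_spec.choose
  have h1 : f ((c⁻¹ * c' : C) : G) = (m : Γ) * (m' : Γ)⁻¹ := by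
    rw [Subgroup.coe_mul, Subgroup.coe_inv, map_mul, map_inv, eq_mul_inv_iff_mul_eq, mul_assoc, hs]
    group
  have h2 := hag (c⁻¹ * c') (by rw [h1]; exact (m * m'⁻¹).2)
  have h3 : (⟨f ((c⁻¹ * c' : C) : G), by rw [h1]; exact (m * m'⁻¹).2⟩ : M) = m * m'⁻¹ :=
    Subtype.ext h1
  rw [h3] at h2
  calc χ c' * θ m' = χ (c * (c⁻¹ * c')) * θ m' := by rw [mul_inv_cancel_left]
    _ = χ c * (θ (m * m'⁻¹) * θ m') := by rw [map_mul, h2, mul_assoc]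
    _ = χ c * θ m := by rw [← map_mul, inv_mul_cancel_right]

theorem glue_mul {f : G →* Γ} {C : Subgroup G} {M : Subgroup Γ} [M.Normal] {χ : C →* ℂ}
    {θ : M →* ℂ} (hinv : ∀ c ∈ C, ∀ m, θ (MulAut.conjNormal (f c) m) = θ m) {Ψ : Γ → ℂ}
    (hΨ : ∀ (c : C) (m : M), Ψ (f c * m) = χ c * θ m) (c c' : C) (m m' : M) :
    Ψ ((f c * m) * (f c' * m')) = Ψ (f c * m) * Ψ (f c' * m') := by
  have : (f c * m) * (f c' * m') =
      f ((c * c' : C) : G) * ((MulAut.conjNormal (f c')⁻¹ m * m' : M) : Γ) := by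
    rw [Subgroup.coe_mul, Subgroup.coe_mul, MulAut.conjNormal_apply, map_mul]
    group
  rw [this, hΨ, hΨ, hΨ, map_mul, map_mul, ← map_inv, hinv _ (C.inv_mem c'.2)]
  ring

end Glue

section Hat

variable {o : Type*} [CommRing o] [IsLocalRing o] {r : ℕ}

/-- The matrices that commute with `B` modulo `℘^ℓ` up to a correction and have determinant `1`
modulo `℘^ℓ`. -/
def IsHat (B Z : Matrix (Fin 2) (Fin 2) (OMod o r)) : Prop :=
  red o (ellUp_le r) (Z.det - 1) = 0 ∧
    ∃ Z₀, Z₀ * B = B * Z₀ ∧ (Z - Z₀).map (red o (ellUp_le r)) = 0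

theorem isUnit_of_red_sub_one {x : OMod o r} (hx : red o (ellUp_le r) (x - 1) = 0) :
    IsUnit x := by
  have := red_mul_eq_zero (ellUp_le r) (ellUp_le r) (by unfold ellUp; omega) hx hx
  exact IsUnit.of_mul_eq_one (2 - x) (by linear_combination -this)

theorem det_red_eq {X Y : Matrix (Fin 2) (Fin 2) (OMod o r)} {m : ℕ} (h : m ≤ r)
    (hXY : X.map (red o h) = Y.map (red o h)) : red o h X.det = red o h Y.det := by
  have e : ∀ Z : Matrix (Fin 2) (Fin 2) (OMod o r), red o h Z.det = (Z.map (red o h)).det :=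
    fun Z => RingHom.map_det _ Z
  rw [e, e, hXY]

theorem IsHat.exists_GL {B Z : Matrix (Fin 2) (Fin 2) (OMod o r)} (hZ : IsHat B Z) :
    ∃ g : GL (Fin 2) (OMod o r), (g : Matrix (Fin 2) (Fin 2) (OMod o r)) = Z ∧
      g ∈ glCentralizer B ⊔ congGL o r (ellUp_le r) := by
  obtain ⟨hd, Z₀, hc, hr⟩ := hZ
  have hd₀ : red o (ellUp_le r) (Z₀.det - 1) = 0 := by
    rw [map_sub, sub_eq_zero] at hd ⊢
    rw [← hd]
    refine det_red_eq _ ?_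
    rw [Matrix.map_sub _ (map_sub _), sub_eq_zero] at hr
    exact hr.symm
  let g := Matrix.GeneralLinearGroup.mk'' Z (isUnit_of_red_sub_one hd)
  let g₀ := Matrix.GeneralLinearGroup.mk'' Z₀ (isUnit_of_red_sub_one hd₀)
  refine ⟨g, rfl, ?_⟩
  have : g = g₀ * (g₀⁻¹ * g) := by group
  rw [this]
  refine Subgroup.mul_mem_sup hc ?_
  rw [mem_congGL_iff]
  have h1 : ((g₀⁻¹ * g : GL (Fin 2) (OMod o r)) : Matrix (Fin 2) (Fin 2) (OMod o r)) - 1 =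
      (g₀⁻¹ : GL (Fin 2) (OMod o r)) * (Z - Z₀) := by
    rw [Matrix.mul_sub, Units.val_mul]
    congr 1
    change 1 = ((g₀⁻¹ : GL (Fin 2) (OMod o r)) : Matrix (Fin 2) (Fin 2) (OMod o r)) *
      (g₀ : Matrix (Fin 2) (Fin 2) (OMod o r))
    rw [← Units.val_mul, inv_mul_cancel, Units.val_one]
  rw [h1, map_red_mul, hr, Matrix.mul_zero]

theorem mem_centSL_iff {B : Matrix (Fin 2) (Fin 2) (OMod o r)} {g : SL(2, OMod o r)} :
    g ∈ centSL B ↔ Matrix.SpecialLinearGroup.toGL g ∈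
      glCentralizer B ⊔ congGL o r (ellUp_le r) := Iff.rfl

/-- The determinant of `g` is congruent to `1` modulo `℘^ℓ`, so it can be moved into a factor from
`M^ℓ`. -/
theorem exists_eq_mul_of_isHat {B : Matrix (Fin 2) (Fin 2) (OMod o r)} {g : GL (Fin 2) (OMod o r)}
    (hg : IsHat B g) : ∃ (c : centSL B) (m : congGL o r (ellUp_le r)),
      g = Matrix.SpecialLinearGroup.toGL (c : SL(2, OMod o r)) * m := by
  obtain ⟨g', hg', hgc⟩ := hg.exists_GL
  obtain rfl : g' = g := Units.ext hg'
  set δ := (g' : Matrix (Fin 2) (Fin 2) (OMod o r)).det - 1 with hδ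
  -- This is the diagonal matrix with entries `1` and `det g`.
  let m := oneAddGL (!![0, 0; 0, δ] : Matrix (Fin 2) (Fin 2) (OMod o r)) (by
    ext i j
    fin_cases i <;> fin_cases j
    · simp
    · simp
    · simp
    · exact hg.1)
  have hdet : ((g' * (m : GL (Fin 2) (OMod o r))⁻¹ : GL (Fin 2) (OMod o r)) :
      Matrix (Fin 2) (Fin 2) (OMod o r)).det = 1 := by
    have h1 : ((m : GL (Fin 2) (OMod o r)) : Matrix (Fin 2) (Fin 2) (OMod o r)).det =
        (g' : Matrix (Fin 2) (Fin 2) (OMod o r)).det := by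
      rw [coe_oneAddGL, Matrix.det_fin_two]
      simp [hδ]
    have h2 : ((m : GL (Fin 2) (OMod o r)) * (m : GL (Fin 2) (OMod o r))⁻¹ :
        GL (Fin 2) (OMod o r)).val.det = 1 := by
      rw [mul_inv_cancel, Units.val_one, Matrix.det_one]
    rw [Units.val_mul, Matrix.det_mul] at h2 ⊢
    rw [← h1, h2]
  let c : SL(2, OMod o r) := ⟨_, hdet⟩
  have hc : Matrix.SpecialLinearGroup.toGL c = g' * (m : GL (Fin 2) (OMod o r))⁻¹ := Units.ext rfl
  refine ⟨⟨c, ?_⟩, m, ?_⟩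
  · rw [mem_centSL_iff, hc]
    exact Subgroup.mul_mem _ hgc (Subgroup.mem_sup_right (Subgroup.inv_mem _ m.2))
  · rw [hc]
    group

end Hat

section Extension

variable {o : Type*} [CommRing o] [IsDomain o] [IsDiscreteValuationRing o]
  [Finite (ResidueField o)] {ϖ : o} {r : ℕ} {ψ : AddChar (OMod o r) ℂ}
  {V : Type*} [AddCommGroup V] [Module ℂ V] {ρ : Representation ℂ (SL(2, OMod o r)) V}

/-- The conjugate of a matrix by the unipotent matrix with entry `a⁻¹ x`. -/
def conjU {S : Type*} [CommRing S] (a : Sˣ) (x : S) (Z : Matrix (Fin 2) (Fin 2) S) :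
    Matrix (Fin 2) (Fin 2) S :=
  (unipotent (↑a⁻¹ * x) : SL(2, S)) * Z * ((unipotent (↑a⁻¹ * x))⁻¹ : SL(2, S))

-- Elements `u + v B` of determinant exactly one are hard to write down, whereas determinant one
-- modulo `℘^ℓ` is easy to arrange. So the eigencharacter `χ` of `centSL B` is glued with `ψ_B` on
-- `M^ℓ` to a function `Ψ` on all `IsHat` matrices. A translation by `x` multiplies `ψ_B` on `M^ℓ`
-- by `ψ (-x (det - 1))`, which explains the extra factor in the invariance of `Ψ` under the
-- stabilizer `P` of `χ`.
set_option maxHeartbeats 400000 in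
theorem exists_hat_character (hϖ : Irreducible ϖ)
    (hψ : ψ (Ideal.Quotient.mk _ (ϖ ^ (r - 1))) ≠ 1) {B : Matrix (Fin 2) (Fin 2) (OMod o r)}
    {a : (OMod o r)ˣ} (ha : B 1 0 = a) [FiniteDimensional ℂ V]
    (hne : isoPart (psiBracket ψ (B.map (red o (ellDown_le r)))) ρ ≠ ⊥)
    (X : AddSubgroup (OMod o r)) (hX : X ≤ translations (B 1 1 - B 0 0)) :
    ∃ (Ψ : Matrix (Fin 2) (Fin 2) (OMod o r) → ℂ) (P : AddSubgroup (OMod o r)), P ≤ X ∧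
      (∀ Z Z', IsHat B Z → IsHat B Z' → Ψ (Z * Z') = Ψ Z * Ψ Z') ∧
      (∀ Y : Matrix (Fin 2) (Fin 2) (OMod o r), Y.map (red o (ellUp_le r)) = 0 →
        Ψ (1 + Y) = ψ (B * Y).trace) ∧
      (∀ Z, IsHat B Z → Ψ Z ≠ 0) ∧
      (∀ x ∈ P, ∀ Z, (∀ y ∈ X, IsHat B (conjU a y Z)) →
        Ψ (conjU a x Z) = Ψ Z * ψ (-x * (Z.det - 1))) ∧
      Nat.card (X.map (red o (ellDown_le r)).toAddMonoidHom) ≤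
        Nat.card (P.map (red o (ellDown_le r)).toAddMonoidHom) *
          Module.finrank ℂ (isoPart (psiBracket ψ (B.map (red o (ellDown_le r)))) ρ) := by
  classical
  -- The translation replaces `B` by `B - x`, and on `M^ℓ` the trace of `m - 1` equals `det m - 1`.
  have hconj : ∀ x ∈ X, ∀ m : congGL o r (ellUp_le r), psiLift ψ B (MulAut.conjNormal
      (Matrix.SpecialLinearGroup.toGL (unipotent ((↑a⁻¹ : OMod o r) * x))) m) =
      psiLift ψ B m * ψ (-x * (((m : GL (Fin 2) (OMod o r)) :
        Matrix (Fin 2) (Fin 2) (OMod o r)).det - 1)) := by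
    intro x hx m
    rw [psiLift_conj, coe_toGL_inv]
    refine (DFunLike.congr_fun (psiLift_congr ψ (map_red_unipotent_conj ha (hX hx))) m).trans ?_
    rw [psiLift_apply, psiLift_apply, Matrix.add_mul, Matrix.trace_add, AddChar.map_add_eq_mul,
      Matrix.smul_mul, Matrix.one_mul, Matrix.trace_smul, trace_eq_det_sub_one m.2, smul_eq_mul]
  obtain ⟨χ, P, hχ, hP, hcard⟩ := exists_extension_card_le hne (centSL B)
    ((centSL_le_stabSL ψ B).trans (stabSL_le_inertia ψ B)) (congSL_le_centSL B)
    (exists_commutator_centSL ψ (ha ▸ a.isUnit)) (X := X) (Y := OMod o (ellDown r))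
    (fun x => unipotent ((↑a⁻¹ : OMod o r) * x))
    (fun x y => by rw [AddSubgroup.coe_add, mul_add, unipotent_add])
    (fun x => (mem_inertia_iff_map hϖ hψ).2 ⟨-x, map_red_unipotent_conj ha (hX x.2)⟩)
    ((red o (ellDown_le r)).toAddMonoidHom.comp X.subtype)
  obtain ⟨Ψ₀, hΨ₀⟩ := exists_glue Matrix.SpecialLinearGroup.toGL (centSL B)
    (congGL o r (ellUp_le r)) χ (psiLift ψ B) (fun k hk => by
      have hk' := (toGL_mem_congGL_iff _).1 hk
      exact (hχ ⟨k, hk'⟩).trans (psiBracket_apply ψ B _))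
  have hinv : ∀ c ∈ centSL B, ∀ m, psiLift ψ B (MulAut.conjNormal
      (Matrix.SpecialLinearGroup.toGL c) m) = psiLift ψ B m := fun c hc m => by
    rw [mem_centSL_iff] at hc
    exact psiLift_conj_of_mem_sup ψ hc m
  -- The value `0` on singular matrices is never used: `IsHat` matrices are invertible.
  let Ψ : Matrix (Fin 2) (Fin 2) (OMod o r) → ℂ := fun Z =>
    if h : ∃ g : GL (Fin 2) (OMod o r), (g : Matrix (Fin 2) (Fin 2) (OMod o r)) = Z then
      Ψ₀ h.choose else 0
  have hΨ : ∀ g : GL (Fin 2) (OMod o r), Ψ g = Ψ₀ g := fun g => by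
    have h : ∃ g' : GL (Fin 2) (OMod o r), (g' : Matrix (Fin 2) (Fin 2) (OMod o r)) = g :=
      ⟨g, rfl⟩
    simp only [Ψ, dif_pos h]
    rw [show h.choose = g from Units.ext h.choose_spec]
  have hχ0 : ∀ c, χ c ≠ 0 := fun c h => by
    have := map_mul χ c c⁻¹
    rw [h, zero_mul, mul_inv_cancel, map_one] at this
    exact one_ne_zero this
  have hcast : ∀ (x : OMod o r) (g : GL (Fin 2) (OMod o r)), conjU a x g =
      ((Matrix.SpecialLinearGroup.toGL (unipotent ((↑a⁻¹ : OMod o r) * x)) * g *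
        (Matrix.SpecialLinearGroup.toGL (unipotent ((↑a⁻¹ : OMod o r) * x)))⁻¹ :
        GL (Fin 2) (OMod o r)) : Matrix (Fin 2) (Fin 2) (OMod o r)) := fun x g => by
    rw [Units.val_mul, Units.val_mul, coe_toGL_inv]
    rfl
  refine ⟨Ψ, P.map X.subtype, ?_, ?_, ?_, ?_, ?_, ?_⟩
  · rintro _ ⟨x, -, rfl⟩
    exact x.2
  · intro Z Z' hZ hZ'
    obtain ⟨g, rfl, -⟩ := hZ.exists_GL
    obtain ⟨g', rfl, -⟩ := hZ'.exists_GL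
    obtain ⟨c, m, rfl⟩ := exists_eq_mul_of_isHat hZ
    obtain ⟨c', m', rfl⟩ := exists_eq_mul_of_isHat hZ'
    rw [← Units.val_mul, hΨ, hΨ, hΨ]
    exact glue_mul hinv hΨ₀ c c' m m'
  · intro Y hY
    rw [← coe_oneAddGL Y hY, hΨ, ← psiLift_oneAddGL ψ B Y hY]
    have := hΨ₀ 1 (oneAddGL Y hY)
    rwa [Subgroup.coe_one, map_one, map_one, one_mul, one_mul] at this
  · intro Z hZ
    obtain ⟨g, rfl, -⟩ := hZ.exists_GL
    obtain ⟨c, m, rfl⟩ := exists_eq_mul_of_isHat hZ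
    rw [hΨ, hΨ₀]
    exact mul_ne_zero (hχ0 c) (psiLift_ne_zero ψ B m)
  · rintro _ ⟨x, hx, rfl⟩ Z hZ
    have h0 : IsHat B Z := by
      have := hZ 0 X.zero_mem
      have e : (unipotent (0 : OMod o r)) = 1 := by
        have := unipotent_add (0 : OMod o r) 0
        rw [add_zero] at this
        exact left_eq_mul.1 this
      rwa [conjU, mul_zero, e, inv_one, Matrix.SpecialLinearGroup.coe_one, Matrix.one_mul,
        Matrix.mul_one] at this
    obtain ⟨g, rfl, -⟩ := h0.exists_GL
    obtain ⟨c, m, rfl⟩ := exists_eq_mul_of_isHat h0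
    have hmem : ∀ y : X, unipotent ((↑a⁻¹ : OMod o r) * y) * (c : SL(2, OMod o r)) *
        (unipotent ((↑a⁻¹ : OMod o r) * y))⁻¹ ∈ centSL B := fun y => by
      obtain ⟨g', hg', hgc⟩ := (hZ y y.2).exists_GL
      rw [hcast] at hg'
      have hg'' := Units.ext hg'
      rw [mem_centSL_iff]
      have e : Matrix.SpecialLinearGroup.toGL (unipotent ((↑a⁻¹ : OMod o r) * y) *
          (c : SL(2, OMod o r)) * (unipotent ((↑a⁻¹ : OMod o r) * y))⁻¹) =
          g' * (MulAut.conjNormal (Matrix.SpecialLinearGroup.toGL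
            (unipotent ((↑a⁻¹ : OMod o r) * y))) m⁻¹ : congGL o r (ellUp_le r)) := by
        rw [hg'', MulAut.conjNormal_apply, map_mul, map_mul, map_inv, Subgroup.coe_inv]
        group
      rw [e]
      exact Subgroup.mul_mem _ hgc (Subgroup.mem_sup_right (Subtype.prop _))
    have h1 := hP x hx c hmem c.2
    have e : (Matrix.SpecialLinearGroup.toGL (unipotent ((↑a⁻¹ : OMod o r) * x)) *
        (Matrix.SpecialLinearGroup.toGL (c : SL(2, OMod o r)) * m) *
        (Matrix.SpecialLinearGroup.toGL (unipotent ((↑a⁻¹ : OMod o r) * x)))⁻¹ :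
          GL (Fin 2) (OMod o r)) =
        Matrix.SpecialLinearGroup.toGL ((⟨_, hmem x⟩ : centSL B) : SL(2, OMod o r)) *
          (MulAut.conjNormal (Matrix.SpecialLinearGroup.toGL
            (unipotent ((↑a⁻¹ : OMod o r) * x))) m : congGL o r (ellUp_le r)) := by
      rw [MulAut.conjNormal_apply, map_mul, map_mul, map_inv]
      group
    rw [AddSubgroup.subtype_apply, hcast, e, hΨ, hΨ₀, h1, hconj x x.2, hΨ, hΨ₀, Units.val_mul,
      Matrix.det_mul]
    have hd : ((Matrix.SpecialLinearGroup.toGL (c : SL(2, OMod o r)) : GL (Fin 2) (OMod o r)) :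
        Matrix (Fin 2) (Fin 2) (OMod o r)).det = 1 := (c : SL(2, OMod o r)).2
    rw [hd, one_mul, ← mul_assoc]
  · rw [AddSubgroup.map_map]
    rwa [AddMonoidHom.range_comp, AddSubgroup.range_subtype] at hcard

end Extension

end SL2Growth

/-! ### Scalar matrices and the case `2 ≠ 0`. -/

namespace SL2Growth

/-- The map `y ↦ y + y²` is injective on the maximal ideal, because a difference of values is `y -
y'` times the unit `1 + y + y'`; finiteness makes it surjective there. -/
theorem IsChainRing.exists_add_sq_eq {R : Type*} [CommRing R] [Finite R] {p : R} {r : ℕ}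
    (h : IsChainRing p r) {c : R} (hc : p ∣ c) : ∃ y, y + y ^ 2 = c := by
  let f : {y : R // p ∣ y} → {y : R // p ∣ y} := fun y =>
    ⟨y + y.1 ^ 2, dvd_add y.2 (dvd_pow y.2 two_ne_zero)⟩
  have hf : Function.Injective f := fun y y' hyy => by
    have h1 : y.1 + y.1 ^ 2 = y'.1 + y'.1 ^ 2 := congrArg Subtype.val hyy
    have h2 := h.isUnit_one_add (dvd_add y.2 y'.2)
    have h3 : (1 + (y.1 + y'.1)) * (y.1 - y'.1) = 0 := by linear_combination h1
    exact Subtype.ext (sub_eq_zero.1 ((IsUnit.mul_right_eq_zero h2).1 h3))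
  obtain ⟨y, hy⟩ := Finite.surjective_of_injective hf ⟨c, hc⟩
  exact ⟨y, congrArg Subtype.val hy⟩

section Scalar

variable {o : Type*} [CommRing o] [IsLocalRing o] {r : ℕ}

theorem conjU_smul_one (a : (OMod o r)ˣ) (x z : OMod o r) :
    conjU a x (z • (1 : Matrix (Fin 2) (Fin 2) (OMod o r))) = z • 1 := by
  rw [conjU, Matrix.mul_smul, Matrix.smul_mul, Matrix.mul_one, ← Matrix.SpecialLinearGroup.coe_mul,
    mul_inv_cancel, Matrix.SpecialLinearGroup.coe_one]

theorem isHat_smul_one (B : Matrix (Fin 2) (Fin 2) (OMod o r)) {z : OMod o r}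
    (hz : red o (ellUp_le r) (z ^ 2 - 1) = 0) :
    IsHat B (z • (1 : Matrix (Fin 2) (Fin 2) (OMod o r))) := by
  refine ⟨?_, z • 1, by simp, ?_⟩
  · rw [Matrix.det_smul, Matrix.det_one, Fintype.card_fin, mul_one]
    exact hz
  · rw [sub_self]
    exact Matrix.map_zero _ (map_zero _)

/-- A scalar matrix is fixed by every translation, so the invariance of `Ψ` leaves only the
determinant factor. -/
theorem addChar_mul_sq_sub_one {ψ : AddChar (OMod o r) ℂ}
    {B : Matrix (Fin 2) (Fin 2) (OMod o r)} {a : (OMod o r)ˣ}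
    {X P : AddSubgroup (OMod o r)} {Ψ : Matrix (Fin 2) (Fin 2) (OMod o r) → ℂ}
    (hne : ∀ Z, IsHat B Z → Ψ Z ≠ 0)
    (hP : ∀ x ∈ P, ∀ Z, (∀ y ∈ X, IsHat B (conjU a y Z)) →
        Ψ (conjU a x Z) = Ψ Z * ψ (-x * (Z.det - 1)))
    {x : OMod o r} (hx : x ∈ P) {z : OMod o r} (hz : red o (ellUp_le r) (z ^ 2 - 1) = 0) :
    ψ (x * (z ^ 2 - 1)) = 1 := by
  have hZ := isHat_smul_one B hz
  have := hP x hx (z • 1) (fun y _ => by rwa [conjU_smul_one])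
  rw [conjU_smul_one, Matrix.det_smul, Matrix.det_one, Fintype.card_fin, mul_one] at this
  have h1 := (left_eq_mul₀ (hne _ hZ)).1 this
  rw [neg_mul, AddChar.map_neg_eq_inv] at h1
  exact inv_eq_one.1 h1

end Scalar

section CharZero

variable {o : Type*} [CommRing o] [IsDomain o] [IsDiscreteValuationRing o]
  {ϖ : o} {r : ℕ} {ψ : AddChar (OMod o r) ℂ}
  {V : Type*} [AddCommGroup V] [Module ℂ V] {ρ : Representation ℂ (SL(2, OMod o r)) V}

theorem card_map_red_le [Finite (ResidueField o)] (hϖ : Irreducible ϖ) {k c : ℕ} (hk : k ≤ r) (hc : c ≤ k)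
    (P : AddSubgroup (OMod o r)) (hP : ∀ x ∈ P, (Ideal.Quotient.mk _ ϖ : OMod o r) ^ c ∣ x) :
    Nat.card (P.map (red o hk).toAddMonoidHom) ≤ Nat.card (ResidueField o) ^ (k - c) := by
  rw [← card_dvd hϖ hc]
  refine Nat.card_le_card_of_injective (fun y => ⟨y.1, ?_⟩) fun y y' h => by
    have h1 := congrArg Subtype.val h
    exact Subtype.ext h1
  obtain ⟨_, x, hx, rfl⟩ := y
  have := map_dvd (red o hk) (hP x hx)
  rwa [map_pow, red_mk] at this

theorem exists_two_eq [CharP (ResidueField o) 2] (hr : levelBound o ≤ r) (hchar : (2 : o) ≠ 0) (hϖ : Irreducible ϖ) :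
    ∃ e, 1 ≤ e ∧ 4 * e ≤ r ∧ ∃ u : (OMod o r)ˣ, (2 : OMod o r) = u * (Ideal.Quotient.mk _ ϖ : OMod o r) ^ e := by
  obtain ⟨n, u, hu⟩ := IsDiscreteValuationRing.eq_unit_mul_pow_irreducible hchar hϖ
  have h0 : ringChar o = 0 := (ringChar_cases (o := o)).resolve_right hchar
  rw [levelBound, if_pos h0, IsDiscreteValuationRing.addVal_def 2 u hϖ n hu] at hr
  refine ⟨n, ?_, hr, Units.map (Ideal.Quotient.mk _).toMonoidHom u, ?_⟩
  · by_contra! hn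
    obtain rfl : n = 0 := by omega
    have := two_mem_maximalIdeal (o := o)
    rw [hu, pow_zero, mul_one, mem_maximalIdeal] at this
    exact this u.isUnit
  · have := congrArg (Ideal.Quotient.mk (maximalIdeal o ^ r)) hu
    rw [map_ofNat, map_mul, map_pow] at this
    exact this

/-- Scalars `1 + 2w` satisfy `(1 + 2w)² - 1 = 4(w + w²)`, and `w + w²` takes every value in `℘`.
Since `r ≥ 4e` gives `2e ≤ ℓ`, these differences fill `℘^(ℓ+1)`. Hence `P` lies in `℘^(r-ℓ-1) =
℘^(ℓ'-1)` and has at most `q` elements modulo `℘^ℓ'`. -/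
theorem card_le_of_two_ne_zero [Finite (ResidueField o)] [CharP (ResidueField o) 2]
    (hr : levelBound o ≤ r) (hchar : (2 : o) ≠ 0) (hϖ : Irreducible ϖ)
    (hψ : ψ (Ideal.Quotient.mk _ (ϖ ^ (r - 1))) ≠ 1) {B : Matrix (Fin 2) (Fin 2) (OMod o r)}
    (ha : IsUnit (B 1 0)) [FiniteDimensional ℂ V]
    (hne : isoPart (psiBracket ψ (B.map (red o (ellDown_le r)))) ρ ≠ ⊥) :
    Nat.card ((translations (B 1 1 - B 0 0)).map (red o (ellDown_le r)).toAddMonoidHom) ≤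
      Nat.card (ResidueField o) *
        Module.finrank ℂ (isoPart (psiBracket ψ (B.map (red o (ellDown_le r)))) ρ) := by
  obtain ⟨a, ha⟩ := ha
  obtain ⟨Ψ, P, -, -, -, hΨ0, hP, hcard⟩ := exists_hat_character hϖ hψ ha.symm hne _ le_rfl
  obtain ⟨e, he, her, u, hu⟩ := exists_two_eq hr hchar hϖ
  refine hcard.trans (Nat.mul_le_mul_right _ ?_)
  have hch := isChainRing_OMod hϖ r
  have hl : ellUp r + 1 ≤ r := by unfold ellUp; omega
  have hdiv : ∀ x ∈ P, (Ideal.Quotient.mk _ ϖ : OMod o r) ^ (ellDown r - 1) ∣ x := by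
    intro x hx
    have := hch.pow_dvd_of_addChar (by rwa [map_pow] at hψ) (z := x) hl fun y => by
      set p : OMod o r := Ideal.Quotient.mk _ ϖ
      -- The right-hand side is `p ^ (ℓ + 1) * y` divided by `4 = u² p ^ (2e)`; it lies in the
      -- maximal ideal because `ℓ + 1 - 2e ≥ 1`.
      obtain ⟨w, hw⟩ := hch.exists_add_sq_eq (c := ↑u⁻¹ ^ 2 * p ^ (ellUp r + 1 - 2 * e) * y)
        (((dvd_pow_self p (by unfold ellUp; omega)).mul_left _).mul_right _)
      have hz : (1 + 2 * w) ^ 2 - 1 = p ^ (ellUp r + 1) * y := by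
        have h4 : (2 : OMod o r) ^ 2 = u ^ 2 * p ^ (2 * e) := by rw [hu]; ring
        have hui : (u : OMod o r) * ↑u⁻¹ = 1 := u.mul_inv
        calc (1 + 2 * w) ^ 2 - 1 = 2 ^ 2 * (w + w ^ 2) := by ring
          _ = (u * ↑u⁻¹) ^ 2 * p ^ (2 * e + (ellUp r + 1 - 2 * e)) * y := by
            rw [h4, hw, pow_add]; ring
          _ = _ := by
            rw [hui, one_pow, one_mul]
            congr 2
            unfold ellUp
            omega
      rw [← hz]
      refine addChar_mul_sq_sub_one hΨ0 hP hx ?_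
      rw [hz, red_eq_zero_iff hϖ, pow_succ, mul_assoc]
      exact dvd_mul_right _ _
    rwa [show r - (ellUp r + 1) = ellDown r - 1 by unfold ellUp ellDown; omega] at this
  refine (card_map_red_le hϖ (ellDown_le r) (Nat.sub_le _ _) P hdiv).trans ?_
  rw [show ellDown r - (ellDown r - 1) = 1 by unfold ellDown; omega, pow_one]

end CharZero

end SL2Growth

namespace SL2Growth

/-! ### Characteristic two: the algebra generated by B and the values of `Ψ` on it. -/

section Lin

variable {S : Type*} [CommRing S] (B : Matrix (Fin 2) (Fin 2) S)

/-- The matrix `u + v B`. -/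
def lin (u v : S) : Matrix (Fin 2) (Fin 2) S := u • (1 : Matrix (Fin 2) (Fin 2) S) + v • B

theorem lin_mul (u v u' v' : S) : lin B u v * lin B u' v' =
    lin B (u * u' - v * v' * B.det) (u * v' + v * u' + v * v' * B.trace) := by
  rw [Matrix.det_fin_two, Matrix.trace_fin_two]
  ext i j
  fin_cases i <;> fin_cases j <;> simp [lin, Matrix.mul_apply, Fin.sum_univ_two] <;> ring

theorem trace_lin (u v : S) : (lin B u v).trace = 2 * u + v * B.trace := by
  simp [lin, Matrix.trace_fin_two]
  ring

theorem det_lin (u v : S) : (lin B u v).det = u ^ 2 + u * v * B.trace + v ^ 2 * B.det := by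
  simp [lin, Matrix.trace_fin_two, Matrix.det_fin_two]
  ring

theorem lin_mul_comm (u v : S) : lin B u v * B = B * lin B u v := by
  simp [lin, Matrix.add_mul, Matrix.mul_add]

theorem lin_add (u v u' v' : S) : lin B (u + u') (v + v') = lin B u v + lin B u' v' := by
  simp only [lin, add_smul]
  abel

theorem smul_lin (c u v : S) : c • lin B u v = lin B (c * u) (c * v) := by
  simp only [lin, smul_add, smul_smul]

theorem lin_zero_one : lin B 0 1 = B := by simp [lin]

theorem mul_lin (u v : S) : B * lin B u v = lin B (-(v * B.det)) (u + v * B.trace) := by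
  have := lin_mul B 0 1 u v
  rw [lin_zero_one] at this
  rw [this]
  congr 1 <;> ring

theorem lin_one_zero : lin B 1 0 = 1 := by simp [lin]

/-- In characteristic two the translation sends `B` to `B + x` up to an upper right entry that is a
multiple of `x (x + tr B)`. For suitable `x` this entry lies in `℘^ℓ`, where `Ψ` is known. -/
theorem conjU_lin (h2 : (2 : S) = 0) (a : Sˣ) (ha : B 1 0 = a) (x u v : S) :
    conjU a x (lin B u v) = lin B (u + v * x) v +
      !![0, v * (↑a⁻¹ * (x * (x + B.trace))); 0, 0] := by
  have hi : (↑a⁻¹ : S) * a = 1 := Units.inv_mul a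
  rw [conjU, unipotent_inv, coe_unipotent, coe_unipotent, Matrix.trace_fin_two]
  ext i j
  fin_cases i <;> fin_cases j <;>
    simp [lin, Matrix.mul_apply, Matrix.vecMul, dotProduct, Fin.sum_univ_two, ha]
  · linear_combination v * x * hi
  · linear_combination -v * ↑a⁻¹ * x ^ 2 * hi - v * ↑a⁻¹ * x * (B 0 0 + x) * h2
  · linear_combination -v * x * hi - v * x * h2

end Lin

section Character

variable {o : Type*} [CommRing o] [IsLocalRing o] {r : ℕ} {ψ : AddChar (OMod o r) ℂ}
  {B : Matrix (Fin 2) (Fin 2) (OMod o r)} {Ψ : Matrix (Fin 2) (Fin 2) (OMod o r) → ℂ}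

theorem isHat_lin {u v : OMod o r}
    (h : red o (ellUp_le r) (u ^ 2 + u * v * B.trace + v ^ 2 * B.det - 1) = 0) :
    IsHat B (lin B u v) := by
  refine ⟨by rwa [det_lin], lin B u v, lin_mul_comm B u v, ?_⟩
  rw [sub_self]
  exact Matrix.map_zero _ (map_zero _)

theorem isHat_one_add {Y : Matrix (Fin 2) (Fin 2) (OMod o r)}
    (hY : Y.map (red o (ellUp_le r)) = 0) : IsHat B (1 + Y) := by
  refine ⟨?_, 1, by simp, by rwa [add_sub_cancel_left]⟩
  have := det_red_eq (ellUp_le r) (X := 1 + Y) (Y := 1) (by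
    rw [Matrix.map_add _ (map_add _), hY, add_zero])
  rw [map_sub, this, Matrix.det_one, map_one, sub_self]

variable (hmul : ∀ Z Z', IsHat B Z → IsHat B Z' → Ψ (Z * Z') = Ψ Z * Ψ Z')
  (hcong : ∀ Y : Matrix (Fin 2) (Fin 2) (OMod o r), Y.map (red o (ellUp_le r)) = 0 →
        Ψ (1 + Y) = ψ (B * Y).trace)

include hmul hcong

/-- `Z + D = Z (1 + W D)` with `W` the inverse of `Z`, and the second factor lies in `M^ℓ`. -/
theorem hat_add {Z W D : Matrix (Fin 2) (Fin 2) (OMod o r)} (hZ : IsHat B Z) (hW : Z * W = 1)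
    (hD : D.map (red o (ellUp_le r)) = 0) : Ψ (Z + D) = Ψ Z * ψ (B * W * D).trace := by
  have hWD : (W * D).map (red o (ellUp_le r)) = 0 := by rw [map_red_mul, hD, Matrix.mul_zero]
  rw [Matrix.mul_assoc B, ← hcong _ hWD, ← hmul _ _ hZ (isHat_one_add hWD), Matrix.mul_add,
    ← Matrix.mul_assoc, hW, Matrix.mul_one, Matrix.one_mul]

/-- In characteristic two the trace of an element `u + v B` is `v` times the trace of `B`. The
correction `tr (B W D)` is therefore a combination of multiples of `2`, `tr B * c` and `tr B * d`,
and vanishes. -/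
theorem hat_lin_add (h2 : (2 : OMod o r) = 0) {u v c d : OMod o r}
    (h : red o (ellUp_le r) (u ^ 2 + u * v * B.trace + v ^ 2 * B.det - 1) = 0)
    (hc : red o (ellUp_le r) c = 0) (hd : red o (ellUp_le r) d = 0) (hβc : B.trace * c = 0)
    (hβd : B.trace * d = 0) : Ψ (lin B (u + c) (v + d)) = Ψ (lin B u v) := by
  obtain ⟨U, hU⟩ := isUnit_of_red_sub_one h
  -- `u + v tr B + v B` is the adjugate of `u + v B` in characteristic two; dividing it by the
  -- determinant `U` gives the inverse.
  rw [lin_add, hat_add hmul hcong (isHat_lin h) (W := (↑U⁻¹ : OMod o r) • lin B (u + v * B.trace) v)]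
  · rw [Matrix.mul_smul, Matrix.smul_mul, Matrix.trace_smul, mul_lin, lin_mul, trace_lin]
    rw [show 2 * _ + _ = (0 : OMod o r) by
      linear_combination (-(u + v * B.trace + v * B.trace) * d * B.det -
        v * B.det * c) * h2 + (u + v * B.trace + v * B.trace) * hβc +
        (u * B.trace + 2 * v * B.trace ^ 2 - v * B.det) * hβd, smul_zero, AddChar.map_zero_eq_one,
      mul_one]
  · rw [Matrix.mul_smul, lin_mul, smul_lin, ← lin_one_zero B]
    have hU' : (↑U⁻¹ : OMod o r) * U = 1 := U.inv_mul
    rw [hU] at hU'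
    congr 1
    · linear_combination hU' - ↑U⁻¹ * v ^ 2 * B.det * h2
    · linear_combination ↑U⁻¹ * (u * v + v ^ 2 * B.trace) * h2
  · ext i j
    simp [lin, hc, hd]

end Character

/-! ### `Ψ` on scalars and on elements `1 + zB` as additive characters. -/

section Shifts

variable {o : Type*} [CommRing o] [IsDomain o] [IsDiscreteValuationRing o]
  [Finite (ResidueField o)] {ϖ : o} {r : ℕ} {ψ : AddChar (OMod o r) ℂ}

/-- Additivity on `℘^m` produces a shift `s`, and agreement with `s₀` on `℘^ℓ` pins `s` modulo
`℘^ℓ'`. If `m ≥ ℓ` the known formula on `℘^ℓ` suffices, so additivity is only requested for `m ≤ ℓ`.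
-/
theorem exists_mulShift_of_eq (hϖ : Irreducible ϖ)
    (hψ : ψ (Ideal.Quotient.mk _ (ϖ ^ (r - 1))) ≠ 1) (m : ℕ) (θ : OMod o r → ℂ) (s₀ : OMod o r)
    (hs₀ : ∀ y, red o (ellUp_le r) y = 0 → θ y = ψ (s₀ * y))
    (hθ : m ≤ ellUp r → ∀ x y, (Ideal.Quotient.mk _ ϖ : OMod o r) ^ m ∣ x →
      (Ideal.Quotient.mk _ ϖ : OMod o r) ^ m ∣ y → θ (x + y) = θ x * θ y) :
    ∃ s, red o (ellDown_le r) (s - s₀) = 0 ∧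
      ∀ y, (Ideal.Quotient.mk _ ϖ : OMod o r) ^ m ∣ y → θ y = ψ (s * y) := by
  rcases le_total m (ellUp r) with hm | hm
  · obtain ⟨s, hs⟩ := (isChainRing_OMod hϖ r).exists_mulShift_of_add (by rwa [map_pow] at hψ) m θ
      (by rw [hs₀ 0 (map_zero _), mul_zero, AddChar.map_zero_eq_one]) (hθ hm)
    refine ⟨s, red_eq_zero_of_addChar hϖ hψ fun y hy => ?_, hs⟩
    rw [sub_mul, AddChar.map_sub_eq_div, ← hs₀ y hy, ← hs y
      ((pow_dvd_pow _ hm).trans ((red_eq_zero_iff hϖ _).1 hy)), div_self]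
    rw [hs₀ y hy]
    exact (AddChar.val_isUnit ψ _).ne_zero
  · refine ⟨s₀, by rw [sub_self, map_zero], fun y hy => hs₀ y ?_⟩
    rw [red_eq_zero_iff hϖ]
    exact (pow_dvd_pow _ hm).trans hy

variable {B : Matrix (Fin 2) (Fin 2) (OMod o r)} {Ψ : Matrix (Fin 2) (Fin 2) (OMod o r) → ℂ}
  (hmul : ∀ Z Z', IsHat B Z → IsHat B Z' → Ψ (Z * Z') = Ψ Z * Ψ Z')
  (hcong : ∀ Y : Matrix (Fin 2) (Fin 2) (OMod o r), Y.map (red o (ellUp_le r)) = 0 →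
        Ψ (1 + Y) = ψ (B * Y).trace)

include hmul hcong

/-- In `(1 + x)(1 + y) = 1 + (x + y) + xy` the last term lies in `℘^ℓ` and is annihilated by `tr B`,
so it is invisible to `Ψ`. The reference value comes from `tr (B * y) = y tr B`. -/
theorem exists_scalar_shift (hϖ : Irreducible ϖ)
    (hψ : ψ (Ideal.Quotient.mk _ (ϖ ^ (r - 1))) ≠ 1) (h2 : (2 : OMod o r) = 0) {j c : ℕ}
    (hj : red o (ellUp_le r) ((Ideal.Quotient.mk _ ϖ : OMod o r) ^ j * B.trace) = 0)
    (hc : red o (ellUp_le r) ((Ideal.Quotient.mk _ ϖ : OMod o r) ^ c) ^ 2 = 0) :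
    ∃ s, red o (ellDown_le r) (s - B.trace) = 0 ∧
      ∀ y, (Ideal.Quotient.mk _ ϖ : OMod o r) ^ (j + c) ∣ y → Ψ (lin B (1 + y) 0) = ψ (s * y) := by
  refine exists_mulShift_of_eq hϖ hψ (j + c) _ B.trace (fun y hy => ?_) fun _ => ?_
  · have := hcong (lin B y 0) (by ext i j; simp [lin, hy])
    rw [mul_lin, trace_lin] at this
    rw [← add_zero (0 : OMod o r), lin_add, lin_one_zero, this]
    congr 1
    linear_combination -0 * h2
  · rintro _ _ ⟨x, rfl⟩ ⟨y, rfl⟩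
    set q := (Ideal.Quotient.mk _ ϖ : OMod o r) ^ j
    set k := (Ideal.Quotient.mk _ ϖ : OMod o r) ^ c
    rw [pow_add]
    have hk : red o (ellUp_le r) (k ^ 2) = 0 := by rw [map_pow, hc]
    have hz := red_mul_eq_zero (ellUp_le r) (ellUp_le r) (by unfold ellUp; omega) hj hk
    have hH : ∀ z, red o (ellUp_le r) ((1 + q * k * z) ^ 2 + (1 + q * k * z) * 0 * B.trace +
        0 ^ 2 * B.det - 1) = 0 := fun z => by
      rw [show (1 + q * k * z) ^ 2 + (1 + q * k * z) * 0 * B.trace + 0 ^ 2 * B.det - 1 =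
        k ^ 2 * (q * z) ^ 2 by linear_combination q * k * z * h2, map_mul, hk, zero_mul]
    rw [← hmul _ _ (isHat_lin (hH x)) (isHat_lin (hH y)), lin_mul]
    have := hat_lin_add hmul hcong h2 (u := 1 + q * k * (x + y)) (v := 0)
      (c := k ^ 2 * (q ^ 2 * x * y)) (d := 0) (hH _) (by rw [map_mul, hk, zero_mul]) (map_zero _)
      (by linear_combination q * x * y * hz) (mul_zero _)
    rw [add_zero] at this
    rw [← mul_add, ← this]
    congr 2 <;> ring

/-- Here `(1 + xB)(1 + yB)` differs from `1 + (x + y)B` by multiples of `xy` in both coordinates,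
again in `℘^ℓ` and annihilated by `tr B`. The reference value is `tr (B²) = (tr B)²` in
characteristic two. -/
theorem exists_linear_shift (hϖ : Irreducible ϖ)
    (hψ : ψ (Ideal.Quotient.mk _ (ϖ ^ (r - 1))) ≠ 1) (h2 : (2 : OMod o r) = 0) {j c : ℕ}
    (hj : red o (ellUp_le r) ((Ideal.Quotient.mk _ ϖ : OMod o r) ^ j * B.trace) = 0)
    (hjd : red o (ellUp_le r) (((Ideal.Quotient.mk _ ϖ : OMod o r) ^ j) ^ 2 * B.det) = 0)
    (hc : red o (ellUp_le r) ((Ideal.Quotient.mk _ ϖ : OMod o r) ^ c) ^ 2 = 0) :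
    ∃ t, red o (ellDown_le r) (t - B.trace ^ 2) = 0 ∧
      ∀ z, (Ideal.Quotient.mk _ ϖ : OMod o r) ^ (2 * j + c) ∣ z → Ψ (lin B 1 z) = ψ (t * z) := by
  refine exists_mulShift_of_eq hϖ hψ (2 * j + c) _ _ (fun y hy => ?_) fun _ => ?_
  · have := hcong (lin B 0 y) (by ext i j; simp [lin, hy])
    rw [mul_lin, trace_lin] at this
    rw [← add_zero (1 : OMod o r), ← zero_add y, lin_add, lin_one_zero, zero_add, this]
    congr 1
    linear_combination -(y * B.det) * h2
  · rintro _ _ ⟨x, rfl⟩ ⟨y, rfl⟩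
    rw [pow_add, pow_mul']
    set q := (Ideal.Quotient.mk _ ϖ : OMod o r) ^ j
    set k := (Ideal.Quotient.mk _ ϖ : OMod o r) ^ c
    have hk : red o (ellUp_le r) (k ^ 2) = 0 := by rw [map_pow, hc]
    have hz := red_mul_eq_zero (ellUp_le r) (ellUp_le r) (by unfold ellUp; omega) hj hk
    have hH : ∀ z, red o (ellUp_le r) (1 ^ 2 + 1 * (q ^ 2 * k * z) * B.trace +
        (q ^ 2 * k * z) ^ 2 * B.det - 1) = 0 := fun z => by
      rw [show 1 ^ 2 + 1 * (q ^ 2 * k * z) * B.trace + (q ^ 2 * k * z) ^ 2 * B.det - 1 =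
        (q * B.trace) * (q * k * z) + (q ^ 2 * B.det) * (q * k * z) ^ 2 by ring, map_add, map_mul,
        map_mul _ (q ^ 2 * B.det), hj, hjd, zero_mul, zero_mul, add_zero]
    rw [← hmul _ _ (isHat_lin (hH x)) (isHat_lin (hH y)), lin_mul]
    have := hat_lin_add hmul hcong h2 (u := 1) (v := q ^ 2 * k * (x + y))
      (c := -(k ^ 2 * (q ^ 4 * x * y * B.det))) (d := k ^ 2 * (q ^ 4 * x * y * B.trace)) (hH _)
      (by rw [map_neg, map_mul, hk, zero_mul, neg_zero]) (by rw [map_mul, hk, zero_mul])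
      (by linear_combination -q ^ 3 * x * y * B.det * hz)
      (by linear_combination q ^ 3 * x * y * B.trace * hz)
    rw [← mul_add, ← this]
    congr 2 <;> ring

end Shifts

end SL2Growth

namespace SL2Growth

/-! ### Characteristic two: the relation satisfied by the stabilizer. -/

section CharTwo

variable {o : Type*} [CommRing o] [IsDomain o] [IsDiscreteValuationRing o]
  {ϖ : o} {r : ℕ} {ψ : AddChar (OMod o r) ℂ}
  {B : Matrix (Fin 2) (Fin 2) (OMod o r)} {Ψ : Matrix (Fin 2) (Fin 2) (OMod o r) → ℂ}

/-- `Ψ` is evaluated in two ways at the translate by `x ∈ P` of `1 + vB`. Invariance gives one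
value. For the other, the translate is `(1 + vx) + vB` plus a matrix vanishing modulo `℘^ℓ`, and `(1
+ vx) + vB` agrees with `(1 + vx)(1 + v²xB)(1 + vB)` up to corrections that `Ψ` does not see. The
factor `Ψ (1 + vB)` cancels. -/
theorem addChar_eq_one_of_conj (h2 : (2 : OMod o r) = 0)
    (hmul : ∀ Z Z', IsHat B Z → IsHat B Z' → Ψ (Z * Z') = Ψ Z * Ψ Z')
    (hcong : ∀ Y : Matrix (Fin 2) (Fin 2) (OMod o r), Y.map (red o (ellUp_le r)) = 0 →
        Ψ (1 + Y) = ψ (B * Y).trace)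
    (hne : ∀ Z, IsHat B Z → Ψ Z ≠ 0) {a : (OMod o r)ˣ} (ha : B 1 0 = a)
    {X P : AddSubgroup (OMod o r)} (hPX : P ≤ X)
    (hP : ∀ x ∈ P, ∀ Z, (∀ y ∈ X, IsHat B (conjU a y Z)) →
        Ψ (conjU a x Z) = Ψ Z * ψ (-x * (Z.det - 1)))
    (hX : ∀ x ∈ X, red o (ellUp_le r) (x ^ 2) = 0 ∧ red o (ellUp_le r) (x * B.trace) = 0)
    {x v s t : OMod o r} (hx : x ∈ P) (hv : red o (ellUp_le r) (v * B.trace) = 0)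
    (hvd : red o (ellUp_le r) (v ^ 2 * B.det) = 0)
    (hs : Ψ (lin B (1 + v * x) 0) = ψ (s * (v * x)))
    (ht : Ψ (lin B 1 (v ^ 2 * x)) = ψ (t * (v ^ 2 * x))) :
    ψ (s * v * x + v * x ^ 2 + v ^ 2 * x * (t + B.det)) = 1 := by
  have zero : ∀ {y z : OMod o r}, red o (ellUp_le r) y = 0 → red o (ellUp_le r) z = 0 →
      y * z = 0 := red_mul_eq_zero _ _ (by unfold ellUp; omega)
  obtain ⟨hx2, hxb⟩ := hX x (hPX hx)
  have hdet : ∀ y, red o (ellUp_le r) (y ^ 2) = 0 → red o (ellUp_le r)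
      ((1 + v * y) ^ 2 + (1 + v * y) * v * B.trace + v ^ 2 * B.det - 1) = 0 := fun y hy => by
    rw [show (1 + v * y) ^ 2 + (1 + v * y) * v * B.trace + v ^ 2 * B.det - 1 =
      v ^ 2 * y ^ 2 + (1 + v * y) * (v * B.trace) + v ^ 2 * B.det by
        linear_combination v * y * h2, map_add, map_add, hvd, map_mul _ (v ^ 2), hy,
      map_mul _ (1 + v * y), hv]
    simp
  have hE : ∀ y ∈ X, (!![0, v * (↑a⁻¹ * (y * (y + B.trace))); 0, 0] :
      Matrix (Fin 2) (Fin 2) (OMod o r)).map (red o (ellUp_le r)) = 0 := fun y hy => by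
    obtain ⟨h3, h4⟩ := hX y hy
    have : red o (ellUp_le r) (v * (↑a⁻¹ * (y * (y + B.trace)))) = 0 := by
      rw [show v * (↑a⁻¹ * (y * (y + B.trace))) = v * ↑a⁻¹ * (y ^ 2 + y * B.trace) by ring,
        map_mul, map_add, h3, h4, add_zero, mul_zero]
    ext i k
    fin_cases i <;> fin_cases k
    · simp
    · exact this
    · simp
    · simp
  have hconj : ∀ y, conjU a y (lin B 1 v) = lin B (1 + v * y) v +
      !![0, v * (↑a⁻¹ * (y * (y + B.trace))); 0, 0] := fun y => conjU_lin B h2 a ha y 1 v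
  have hg : red o (ellUp_le r) (1 ^ 2 + 1 * v * B.trace + v ^ 2 * B.det - 1) = 0 := by
    have := hdet 0 (by simp)
    simpa using this
  have hw := hdet x hx2
  -- the conjugate is again in the group
  have hmem : ∀ y ∈ X, IsHat B (conjU a y (lin B 1 v)) := fun y hy => by
    refine ⟨?_, lin B (1 + v * y) v, lin_mul_comm _ _ _, ?_⟩
    · have : (conjU a y (lin B 1 v)).det = (lin B 1 v).det := by
        rw [conjU, Matrix.det_mul, Matrix.det_mul, Matrix.SpecialLinearGroup.det_coe,
          Matrix.SpecialLinearGroup.det_coe, one_mul, mul_one]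
      rw [this, det_lin, hg]
    · rw [hconj, add_sub_cancel_left]
      exact hE y hy
  have h1 := hP x hx _ hmem
  -- the value at the conjugate
  obtain ⟨U, hU⟩ := isUnit_of_red_sub_one hw
  have hUi : (↑U⁻¹ : OMod o r) * U = 1 := U.inv_mul
  have h3 : Ψ (conjU a x (lin B 1 v)) =
      Ψ (lin B (1 + v * x) v) * ψ (v * (1 + v * x) * (x * (x + B.trace))) := by
    rw [hconj, hat_add hmul hcong (isHat_lin hw)
      (W := (↑U⁻¹ : OMod o r) • lin B (1 + v * x + v * B.trace) v) _ (hE x (hPX hx))]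
    · congr 2
      have hx3 : red o (ellUp_le r) (x * (x + B.trace)) = 0 := by
        rw [show x * (x + B.trace) = x ^ 2 + x * B.trace by ring, map_add, hx2, hxb, add_zero]
      have hz := zero hx3 hw
      rw [← hU, Matrix.trace_fin_two] at hz
      have hai : (↑a⁻¹ : OMod o r) * a = 1 := Units.inv_mul a
      rw [Matrix.mul_smul, Matrix.smul_mul, Matrix.trace_smul, mul_lin, smul_eq_mul]
      simp only [lin, Matrix.trace_fin_two, Matrix.mul_apply, Fin.sum_univ_two]
      simp [ha]
      linear_combination (↑U⁻¹ * (1 + v * x + 2 * v * (B 0 0 + B 1 1)) * v * x *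
          (x + (B 0 0 + B 1 1))) * hai +
        ↑U⁻¹ * v * x * (x + (B 0 0 + B 1 1)) * v * (B 0 0 + B 1 1) * h2 -
        v * (1 + v * x) * ↑U⁻¹ * hz + v * (1 + v * x) * (x * (x + (B 0 0 + B 1 1))) * hUi
    · rw [Matrix.mul_smul, lin_mul, smul_lin, ← lin_one_zero B]
      rw [hU] at hUi
      congr 1
      · linear_combination hUi - ↑U⁻¹ * v ^ 2 * B.det * h2
      · linear_combination ↑U⁻¹ * ((1 + v * x) * v + v ^ 2 * B.trace) * h2
  have h4 : Ψ (lin B (1 + v * x) v) =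
      ψ (s * (v * x)) * ψ (t * (v ^ 2 * x)) * Ψ (lin B 1 v) := by
    have hx2' : ∀ y, red o (ellUp_le r) (x ^ 2 * y) = 0 := fun y => by rw [map_mul, hx2, zero_mul]
    have hb' : ∀ y, red o (ellUp_le r) (v * B.trace * y) = 0 := fun y => by
      rw [map_mul, hv, zero_mul]
    have hd' : ∀ y, red o (ellUp_le r) (v ^ 2 * B.det * y) = 0 := fun y => by
      rw [map_mul, hvd, zero_mul]
    have h012 : ∀ y z w, red o (ellUp_le r)
        (x ^ 2 * y + v * B.trace * z + v ^ 2 * B.det * w) = 0 := fun y z w => by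
      rw [map_add, map_add, hx2', hb', hd', add_zero, add_zero]
    have hA : IsHat B (lin B (1 + v * x) 0) := isHat_lin (by
      rw [← hx2' (v ^ 2)]
      congr 1
      linear_combination v * x * h2)
    have hC : IsHat B (lin B 1 (v ^ 2 * x)) := isHat_lin (by
      rw [← h012 0 (v * x) (v ^ 2 * x ^ 2)]
      congr 1
      ring)
    have hAC : IsHat B (lin B (1 + v * x) 0 * lin B 1 (v ^ 2 * x)) := by
      rw [lin_mul]
      refine isHat_lin ?_
      rw [← h012 (v ^ 2) ((1 + v * x) ^ 2 * v * x) ((1 + v * x) ^ 2 * v ^ 2 * x ^ 2)]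
      congr 1
      linear_combination v * x * h2
    rw [← hs, ← ht, ← hmul _ _ hA hC, ← hmul _ _ hAC (isHat_lin hg), lin_mul, lin_mul]
    have e1 := zero hv hx2
    have e2 := zero hv hv
    have e3 := zero hv hvd
    have := hat_lin_add hmul hcong h2 (u := 1 + v * x) (v := v)
      (c := v ^ 2 * B.det * (-(1 + v * x) * v * x))
      (d := x ^ 2 * v ^ 3 + v * B.trace * ((1 + v * x) * v ^ 2 * x)) hw (hd' _)
      (by rw [map_add, hx2', hb', add_zero])
      (by linear_combination -(1 + v * x) * x * e3)
      (by linear_combination v ^ 2 * e1 + (1 + v * x) * v * x * e2)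
    rw [← this]
    congr 2
    · ring
    · linear_combination -v ^ 2 * x * h2
  -- The scalar `1 + vx` yields `ψ (v² x³) = 1`, which removes the cubic term in `x` from the
  -- comparison.
  have hz := addChar_mul_sq_sub_one hne hP hx (z := 1 + v * x) (by
    rw [show (1 + v * x) ^ 2 - 1 = v ^ 2 * x ^ 2 by linear_combination v * x * h2, map_mul, hx2,
      mul_zero])
  rw [h3, h4] at h1
  have hg0 := hne _ (isHat_lin hg)
  have h5 : ψ (s * (v * x)) * ψ (t * (v ^ 2 * x)) * ψ (v * (1 + v * x) * (x * (x + B.trace))) =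
      ψ (-x * ((lin B 1 v).det - 1)) := by
    refine mul_left_cancel₀ hg0 ?_
    rw [← h1]
    ring
  rw [← AddChar.map_add_eq_mul, ← AddChar.map_add_eq_mul, det_lin] at h5
  have e1 := zero hv hx2
  have h6 : s * v * x + v * x ^ 2 + v ^ 2 * x * (t + B.det) =
      (s * (v * x) + t * (v ^ 2 * x) + v * (1 + v * x) * (x * (x + B.trace))) -
        -x * (1 ^ 2 + 1 * v * B.trace + v ^ 2 * B.det - 1) - x * ((1 + v * x) ^ 2 - 1) := by
    linear_combination -v * e1 - (v * B.trace * x - v * x ^ 2) * h2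
  rw [h6, AddChar.map_sub_eq_div, hz, AddChar.map_sub_eq_div, h5, div_self, div_one]
  exact (AddChar.val_isUnit ψ _).ne_zero

/-- The exponent `c` is such that the ideal generated by `p ^ c` consists of translations that keep
`1 + vB` in the `IsHat` matrices. The exponent `j` is such that for `v` in `℘^j` the determinant of
`1 + vB` is `1` modulo `℘^ℓ`. -/
theorem exists_char_two_conditions [Finite (ResidueField o)] {V : Type*} [AddCommGroup V] [Module ℂ V]
    {ρ : Representation ℂ (SL(2, OMod o r)) V} [FiniteDimensional ℂ V] (hϖ : Irreducible ϖ)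
    (hψ : ψ (Ideal.Quotient.mk _ (ϖ ^ (r - 1))) ≠ 1) (h2 : (2 : OMod o r) = 0)
    (ha : IsUnit (B 1 0))
    (hne : isoPart (psiBracket ψ (B.map (red o (ellDown_le r)))) ρ ≠ ⊥)
    {j c : ℕ} (hj : red o (ellUp_le r) ((Ideal.Quotient.mk _ ϖ : OMod o r) ^ j * B.trace) = 0)
    (hjd : red o (ellUp_le r) (((Ideal.Quotient.mk _ ϖ : OMod o r) ^ j) ^ 2 * B.det) = 0)
    (hc : red o (ellUp_le r) ((Ideal.Quotient.mk _ ϖ : OMod o r) ^ c) ^ 2 = 0)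
    (hcb : red o (ellUp_le r) ((Ideal.Quotient.mk _ ϖ : OMod o r) ^ c * B.trace) = 0) :
    ∃ (s t : OMod o r) (P : AddSubgroup (OMod o r)),
      red o (ellDown_le r) (s - B.trace) = 0 ∧ red o (ellDown_le r) (t - B.trace ^ 2) = 0 ∧
      (∀ x ∈ P, (Ideal.Quotient.mk _ ϖ : OMod o r) ^ c ∣ x) ∧
      (∀ x ∈ P, ∀ w, red o (ellUp_le r) (w ^ 2) = 0 → ψ (x * w ^ 2) = 1) ∧
      (∀ x ∈ P, ∀ v, (Ideal.Quotient.mk _ ϖ : OMod o r) ^ j ∣ v →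
        ψ (s * v * x + v * x ^ 2 + v ^ 2 * x * (t + B.det)) = 1) ∧
      Nat.card (((Ideal.span {(Ideal.Quotient.mk _ ϖ : OMod o r) ^ c}).toAddSubgroup).map
          (red o (ellDown_le r)).toAddMonoidHom) ≤
        Nat.card (P.map (red o (ellDown_le r)).toAddMonoidHom) *
          Module.finrank ℂ (isoPart (psiBracket ψ (B.map (red o (ellDown_le r)))) ρ) := by
  obtain ⟨a, ha⟩ := ha
  have hX : ∀ x ∈ (Ideal.span {(Ideal.Quotient.mk _ ϖ : OMod o r) ^ c}).toAddSubgroup,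
      red o (ellUp_le r) (x ^ 2) = 0 ∧ red o (ellUp_le r) (x * B.trace) = 0 := by
    intro x hx
    obtain ⟨y, rfl⟩ := Ideal.mem_span_singleton.1 hx
    refine ⟨by rw [mul_pow, map_mul, map_pow, hc, zero_mul], ?_⟩
    rw [mul_right_comm, map_mul, hcb, zero_mul]
  have hdown : ∀ x, red o (ellUp_le r) x = 0 → red o (ellDown_le r) x = 0 := fun x hx => by
    rw [red_eq_zero_iff hϖ] at hx ⊢
    exact (pow_dvd_pow _ (by unfold ellUp ellDown; omega)).trans hx
  obtain ⟨Ψ, P, hPX, hmul, hcong, hΨ0, hP, hcard⟩ := exists_hat_character hϖ hψ ha.symm hne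
    (Ideal.span {(Ideal.Quotient.mk _ ϖ : OMod o r) ^ c}).toAddSubgroup (fun x hx => by
      obtain ⟨h3, h4⟩ := hX x hx
      refine ⟨by rw [h2, zero_mul, map_zero], hdown _ ?_⟩
      rw [show x * (x + (B 1 1 - B 0 0)) = x ^ 2 + x * B.trace by
        rw [Matrix.trace_fin_two]; linear_combination -x * B 0 0 * h2, map_add, h3, h4, add_zero])
  obtain ⟨s, hs, hs'⟩ := exists_scalar_shift hmul hcong hϖ hψ h2 hj hc
  obtain ⟨t, ht, ht'⟩ := exists_linear_shift hmul hcong hϖ hψ h2 hj hjd hc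
  refine ⟨s, t, P, hs, ht, fun x hx => Ideal.mem_span_singleton.1 (hPX hx), ?_, ?_, hcard⟩
  · intro x hx w hw
    have := addChar_mul_sq_sub_one hΨ0 hP hx (z := 1 + w) (by
      rw [show (1 + w) ^ 2 - 1 = w ^ 2 by linear_combination w * h2, hw])
    rwa [show (1 + w) ^ 2 - 1 = w ^ 2 by linear_combination w * h2] at this
  · intro x hx v hv
    have hxc := Ideal.mem_span_singleton.1 (hPX hx)
    obtain ⟨v, rfl⟩ := hv
    refine addChar_eq_one_of_conj h2 hmul hcong hΨ0 ha.symm hPX hP hX hx ?_ ?_ (hs' _ ?_) (ht' _ ?_)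
    · rw [mul_right_comm, map_mul, hj, zero_mul]
    · rw [mul_pow, mul_right_comm, map_mul, hjd, zero_mul]
    · rw [pow_add]
      exact mul_dvd_mul (dvd_mul_right _ _) hxc
    · rw [pow_add, pow_mul', mul_pow]
      exact mul_dvd_mul (dvd_mul_right _ _) hxc

end CharTwo

end SL2Growth

namespace SL2Growth

namespace IsChainRing

/-! ### Valuations, squares and a splitting adapted to `ψ`. -/

section Arithmetic

variable {R : Type*} [CommRing R] {p : R} {r : ℕ} (h : IsChainRing p r)

include h

theorem not_pow_dvd_of_lt {M a b c : ℕ} (hM : M ≤ r) {u v w : R} (hu : IsUnit u)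
    (ha : a < M) (hab : a < b) (hac : a < c) : ¬ p ^ M ∣ u * p ^ a + v * p ^ b + w * p ^ c := by
  obtain ⟨u, rfl⟩ := hu
  intro hd
  have h1 : p ^ (a + 1) ∣ u * p ^ a := by
    have h2 := dvd_sub (dvd_sub ((pow_dvd_pow p ha).trans hd) ((pow_dvd_pow p hac).mul_left w))
      ((pow_dvd_pow p hab).mul_left v)
    rwa [show u * p ^ a + v * p ^ b + w * p ^ c - w * p ^ c - v * p ^ b = u * p ^ a by ring] at h2
  have := (h.dvd_unit_mul_iff (by omega) u).1 h1
  omega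

/-- The minimum of three valuations is attained twice if the sum has a larger valuation. -/
theorem eq_or_eq_or_eq_of_dvd {M a b c : ℕ} (hM : M ≤ r) {u v w : R} (hu : IsUnit u)
    (hv : IsUnit v) (hw : IsUnit w) (hd : p ^ M ∣ u * p ^ a + v * p ^ b + w * p ^ c)
    (hlt : a < M ∨ b < M ∨ c < M) : a = b ∨ a = c ∨ b = c := by
  by_contra! hne
  have h1 := h.not_pow_dvd_of_lt (a := a) (b := b) (c := c) hM (v := v) (w := w) hu
  have h2 := h.not_pow_dvd_of_lt (a := b) (b := a) (c := c) hM (v := u) (w := w) hv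
  have h3 := h.not_pow_dvd_of_lt (a := c) (b := a) (c := b) hM (v := u) (w := v) hw
  rw [show v * p ^ b + u * p ^ a + w * p ^ c = u * p ^ a + v * p ^ b + w * p ^ c by ring] at h2
  rw [show w * p ^ c + u * p ^ a + v * p ^ b = u * p ^ a + v * p ^ b + w * p ^ c by ring] at h3
  by_cases ha : a < M ∧ a < b ∧ a < c
  · exact h1 ha.1 ha.2.1 ha.2.2 hd
  by_cases hb : b < M ∧ b < a ∧ b < c
  · exact h2 hb.1 hb.2.1 hb.2.2 hd
  by_cases hc : c < M ∧ c < a ∧ c < b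
  · exact h3 hc.1 hc.2.1 hc.2.2 hd
  omega

/-- Successive approximation: in characteristic two squaring is additive, so an error of even order
is absorbed into `y` and one of odd order into `z`. -/
theorem exists_sq_add_mul_sq (h2 : (2 : R) = 0) (hsq : ∀ x : R, ∃ y, p ∣ x - y ^ 2) (x : R) :
    ∃ y z, x = y ^ 2 + p * z ^ 2 := by
  have key : ∀ n : ℕ, ∃ y z, p ^ n ∣ x - (y ^ 2 + p * z ^ 2) := by
    intro n
    induction n with
    | zero => exact ⟨0, 0, by simp⟩
    | succ n ih =>
      obtain ⟨y, z, c, hc⟩ := ih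
      obtain ⟨d, e, he⟩ := hsq c
      rcases Nat.even_or_odd' n with ⟨i, rfl | rfl⟩
      · refine ⟨y + p ^ i * d, z, e, ?_⟩
        linear_combination hc + p ^ (2 * i) * he - y * p ^ i * d * h2
      · refine ⟨y, z + p ^ i * d, e, ?_⟩
        linear_combination hc + p ^ (2 * i + 1) * he - p * z * p ^ i * d * h2
  obtain ⟨y, z, hyz⟩ := key r
  exact ⟨y, z, sub_eq_zero.1 (h.eq_zero_of_dvd le_rfl hyz)⟩

variable [Finite R] {ψ : AddChar R ℂ}

theorem exists_sq_shift (hψ : ψ (p ^ (r - 1)) ≠ 1) (h2 : (2 : R) = 0) (c : R) :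
    ∃ s, ∀ y, ψ (c * y ^ 2) = ψ (s * y) := by
  refine h.exists_mulShift hψ
    { toFun := fun y => ψ (c * y ^ 2)
      map_zero_eq_one' := by simp
      map_add_eq_mul' := fun x y => by
        rw [← AddChar.map_add_eq_mul]
        congr 1
        linear_combination c * x * y * h2 }

/-- A splitting of a chain ring of characteristic `2` over its squares that is adapted to a
primitive character. -/
theorem exists_splitting (hr : 1 ≤ r) (hψ : ψ (p ^ (r - 1)) ≠ 1) (h2 : (2 : R) = 0)
    (hsq : ∀ x : R, ∃ y, p ∣ x - y ^ 2) :
    ∃ κ κ' γ : Rˣ, (∀ y, ψ (κ * p ^ (r % 2) * y ^ 2) = 1) ∧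
      (∀ y, ψ (κ' * p ^ (1 - r % 2) * y ^ 2) = ψ (γ * p ^ (r / 2) * y)) ∧
      ∀ x, ∃ y z, x = κ * p ^ (r % 2) * y ^ 2 + κ' * p ^ (1 - r % 2) * z ^ 2 := by
  -- Both `ψ(y²)` and `ψ(p y²)` are characters in `y`, with parameters `A` and `C`. The one whose
  -- squares reach the socle (`C` for even `r`, `A` for odd `r`) has valuation exactly `r / 2`; the
  -- other is a multiple of it.
  obtain ⟨A, hA⟩ := h.exists_sq_shift hψ h2 1
  obtain ⟨C, hC⟩ := h.exists_sq_shift hψ h2 p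
  have hdvd : ∀ {s : R} {c : R} {m : ℕ}, (∀ y, ψ (c * y ^ 2) = ψ (s * y)) → m ≤ r →
      c * p ^ (2 * m) = 0 → p ^ (r - m) ∣ s := fun {s c m} hs hm hc =>
    h.pow_dvd_of_addChar hψ hm fun y => by
      rw [← hs, show c * (p ^ m * y) ^ 2 = c * p ^ (2 * m) * y ^ 2 by ring, hc, zero_mul,
        AddChar.map_zero_eq_one]
  have hpow : ∀ m, r ≤ m → p ^ m = 0 := fun m hm => h.eq_zero_of_dvd hm dvd_rfl
  rcases Nat.even_or_odd' r with ⟨n, hn | hn⟩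
  · have e1 : r % 2 = 0 := by omega
    have e2 : r / 2 = n := by omega
    have hCn : p ^ n ∣ C := by
      have := hdvd hC (m := n) (by omega) (by rw [← pow_succ', hpow _ (by omega)])
      rwa [show r - n = n by omega] at this
    have hAn : p ^ n ∣ A := by
      have := hdvd hA (m := n) (by omega) (by rw [one_mul, hpow _ (by omega)])
      rwa [show r - n = n by omega] at this
    obtain ⟨k, hnk, hkr, u, rfl⟩ := h.exists_unit_of_dvd (by omega) hCn
    -- At `y = p ^ (n - 1)` the argument `p y²` generates the socle, so a larger valuation of `C`
    -- would make `ψ` trivial there.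
    have hk : k = n := by
      by_contra hk
      refine hψ ?_
      have := hC (p ^ (n - 1))
      rw [← pow_mul, ← pow_succ', mul_assoc, ← pow_add, hpow (k + (n - 1)) (by omega), mul_zero,
        AddChar.map_zero_eq_one] at this
      rwa [show (n - 1) * 2 + 1 = r - 1 by omega] at this
    subst hk
    obtain ⟨m, rfl⟩ := hAn
    obtain ⟨κ, hκ⟩ := h.isUnit_one_add (dvd_mul_right p ((↑u⁻¹ * m) ^ 2))
    -- The unit `κ = 1 + p (u⁻¹ m)²` is chosen so that the character of `y²` and that of `p (u⁻¹ m
    -- y)²` have the same parameter and cancel.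
    have hu : (u : R) * ↑u⁻¹ = 1 := u.mul_inv
    have hk1 : ∀ y, ψ ((1 + p * (↑u⁻¹ * m) ^ 2) * y ^ 2) = 1 := fun y => by
      rw [show (1 + p * (↑u⁻¹ * m) ^ 2) * y ^ 2 = 1 * y ^ 2 + p * (↑u⁻¹ * m * y) ^ 2 by ring,
        AddChar.map_add_eq_mul, hA, hC, ← AddChar.map_add_eq_mul, ← AddChar.map_zero_eq_one ψ]
      congr 1
      linear_combination p ^ k * m * y * hu + p ^ k * m * y * h2
    refine ⟨κ, 1, u, ?_, ?_, ?_⟩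
    · intro y
      rw [e1, pow_zero, mul_one, hκ, hk1]
    · intro y
      rw [e1, e2, Units.val_one, one_mul, pow_one, hC]
    · intro x
      obtain ⟨y, z, rfl⟩ := h.exists_sq_add_mul_sq h2 hsq x
      refine ⟨y, z + ↑u⁻¹ * m * y, ?_⟩
      rw [e1, hκ, Units.val_one]
      linear_combination -p * (z * (↑u⁻¹ * m * y) + (↑u⁻¹ * m * y) ^ 2) * h2
  · have e1 : r % 2 = 1 := by omega
    have e2 : r / 2 = n := by omega
    have hCn : p ^ (n + 1) ∣ C := by
      have := hdvd hC (m := n) (by omega) (by rw [← pow_succ', hpow _ (by omega)])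
      rwa [show r - n = n + 1 by omega] at this
    have hAn : p ^ n ∣ A := by
      have := hdvd hA (m := n + 1) (by omega) (by rw [one_mul, hpow _ (by omega)])
      rwa [show r - (n + 1) = n by omega] at this
    obtain ⟨k, hnk, hkr, u, rfl⟩ := h.exists_unit_of_dvd (by omega) hAn
    -- The odd case exchanges the roles: now `y = p ^ n` makes `y²` the socle generator.
    have hk : k = n := by
      by_contra hk
      refine hψ ?_
      have := hA (p ^ n)
      rw [← pow_mul, mul_assoc, ← pow_add, hpow (k + n) (by omega), mul_zero,
        AddChar.map_zero_eq_one, one_mul] at this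
      rwa [show n * 2 = r - 1 by omega] at this
    subst hk
    obtain ⟨m, rfl⟩ := hCn
    obtain ⟨κ, hκ⟩ := h.isUnit_one_add (dvd_mul_right p ((↑u⁻¹ * m) ^ 2))
    have hu : (u : R) * ↑u⁻¹ = 1 := u.mul_inv
    have hk1 : ∀ y, ψ ((1 + p * (↑u⁻¹ * m) ^ 2) * p * y ^ 2) = 1 := fun y => by
      rw [show (1 + p * (↑u⁻¹ * m) ^ 2) * p * y ^ 2 = p * y ^ 2 + 1 * (p * ↑u⁻¹ * m * y) ^ 2 by ring,
        AddChar.map_add_eq_mul, hA, hC, ← AddChar.map_add_eq_mul, ← AddChar.map_zero_eq_one ψ]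
      congr 1
      linear_combination p ^ (k + 1) * m * y * hu + p ^ (k + 1) * m * y * h2
    refine ⟨κ, 1, u, ?_, ?_, ?_⟩
    · intro y
      rw [e1, pow_one, hκ, hk1]
    · intro y
      rw [e1, e2, Units.val_one, Nat.sub_self, pow_zero, mul_one, hA]
    · intro x
      obtain ⟨y, z, rfl⟩ := h.exists_sq_add_mul_sq h2 hsq x
      refine ⟨z, y + p * ↑u⁻¹ * m * z, ?_⟩
      rw [e1, hκ, Units.val_one]
      linear_combination -(y * (p * ↑u⁻¹ * m * z) + (p * ↑u⁻¹ * m * z) ^ 2) * h2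

end Arithmetic

end IsChainRing

end SL2Growth

namespace SL2Growth

namespace IsChainRing

/-! ### Solving the relation: traces of small and of large valuation. -/

section Valuations

variable {R : Type*} [CommRing R] {p : R} {r : ℕ} (h : IsChainRing p r)

include h

theorem mul_eq_zero_of_dvd {x y : R} {m n : ℕ} (hmn : r ≤ m + n) (hx : p ^ m ∣ x)
    (hy : p ^ n ∣ y) : x * y = 0 :=
  h.eq_zero_of_dvd hmn (by rw [pow_add]; exact mul_dvd_mul hx hy)

/-- The case of a trace of small valuation. -/
theorem pow_dvd_of_trace_small {ψ : AddChar R ℂ} (hψ : ψ (p ^ (r - 1)) ≠ 1) (hr : 2 ≤ r)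
    {b : ℕ} (hb : 2 * b < (r + 1) / 2) {β s t δ x : R} {u : Rˣ} (hβ : β = u * p ^ b)
    (hs : p ^ (r / 2) ∣ s - β) (hx : p ^ ((r + 1) / 2 - b) ∣ x)
    (hst : ∀ v, p ^ ((r + 1) / 2 - b) ∣ v → ψ (s * v * x + v * x ^ 2 + v ^ 2 * x * (t + δ)) = 1) :
    p ^ (r / 2) ∣ x := by
  by_contra hnd
  obtain ⟨e, he, w, rfl⟩ := h.exists_unit_of_not_dvd (by omega) hnd
  have hle := (h.dvd_unit_mul_iff (by omega) w).1 hx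
  have hw : (w : R) * ↑w⁻¹ = 1 := w.mul_inv
  have hu : (u : R) * ↑u⁻¹ = 1 := u.mul_inv
  -- This `v` makes `s v x` the socle generator, while `v x²` and `v² x` vanish because `ℓ - b ≤ e <
  -- ℓ'` and `2b < ℓ`. The relation then contradicts nontriviality of `ψ` on the socle.
  set v : R := ↑u⁻¹ * ↑w⁻¹ * p ^ (r - 1 - b - e) with hv
  have hvd : p ^ ((r + 1) / 2 - b) ∣ v := (pow_dvd_pow p (by omega)).mul_left _
  refine hψ ?_
  have := hst v hvd
  have hz1 : (s - β) * (v * (w * p ^ e)) = 0 := by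
    refine h.mul_eq_zero_of_dvd (m := r / 2) (n := r - 1 - b - e + e) (by omega) hs ?_
    rw [pow_add]
    exact mul_dvd_mul (dvd_mul_left _ _) (dvd_mul_left _ _)
  have hz2 : v * (w * p ^ e) ^ 2 = 0 := by
    refine h.mul_eq_zero_of_dvd (m := r - 1 - b - e) (n := e * 2) (by omega) (dvd_mul_left _ _) ?_
    rw [mul_pow, ← pow_mul]
    exact dvd_mul_left _ _
  have hz3 : v ^ 2 * (w * p ^ e) = 0 := by
    refine h.mul_eq_zero_of_dvd (m := (r - 1 - b - e) * 2) (n := e) (by omega) ?_ (dvd_mul_left _ _)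
    rw [hv, mul_pow, ← pow_mul]
    exact dvd_mul_left _ _
  have hz4 : s * v * (w * p ^ e) = p ^ (r - 1) := by
    have e1 : p ^ b * p ^ (r - 1 - b - e) * p ^ e = p ^ (r - 1) := by
      rw [← pow_add, ← pow_add]
      congr 1
      omega
    have e2 : s * v * (w * p ^ e) = β * v * (w * p ^ e) := by linear_combination hz1
    rw [e2, hβ, hv, ← e1]
    linear_combination p ^ b * p ^ (r - 1 - b - e) * p ^ e * (w * ↑w⁻¹ * hu + hw)
  rwa [hz2, hz3, hz4, zero_mul, add_zero, add_zero] at this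

/-- Removing squares from the determinant by adding a scalar matrix. -/
theorem exists_shift_det (h2 : (2 : R) = 0) (hsq : ∀ x : R, ∃ y, p ∣ x - y ^ 2) {β δ : R}
    (hβ : p ^ (((r + 1) / 2 + 1) / 2) ∣ β) : ∃ s, p ^ (r / 2) ∣ δ + s * β + s ^ 2 ∨
      ∃ k, 2 * k + 1 < r / 2 ∧ ∃ w : Rˣ, δ + s * β + s ^ 2 = w * p ^ (2 * k + 1) := by
  have key : ∀ n ≤ r / 2, ∃ s, p ^ n ∣ δ + s * β + s ^ 2 ∨
      ∃ k, 2 * k + 1 < r / 2 ∧ ∃ w : Rˣ, δ + s * β + s ^ 2 = w * p ^ (2 * k + 1) := by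
    intro n hn
    induction n with
    | zero => exact ⟨0, Or.inl (by simp)⟩
    | succ n ih =>
      obtain ⟨s, hs | hs⟩ := ih (by omega)
      swap
      · exact ⟨s, Or.inr hs⟩
      obtain ⟨m, hnm, hm, w, hw⟩ := h.exists_unit_of_dvd (by omega) hs
      rcases Nat.lt_or_ge n m with hlt | hge
      · exact ⟨s, Or.inl (by rw [hw]; exact (pow_dvd_pow p hlt).mul_left _)⟩
      obtain rfl : m = n := by omega
      rcases Nat.even_or_odd' m with ⟨i, rfl | rfl⟩
      · obtain ⟨d, hd⟩ := hsq w
        refine ⟨s + p ^ i * d, Or.inl ?_⟩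
        have e : δ + (s + p ^ i * d) * β + (s + p ^ i * d) ^ 2 =
            p ^ (2 * i) * (w - d ^ 2) + d * (p ^ i * β) := by
          linear_combination hw + (s * p ^ i * d + p ^ (2 * i) * d ^ 2) * h2
        rw [e]
        refine dvd_add ?_ (Dvd.dvd.mul_left ?_ _)
        · rw [pow_succ]
          exact mul_dvd_mul_left _ hd
        · refine (pow_dvd_pow p (n := i + ((r + 1) / 2 + 1) / 2) (by omega)).trans ?_
          rw [pow_add]
          exact mul_dvd_mul_left _ hβ
      · exact ⟨s, Or.inr ⟨i, by omega, w, hw⟩⟩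
  exact key _ le_rfl

variable [Finite R]

set_option maxHeartbeats 400000 in
/-- The case of a trace of large valuation: only three valuations can occur. -/
theorem exists_valuations_of_trace_large {ψ : AddChar R ℂ} (hψ : ψ (p ^ (r - 1)) ≠ 1) (hr : 2 ≤ r)
    (h2 : (2 : R) = 0) (hsq : ∀ x : R, ∃ y, p ∣ x - y ^ 2) {β s t δ : R} {j : ℕ}
    (hβ : p ^ (((r + 1) / 2 + 1) / 2) ∣ β) (hs : p ^ (r / 2) ∣ s - β)
    (ht : p ^ (r / 2) ∣ t - β ^ 2) (hjβ : p ^ ((r + 1) / 2) ∣ p ^ j * β)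
    (hjδ : p ^ ((r + 1) / 2) ∣ (p ^ j) ^ 2 * δ) (hjr : r % 2 ≤ j)
    (hj : j = r % 2 ∨
      (∃ b < r / 2, ¬ p ^ (b + 1) ∣ β ∧ b + j ≤ (r + 1) / 2) ∨
      ∃ k, 2 * k + 1 < r / 2 ∧ (∃ w : Rˣ, δ = w * p ^ (2 * k + 1)) ∧
        2 * j + 2 * k ≤ (r + 1) / 2) :
    ∃ I : Finset ℕ, I.card ≤ 3 ∧ ∀ x, p ^ (((r + 1) / 2 + 1) / 2) ∣ x →
      (∀ w, p ^ ((r + 1) / 2) ∣ w ^ 2 → ψ (x * w ^ 2) = 1) →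
      (∀ v, p ^ j ∣ v → ψ (s * v * x + v * x ^ 2 + v ^ 2 * x * (t + δ)) = 1) →
      p ^ (r / 2) ∣ x ∨ ∃ i ∈ I, ∃ w : Rˣ, x = w * p ^ i := by
  obtain ⟨κ, κ', γ, hκ, hκ', hdec⟩ := h.exists_splitting (by omega) hψ h2 hsq
  set ε := r % 2 with hε
  set D := r / 2 with hD
  set L := (r + 1) / 2 with hL
  have hrε : r = 2 * D + ε := by omega
  have hLε : L = D + ε := by omega
  have hε1 : ε ≤ 1 := by omega
  obtain ⟨τ₀, τ₁, hτ⟩ := hdec (κ * p ^ ε * (t + δ))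
  obtain ⟨vs, hvs, us, hus⟩ := h.exists_unit s
  obtain ⟨m₁, hm₁, u₁, hu₁⟩ := h.exists_unit τ₁
  -- If `x` has valuation `ε + 2 e₀ < D`, the three terms of the quartic relation have valuations
  -- `2ε + 4e₀`, `vs + ε + 2e₀` and `D + m₁ + e₀`. Each pairwise equality determines `e₀`, and the
  -- listed numbers are the resulting values of `ε + 2 e₀`.
  refine ⟨{vs, 2 * ((D + m₁ - 2 * ε) / 3) + ε, 2 * (D + m₁ - vs - ε) + ε}, Finset.card_le_three,
    fun x hx hc1 hst => ?_⟩
  obtain ⟨x₀, x₁, hx01⟩ := hdec x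
  -- the second component is small
  have hx₁ : p ^ (L - (L + 1) / 2) ∣ x₁ := by
    have h1 : p ^ (r - (L + 1) / 2) ∣ γ * p ^ D * x₁ := by
      refine h.pow_dvd_of_addChar hψ (by omega) fun y => ?_
      have := hc1 (p ^ ((L + 1) / 2) * y) (by
        rw [mul_pow, ← pow_mul]
        exact (pow_dvd_pow p (by omega)).mul_right _)
      rw [hx01, show (κ * p ^ ε * x₀ ^ 2 + κ' * p ^ (1 - ε) * x₁ ^ 2) * (p ^ ((L + 1) / 2) * y) ^ 2
        = κ * p ^ ε * (x₀ * (p ^ ((L + 1) / 2) * y)) ^ 2 +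
          κ' * p ^ (1 - ε) * (x₁ * (p ^ ((L + 1) / 2) * y)) ^ 2 by ring, AddChar.map_add_eq_mul,
        hκ, one_mul, hκ'] at this
      rw [← this]
      congr 1
      ring
    rw [mul_assoc, Units.dvd_mul_left, mul_comm] at h1
    rw [show r - (L + 1) / 2 = L - (L + 1) / 2 + D by omega] at h1
    exact h.pow_dvd_of_mul_pow (by omega) h1
  set x' := κ' * p ^ (1 - ε) * x₁ ^ 2 with hx'
  have hx'D : p ^ D ∣ x' := by
    have : p ^ (1 - ε + (L - (L + 1) / 2) * 2) ∣ x' := by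
      rw [hx', pow_add, pow_mul]
      exact mul_dvd_mul (dvd_mul_left _ _) (pow_dvd_pow_of_dvd hx₁ 2)
    exact (pow_dvd_pow p (by omega)).trans this
  -- the quartic relation
  have hQ : p ^ (r - j) ∣ (κ * p ^ ε * x₀ ^ 2) ^ 2 + s * (κ * p ^ ε * x₀ ^ 2) +
      γ * p ^ D * τ₁ * x₀ := by
    by_cases hjr' : j ≤ r
    swap
    · rw [show r - j = 0 by omega, pow_zero]
      exact one_dvd _
    refine h.pow_dvd_of_addChar hψ hjr' fun y => ?_
    set v := p ^ j * y with hv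
    have hvj : p ^ j ∣ v := dvd_mul_right _ _
    have hvε : p ^ ε ∣ v := (pow_dvd_pow p hjr).trans hvj
    have hvβ : p ^ L ∣ v * β := by
      rw [hv, mul_right_comm]
      exact hjβ.mul_right _
    have hvδ : p ^ L ∣ v ^ 2 * δ := by
      rw [hv, mul_pow, mul_right_comm]
      exact hjδ.mul_right _
    have hDDv : ∀ {a b}, p ^ D ∣ a → p ^ D ∣ b → a * b * v = 0 := fun ha hb =>
      h.eq_zero_of_dvd (n := D + D + ε) (by omega) (by
        rw [pow_add, pow_add]; exact mul_dvd_mul (mul_dvd_mul ha hb) hvε)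
    have z1 := hDDv hs hx'D
    have z2 := hDDv hx'D hx'D
    have z3 := hDDv ht hx'D
    have z4 := h.mul_eq_zero_of_dvd (by omega) hvβ hx'D
    have z5 := h.mul_eq_zero_of_dvd (by omega) hvδ hx'D
    have hA := hκ (v * x₀ * τ₀)
    have hB := hκ' (v * x₀ * τ₁)
    have h1 := hst v hvj
    -- All contributions of `x'` vanish, and so does the cross term `2 v x' (κ p^ε x₀²)`. The term
    -- quadratic in `v` is split by `τ₀`, `τ₁`: `ψ` is trivial on its first part and turns the
    -- second into a term linear in `v`, so the whole relation becomes linear in `v`.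
    have e : s * v * x + v * x ^ 2 + v ^ 2 * x * (t + δ) =
        (s * (κ * p ^ ε * x₀ ^ 2) * v + (κ * p ^ ε * x₀ ^ 2) ^ 2 * v) +
        (κ * p ^ ε * (v * x₀ * τ₀) ^ 2 + κ' * p ^ (1 - ε) * (v * x₀ * τ₁) ^ 2) := by
      rw [hx01]
      linear_combination z1 + z2 + v * z3 + (1 + v * β) * z4 + z5 + v ^ 2 * x₀ ^ 2 * hτ +
        v * (κ * p ^ ε * x₀ ^ 2) * x' * h2
    rw [e, AddChar.map_add_eq_mul,
      AddChar.map_add_eq_mul ψ (κ * p ^ ε * (v * x₀ * τ₀) ^ 2), hA, hB, one_mul,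
      ← AddChar.map_add_eq_mul] at h1
    rw [← h1]
    congr 1
    ring
  by_cases hxD : p ^ D ∣ x
  · exact Or.inl hxD
  right
  obtain ⟨e₀, he₀, w₀, hw₀⟩ := h.exists_unit x₀
  have hxval : κ * p ^ ε * x₀ ^ 2 = (κ * w₀ ^ 2 : Rˣ) * p ^ (ε + 2 * e₀) := by
    rw [hw₀, Units.val_mul, Units.val_pow_eq_pow_val]
    ring
  have hlt : ε + 2 * e₀ < D := by
    by_contra! hge
    refine hxD ?_
    rw [hx01, hxval]
    exact dvd_add ((pow_dvd_pow p hge).mul_left _) hx'D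
  have hQ' : p ^ (r - j) ∣ ((κ * w₀ ^ 2 : Rˣ) ^ 2 : Rˣ) * p ^ (2 * ε + 4 * e₀) +
      (us * (κ * w₀ ^ 2) : Rˣ) * p ^ (vs + ε + 2 * e₀) + (γ * u₁ * w₀ : Rˣ) *
        p ^ (D + m₁ + e₀) := by
    rw [hxval, hus, hu₁, hw₀] at hQ
    convert hQ using 1
    push_cast
    ring
  -- At least one term lies below the precision `r - j`. Which one depends on the constraint that
  -- determined `j`.
  have hmin : 2 * ε + 4 * e₀ < r - j ∨ vs + ε + 2 * e₀ < r - j ∨ D + m₁ + e₀ < r - j := by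
    rcases hj with hj | ⟨b, hb, hbβ, hbj⟩ | ⟨k, hk, ⟨w, hw⟩, hkj⟩
    · left
      omega
    · right; left
      have : vs ≤ b := by
        by_contra! hlt'
        refine hbβ ?_
        have h1 : p ^ (b + 1) ∣ s := by
          rw [hus]
          exact (pow_dvd_pow p hlt').mul_left _
        have h3 := dvd_sub h1 ((pow_dvd_pow p hb).trans hs)
        rwa [sub_sub_cancel] at h3
      omega
    · right; right
      obtain ⟨m₀, hm₀, u₀, hu₀⟩ := h.exists_unit τ₀
      have htD : p ^ D ∣ t := by
        have h1 : p ^ D ∣ β ^ 2 := by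
          have := pow_dvd_pow_of_dvd hβ 2
          rw [← pow_mul] at this
          exact (pow_dvd_pow p (by omega)).trans this
        have := dvd_add ht h1
        rwa [sub_add_cancel] at this
      obtain ⟨t', ht'⟩ := htD
      have hu' : IsUnit (p ^ (D - (2 * k + 1)) * t' + w) := by
        refine h.isUnit_add ?_ w.isUnit
        exact (dvd_pow_self p (by omega)).mul_right _
      have hsum : p ^ r ∣ κ * (p ^ (D - (2 * k + 1)) * t' + w) * p ^ (2 * k + 1 + ε) +
          (κ * u₀ ^ 2 : Rˣ) * p ^ (ε + 2 * m₀) + (κ' * u₁ ^ 2 : Rˣ) * p ^ (1 - ε + 2 * m₁) := by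
        have e1 : p ^ (D - (2 * k + 1)) * p ^ (2 * k + 1) = p ^ D := by
          rw [← pow_add]
          congr 1
          omega
        rw [ht', hw, hu₀, hu₁, ← e1] at hτ
        refine Dvd.intro 0 ?_
        rw [mul_zero]
        symm
        push_cast
        linear_combination hτ + (κ * u₀ ^ 2 * p ^ (ε + 2 * m₀) +
          κ' * u₁ ^ 2 * p ^ (1 - ε + 2 * m₁)) * h2
      have := h.eq_or_eq_or_eq_of_dvd le_rfl (κ.isUnit.mul hu') (Units.isUnit _) (Units.isUnit _)
        hsum (Or.inl (by omega))
      omega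
  have hcases := h.eq_or_eq_or_eq_of_dvd (by omega) (Units.isUnit _) (Units.isUnit _)
    (Units.isUnit _) hQ' hmin
  refine ⟨ε + 2 * e₀, ?_, ?_⟩
  · simp only [Finset.mem_insert, Finset.mem_singleton]
    omega
  · obtain ⟨y, hy⟩ := hx'D
    have hu := h.isUnit_add (x := p ^ (D - (ε + 2 * e₀)) * y)
      ((dvd_pow_self p (by omega)).mul_right _) (κ * w₀ ^ 2).isUnit
    obtain ⟨w, hw⟩ := hu
    refine ⟨w, ?_⟩
    have e1 : p ^ (D - (ε + 2 * e₀)) * p ^ (ε + 2 * e₀) = p ^ D := by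
      rw [← pow_add]
      congr 1
      omega
    rw [hw, hx01, hxval, hy, ← e1]
    ring

end Valuations

end IsChainRing

end SL2Growth

/-! ### Counting subgroups by valuations and bounding the translations. -/

namespace SL2Growth

/-- An additive subgroup in which only the valuations in `I` occur has at most `q ^ |I|`
elements. -/
theorem IsChainRing.card_le_pow_of_valuations {Y : Type*} [CommRing Y] [Finite Y] {p : Y} {k : ℕ}
    (h : IsChainRing p k) {F : Type*} [Finite F] (res : Y → F)
    (hres : ∀ x y, res x = res y → p ∣ x - y) (I : Finset ℕ) :
    ∀ Q : AddSubgroup Y, (∀ y ∈ Q, y = 0 ∨ ∃ i ∈ I, ∃ w : Yˣ, y = w * p ^ i) →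
      Nat.card Q ≤ Nat.card F ^ I.card := by
  classical
  have := Fintype.ofFinite F
  have := Fintype.ofFinite Y
  induction I using Finset.induction_on_min with
  | empty =>
    intro Q hQ
    have : Subsingleton Q := ⟨fun x y => Subtype.ext (by
      have hx := hQ x x.2
      have hy := hQ y y.2
      simp only [Finset.notMem_empty, false_and, exists_false, or_false] at hx hy
      rw [hx, hy])⟩
    rw [Finset.card_empty, pow_zero]
    exact Finite.card_le_one_iff_subsingleton.2 this
  | insert a s has ih =>
    intro Q hQ
    have hdiv : ∀ y : Q, ∃ z, (y : Y) = p ^ a * z := fun y => by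
      rcases hQ y y.2 with h0 | ⟨i, hi, w, hw⟩
      · exact ⟨0, by rw [h0, mul_zero]⟩
      · refine (?_ : p ^ a ∣ (y : Y))
        rw [hw]
        refine (pow_dvd_pow p ?_).mul_left _
        rcases Finset.mem_insert.1 hi with rfl | hi
        · exact le_rfl
        · exact (has i hi).le
    choose z hz using hdiv
    -- Elements of valuation above the smallest allowed one form the kernel of the
    -- leading-coefficient map to the residue field, so each allowed valuation costs at most a
    -- factor `|F|`.
    let Q' : AddSubgroup Y := Q ⊓ (Ideal.span {p ^ (a + 1)}).toAddSubgroup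
    have hQ' := ih Q' (by
      rintro y ⟨hy, hy'⟩
      have hy' := Ideal.mem_span_singleton.1 hy'
      rcases hQ y hy with h0 | ⟨i, hi, w, hw⟩
      · exact Or.inl h0
      rcases Finset.mem_insert.1 hi with rfl | hi
      · left
        rcases Nat.lt_or_ge i k with hlt | hge
        · rw [hw, h.dvd_unit_mul_iff hlt] at hy'
          omega
        · rw [hw, h.eq_zero_of_dvd hge dvd_rfl, mul_zero]
      · exact Or.inr ⟨i, hi, w, hw⟩)
    rw [Finset.card_insert_of_notMem fun ha => lt_irrefl a (has a ha), pow_succ]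
    have hfib : ∀ b ∈ Finset.univ.image (fun y => res (z y)),
        (Finset.univ.filter fun y : Q => res (z y) = b).card ≤ Nat.card Q' := by
      intro b hb
      obtain ⟨y₀, -, rfl⟩ := Finset.mem_image.1 hb
      rw [← Fintype.card_subtype, ← Nat.card_eq_fintype_card]
      refine Nat.card_le_card_of_injective (fun y => ⟨(y.1 : Y) - y₀, Q.sub_mem y.1.2 y₀.2,
        Ideal.mem_span_singleton.2 ?_⟩) fun y y' hyy => ?_
      · rw [hz y.1, hz y₀, ← mul_sub, pow_succ]
        exact mul_dvd_mul_left _ (hres _ _ y.2)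
      · have h1 := congrArg Subtype.val hyy
        exact Subtype.ext (Subtype.ext (sub_left_injective h1))
    calc Nat.card Q = (Finset.univ : Finset Q).card := Nat.card_eq_fintype_card
      _ ≤ Nat.card Q' * (Finset.univ.image (fun y : Q => res (z y))).card :=
        Finset.card_le_mul_card_image _ _ hfib
      _ ≤ Nat.card F ^ s.card * Nat.card F := by
        refine Nat.mul_le_mul hQ' ((Finset.card_le_univ _).trans ?_)
        rw [Nat.card_eq_fintype_card]

section Bounds

variable {o : Type*} [CommRing o] [IsDomain o] [IsDiscreteValuationRing o]
  {ϖ : o} {r : ℕ} {ψ : AddChar (OMod o r) ℂ}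

theorem exists_res (hϖ : Irreducible ϖ) (k : ℕ) : ∃ res : OMod o k → ResidueField o,
    ∀ x y, res x = res y → (Ideal.Quotient.mk _ ϖ : OMod o k) ∣ x - y := by
  choose f hf using (Ideal.Quotient.mk_surjective (I := maximalIdeal o ^ k))
  refine ⟨fun x => residue o (f x), fun x y hxy => ?_⟩
  rw [← sub_eq_zero, ← map_sub, residue_eq_zero_iff, hϖ.maximalIdeal_eq,
    Ideal.mem_span_singleton] at hxy
  rw [← hf x, ← hf y, ← map_sub]
  exact map_dvd _ hxy

variable [Finite (ResidueField o)]

theorem pow_le_card_map_span (hϖ : Irreducible ϖ) (c : ℕ) :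
    Nat.card (ResidueField o) ^ (ellDown r - c) ≤
      Nat.card (((Ideal.span {(Ideal.Quotient.mk _ ϖ : OMod o r) ^ c}).toAddSubgroup).map
          (red o (ellDown_le r)).toAddMonoidHom) := by
  rcases le_total c (ellDown r) with hc | hc
  · rw [← card_dvd hϖ hc]
    refine Nat.card_le_card_of_injective (fun y => ⟨y.1, ?_⟩) fun y y' h => by
      have h1 := congrArg Subtype.val h
      exact Subtype.ext h1
    obtain ⟨y, z, rfl⟩ := y
    obtain ⟨z, rfl⟩ := red_surjective (ellDown_le r) z
    refine ⟨(Ideal.Quotient.mk _ ϖ) ^ c * z, Ideal.mem_span_singleton.2 (dvd_mul_right _ _), ?_⟩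
    change red o (ellDown_le r) _ = _
    rw [map_mul, map_pow, red_mk]
  · rw [Nat.sub_eq_zero_of_le hc, pow_zero]
    exact Nat.card_pos

/-- An upper bound for the number of translations modulo `℘^ℓ'`. -/
theorem card_map_translations_le (hϖ : Irreducible ϖ) {β : OMod o r} {c : ℕ}
    (hc : c ≤ ellDown r)
    (hβ : ∀ x, (Ideal.Quotient.mk _ ϖ : OMod o r) ^ ellDown r ∣ x * (x + β) →
      (Ideal.Quotient.mk _ ϖ : OMod o r) ^ c ∣ x ∨ (Ideal.Quotient.mk _ ϖ : OMod o r) ^ c ∣ x + β) :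
    Nat.card ((translations β).map (red o (ellDown_le r)).toAddMonoidHom) ≤
      2 * Nat.card (ResidueField o) ^ (ellDown r - c) := by
  rw [← card_dvd hϖ hc, two_mul, ← Nat.card_sum]
  have key : ∀ y : (translations β).map (red o (ellDown_le r)).toAddMonoidHom,
      (Ideal.Quotient.mk _ ϖ : OMod o (ellDown r)) ^ c ∣ y ∨
        (Ideal.Quotient.mk _ ϖ : OMod o (ellDown r)) ^ c ∣ y + red o (ellDown_le r) β := by
    rintro ⟨_, x, ⟨-, hx⟩, rfl⟩
    rw [red_eq_zero_iff hϖ] at hx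
    refine (hβ x hx).imp (fun h => ?_) (fun h => ?_)
    · have := map_dvd (red o (ellDown_le r)) h
      rwa [map_pow, red_mk] at this
    · have := map_dvd (red o (ellDown_le r)) h
      rwa [map_pow, red_mk, map_add] at this
  classical
  refine Nat.card_le_card_of_injective
    (fun y => if h : (Ideal.Quotient.mk _ ϖ : OMod o (ellDown r)) ^ c ∣ y then Sum.inl ⟨y, h⟩
      else Sum.inr ⟨y + red o (ellDown_le r) β, (key y).resolve_left h⟩) fun y y' h => ?_
  simp only at h
  split_ifs at h with h1 h2 h2
  · have := congrArg Subtype.val (Sum.inl_injective h)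
    exact Subtype.ext this
  · have := congrArg Subtype.val (Sum.inr_injective h)
    exact Subtype.ext (add_right_cancel this)

end Bounds

/-! ### Characteristic two: lower bounds for the isotypic part. -/

section CharTwo

variable {o : Type*} [CommRing o] [IsDomain o] [IsDiscreteValuationRing o]
  [Finite (ResidueField o)] {ϖ : o} {r : ℕ} {ψ : AddChar (OMod o r) ℂ}
  {V : Type*} [AddCommGroup V] [Module ℂ V] {ρ : Representation ℂ (SL(2, OMod o r)) V}

/-- With `j = c = ℓ - b` the stabilizer is trivial modulo `℘^ℓ'`, so the isotypic part has dimension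
at least `q ^ (ℓ' - (ℓ - b))`. On the other side, `x (x + β) ≡ 0` forces `x` or `x + β` into
`℘^(ℓ'-b)`, which leaves at most `2 q ^ b` translations. -/
theorem card_le_of_trace_small (hr : 2 ≤ r) (h2 : (2 : OMod o r) = 0) (hϖ : Irreducible ϖ)
    (hψ : ψ (Ideal.Quotient.mk _ (ϖ ^ (r - 1))) ≠ 1) {B : Matrix (Fin 2) (Fin 2) (OMod o r)}
    (ha : IsUnit (B 1 0)) [FiniteDimensional ℂ V]
    (hne : isoPart (psiBracket ψ (B.map (red o (ellDown_le r)))) ρ ≠ ⊥) {b : ℕ}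
    (hb : 2 * b < ellUp r) {u : (OMod o r)ˣ}
    (hβ : B.trace = u * (Ideal.Quotient.mk _ ϖ : OMod o r) ^ b) :
    Nat.card ((translations B.trace).map (red o (ellDown_le r)).toAddMonoidHom) ≤
      Nat.card (ResidueField o) ^ 2 *
        Module.finrank ℂ (isoPart (psiBracket ψ (B.map (red o (ellDown_le r)))) ρ) := by
  have hch := isChainRing_OMod hϖ r
  have hψ' := hψ
  rw [map_pow] at hψ'
  have hL : ellUp r = (r + 1) / 2 := rfl
  have hD : ellDown r = r / 2 := rfl
  set p : OMod o r := Ideal.Quotient.mk _ ϖ with hp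
  have hjβ : red o (ellUp_le r) (p ^ (ellUp r - b) * B.trace) = 0 := by
    rw [red_eq_zero_iff hϖ, ← hp, hβ, mul_left_comm, ← pow_add]
    exact (pow_dvd_pow p (by omega)).mul_left _
  have hjj : ∀ y, red o (ellUp_le r) ((p ^ (ellUp r - b)) ^ 2 * y) = 0 := fun y => by
    rw [red_eq_zero_iff hϖ, ← hp, ← pow_mul]
    exact (pow_dvd_pow p (by omega)).mul_right _
  obtain ⟨s, t, P, hs, -, hPc, -, hst, hcard⟩ := exists_char_two_conditions hϖ hψ h2 ha hne
    (j := ellUp r - b) (c := ellUp r - b) hjβ (hjj _) (by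
      rw [← map_pow, ← mul_one ((_ : OMod o r) ^ 2)]
      exact hjj 1) hjβ
  rw [red_eq_zero_iff hϖ] at hs
  have hP0 : Nat.card (P.map (red o (ellDown_le r)).toAddMonoidHom) ≤ 1 := by
    have := card_map_red_le hϖ (ellDown_le r) le_rfl P fun x hx =>
      hch.pow_dvd_of_trace_small hψ' hr hb hβ hs (hPc x hx) (hst x hx)
    rwa [Nat.sub_self, pow_zero] at this
  have h1 := (pow_le_card_map_span hϖ (r := r) (ellUp r - b)).trans
    (hcard.trans (Nat.mul_le_mul_right _ hP0))
  rw [one_mul] at h1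
  refine (card_map_translations_le hϖ (c := ellDown r - b) (Nat.sub_le _ _) fun x hx => ?_).trans ?_
  · obtain ⟨i, k, hik, hi, hk, -, -⟩ := hch.dvd_or_dvd_of_mul (ellDown_le r) hx
    by_contra! hcon
    have hi' : i < ellDown r - b := by
      by_contra! h'
      exact hcon.1 ((pow_dvd_pow p h').trans hi)
    have hk' : k < ellDown r - b := by
      by_contra! h'
      exact hcon.2 ((pow_dvd_pow p h').trans hk)
    have h3 := dvd_sub ((pow_dvd_pow p (show b + 1 ≤ k by omega)).trans hk)
      ((pow_dvd_pow p (show b + 1 ≤ i by omega)).trans hi)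
    rw [add_sub_cancel_left, hβ, hch.dvd_unit_mul_iff (by omega)] at h3
    omega
  -- One factor `q` absorbs the `2`, the other the possible difference `ℓ - ℓ' = 1`.
  · calc 2 * Nat.card (ResidueField o) ^ (ellDown r - (ellDown r - b))
        ≤ Nat.card (ResidueField o) * Nat.card (ResidueField o) ^ (1 + (ellDown r - (ellUp r - b))) :=
          Nat.mul_le_mul two_le_card (Nat.pow_le_pow_right Nat.card_pos (by omega))
      _ = Nat.card (ResidueField o) ^ 2 * Nat.card (ResidueField o) ^ (ellDown r - (ellUp r - b)) := by
          ring
      _ ≤ _ := Nat.mul_le_mul_left _ h1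

/-- Take `c = ⌈ℓ/2⌉` and for `j` the least exponent with `j ≥ r % 2`, `p^j tr B ∈ ℘^ℓ` and `p^(2j)
det B ∈ ℘^ℓ`, apart from a harmless enlargement; the binding constraint supplies the alternative
needed for the valuation argument. Three valuations give a stabilizer of at most `q³` elements, and
comparing the ideal of `p ^ c` with all translations costs another `q²`. -/
theorem card_le_of_trace_large [CharP (ResidueField o) 2] (hr : 2 ≤ r) (h2 : (2 : OMod o r) = 0) (hϖ : Irreducible ϖ)
    (hψ : ψ (Ideal.Quotient.mk _ (ϖ ^ (r - 1))) ≠ 1) {B : Matrix (Fin 2) (Fin 2) (OMod o r)}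
    (ha : IsUnit (B 1 0)) [FiniteDimensional ℂ V]
    (hne : isoPart (psiBracket ψ (B.map (red o (ellDown_le r)))) ρ ≠ ⊥)
    (hβ : (Ideal.Quotient.mk _ ϖ : OMod o r) ^ ((ellUp r + 1) / 2) ∣ B.trace)
    (hδ : (Ideal.Quotient.mk _ ϖ : OMod o r) ^ ellDown r ∣ B.det ∨
      ∃ k, 2 * k + 1 < ellDown r ∧ ∃ w : (OMod o r)ˣ,
        B.det = w * (Ideal.Quotient.mk _ ϖ : OMod o r) ^ (2 * k + 1)) :
    Nat.card ((translations B.trace).map (red o (ellDown_le r)).toAddMonoidHom) ≤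
      Nat.card (ResidueField o) ^ 5 *
        Module.finrank ℂ (isoPart (psiBracket ψ (B.map (red o (ellDown_le r)))) ρ) := by
  have hch := isChainRing_OMod hϖ r
  have hchD := isChainRing_OMod hϖ (ellDown r)
  have hψ' := hψ
  rw [map_pow] at hψ'
  have hL : ellUp r = (r + 1) / 2 := rfl
  have hD : ellDown r = r / 2 := rfl
  set p : OMod o r := Ideal.Quotient.mk _ ϖ with hp
  obtain ⟨b, hbr, u, hu⟩ := hch.exists_unit B.trace
  have hcc : ∀ y, red o (ellUp_le r) (p ^ ((ellUp r + 1) / 2) * p ^ ((ellUp r + 1) / 2) * y) = 0 :=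
    fun y => by
      rw [red_eq_zero_iff hϖ, ← hp, ← pow_add]
      exact (pow_dvd_pow p (by omega)).mul_right _
  obtain ⟨β', hβ'⟩ := id hβ
  -- the choice of the exponent `j`
  obtain ⟨j, hjr, hjb, hjδ, hj⟩ : ∃ j, r % 2 ≤ j ∧ ellUp r ≤ j + b ∧
      p ^ ellUp r ∣ (p ^ j) ^ 2 * B.det ∧ (j = r % 2 ∨
      (∃ b < r / 2, ¬ p ^ (b + 1) ∣ B.trace ∧ b + j ≤ (r + 1) / 2) ∨
      ∃ k, 2 * k + 1 < r / 2 ∧ (∃ w : (OMod o r)ˣ, B.det = w * p ^ (2 * k + 1)) ∧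
        2 * j + 2 * k ≤ (r + 1) / 2) := by
    have hbt : b < r / 2 → ¬ p ^ (b + 1) ∣ B.trace := fun hb h' => by
      rw [hu, hch.dvd_unit_mul_iff (by omega)] at h'
      omega
    rcases hδ with hδ | ⟨k, hk, w, hw⟩
    · have hdiv : ∀ j, r % 2 ≤ j → p ^ ellUp r ∣ (p ^ j) ^ 2 * B.det := fun j hj => by
        refine (pow_dvd_pow p (n := j * 2 + ellDown r) (by omega)).trans ?_
        rw [pow_add, ← pow_mul]
        exact mul_dvd_mul_left _ hδ
      rcases le_total (ellUp r - b) (r % 2) with hle | hle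
      · exact ⟨r % 2, le_rfl, by omega, hdiv _ le_rfl, Or.inl rfl⟩
      · by_cases hb : b < r / 2
        · exact ⟨ellUp r - b, hle, by omega, hdiv _ hle, Or.inr (Or.inl ⟨b, hb, hbt hb, by omega⟩)⟩
        · exact ⟨r % 2, le_rfl, by omega, hdiv _ le_rfl, Or.inl rfl⟩
    · have hdiv : ∀ j, (ellUp r - 2 * k) / 2 ≤ j → p ^ ellUp r ∣ (p ^ j) ^ 2 * B.det :=
        fun j hj => by
        rw [hw, mul_left_comm, ← pow_mul, ← pow_add]
        exact (pow_dvd_pow p (by omega)).mul_left _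
      by_cases hb : b < r / 2 ∧ (ellUp r - 2 * k) / 2 ≤ ellUp r - b
      · exact ⟨ellUp r - b, by omega, by omega, hdiv _ hb.2,
          Or.inr (Or.inl ⟨b, hb.1, hbt hb.1, by omega⟩)⟩
      · by_cases hk' : r % 2 ≤ (ellUp r - 2 * k) / 2
        · exact ⟨(ellUp r - 2 * k) / 2, hk', by omega, hdiv _ le_rfl,
            Or.inr (Or.inr ⟨k, hk, ⟨w, hw⟩, by omega⟩)⟩
        · exact ⟨r % 2, le_rfl, by omega, hdiv _ (by omega), Or.inl rfl⟩
  have hjβ : p ^ ellUp r ∣ p ^ j * B.trace := by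
    rw [hu, mul_left_comm, ← pow_add]
    exact (pow_dvd_pow p hjb).mul_left _
  obtain ⟨s, t, P, hs, ht, hPc, hc1, hst, hcard⟩ := exists_char_two_conditions hϖ hψ h2 ha hne
    (j := j) (c := (ellUp r + 1) / 2) ((red_eq_zero_iff hϖ _).2 hjβ)
    ((red_eq_zero_iff hϖ _).2 hjδ) (by
      have := hcc 1
      rwa [mul_one, ← pow_two, map_pow] at this) (by
      have := hcc β'
      rwa [mul_assoc, ← hβ'] at this)
  rw [red_eq_zero_iff hϖ] at hs ht
  obtain ⟨I, hI, hval⟩ := hch.exists_valuations_of_trace_large hψ' hr h2 (exists_sq_sub_dvd hϖ r) hβ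
    hs ht hjβ hjδ hjr hj
  obtain ⟨res, hres⟩ := exists_res hϖ (ellDown r)
  have hP3 : Nat.card (P.map (red o (ellDown_le r)).toAddMonoidHom) ≤
      Nat.card (ResidueField o) ^ 3 := by
    refine (hchD.card_le_pow_of_valuations res hres I _ ?_).trans
      (Nat.pow_le_pow_right Nat.card_pos hI)
    rintro _ ⟨x, hx, rfl⟩
    rcases hval x (hPc x hx) (fun w hw => hc1 x hx w ((red_eq_zero_iff hϖ _).2 hw)) (hst x hx)
      with h0 | ⟨i, hi, w, hw⟩
    · exact Or.inl ((red_eq_zero_iff hϖ (ellDown_le r)).2 h0)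
    · refine Or.inr ⟨i, hi, Units.map (red o (ellDown_le r)).toMonoidHom w, ?_⟩
      have := congrArg (red o (ellDown_le r)) hw
      rw [map_mul, map_pow, red_mk] at this
      exact this
  have h1 := (pow_le_card_map_span hϖ (r := r) ((ellUp r + 1) / 2)).trans
    (hcard.trans (Nat.mul_le_mul_right _ hP3))
  refine (card_map_translations_le hϖ (c := (ellDown r + 1) / 2) (by omega) fun x hx => ?_).trans ?_
  · obtain ⟨i, k, hik, hi, hk, -, -⟩ := hch.dvd_or_dvd_of_mul (ellDown_le r) hx
    rcases le_total i k with hle | hle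
    · exact Or.inr ((pow_dvd_pow p (by omega)).trans hk)
    · exact Or.inl ((pow_dvd_pow p (by omega)).trans hi)
  · calc 2 * Nat.card (ResidueField o) ^ (ellDown r - (ellDown r + 1) / 2)
        ≤ Nat.card (ResidueField o) *
            Nat.card (ResidueField o) ^ (1 + (ellDown r - (ellUp r + 1) / 2)) :=
          Nat.mul_le_mul two_le_card (Nat.pow_le_pow_right Nat.card_pos (by omega))
      _ = Nat.card (ResidueField o) ^ 2 *
            Nat.card (ResidueField o) ^ (ellDown r - (ellUp r + 1) / 2) := by ring
      _ ≤ Nat.card (ResidueField o) ^ 2 * (Nat.card (ResidueField o) ^ 3 * _) :=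
          Nat.mul_le_mul_left _ h1
      _ = _ := by ring

end CharTwo

end SL2Growth

namespace SL2Growth

/-! ### The bounds for a matrix in normal form. -/

section NormalForm

variable {o : Type*} [CommRing o] [IsDomain o] [IsDiscreteValuationRing o]
  {ϖ : o} {r : ℕ} {ψ : AddChar (OMod o r) ℂ}

theorem two_le_of_levelBound_le [CharP (ResidueField o) 2] (hr : levelBound o ≤ r) (hϖ : Irreducible ϖ) : 2 ≤ r := by
  by_cases h2 : (2 : o) = 0
  · have h0 : ringChar o ≠ 0 := fun h0 => by
      have := (ringChar.spec o 2).1 (by exact_mod_cast h2)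
      rw [h0] at this
      simp at this
    rwa [levelBound, if_neg h0] at hr
  · obtain ⟨e, he, her, -⟩ := exists_two_eq hr h2 hϖ
    omega

theorem card_inertia_normalForm (hϖ : Irreducible ϖ)
    (hψ : ψ (Ideal.Quotient.mk _ (ϖ ^ (r - 1))) ≠ 1) (a : (OMod o r)ˣ) (α β : OMod o r) :
    Nat.card (inertia _ (psiBracket ψ ((normalForm a α β).map (red o (ellDown_le r))))) =
      Nat.card (stabSL ψ ((normalForm a α β).map (red o (ellDown_le r)))) *
        Nat.card ((translations β).map (red o (ellDown_le r)).toAddMonoidHom) :=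
  card_inertia hϖ hψ (B := normalForm a α β) a.isUnit rfl

variable [Finite (ResidueField o)] [CharP (ResidueField o) 2]

/-- The isotypic part is large. -/
theorem card_map_translations_le_finrank (hr : levelBound o ≤ r) (hϖ : Irreducible ϖ)
    (hψ : ψ (Ideal.Quotient.mk _ (ϖ ^ (r - 1))) ≠ 1) (a : (OMod o r)ˣ) (α β : OMod o r)
    {V : Type*} [AddCommGroup V] [Module ℂ V] {ρ : Representation ℂ (SL(2, OMod o r)) V}
    [FiniteDimensional ℂ V]
    (hne : isoPart (psiBracket ψ ((normalForm a α β).map (red o (ellDown_le r)))) ρ ≠ ⊥) :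
    Nat.card ((translations β).map (red o (ellDown_le r)).toAddMonoidHom) ≤
      Nat.card (ResidueField o) ^ 5 * Module.finrank ℂ
        (isoPart (psiBracket ψ ((normalForm a α β).map (red o (ellDown_le r)))) ρ) := by
  have ha : IsUnit (normalForm a α β 1 0) := a.isUnit
  have hq : 1 ≤ Nat.card (ResidueField o) := Nat.card_pos
  have hr2 := two_le_of_levelBound_le hr hϖ
  by_cases hchar : (2 : o) = 0
  · have h2 : (2 : OMod o r) = 0 := by
      rw [← map_ofNat (Ideal.Quotient.mk (maximalIdeal o ^ r)) 2, hchar, map_zero]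
    have htr : (normalForm a α β).trace = β := by simp [normalForm, Matrix.trace_fin_two]
    have hch := isChainRing_OMod hϖ r
    obtain ⟨b, hb, u, hu⟩ := hch.exists_unit β
    by_cases hbL : 2 * b < ellUp r
    · have := card_le_of_trace_small hr2 h2 hϖ hψ ha hne hbL (htr.trans hu)
      rw [htr] at this
      exact this.trans (Nat.mul_le_mul_right _ (Nat.pow_le_pow_right hq (by norm_num)))
    · have hβ : (Ideal.Quotient.mk _ ϖ : OMod o r) ^ ((ellUp r + 1) / 2) ∣ β := by
        rw [hu]
        exact (pow_dvd_pow _ (by omega)).mul_left _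
      obtain ⟨s, hs⟩ := hch.exists_shift_det h2 (exists_sq_sub_dvd hϖ r)
        (δ := (normalForm a α β).det) hβ
      set B := normalForm a α β + s • (1 : Matrix (Fin 2) (Fin 2) (OMod o r)) with hB
      have hB10 : IsUnit (B 1 0) := by simpa [hB] using ha
      have hBt : B.trace = β := by
        rw [hB, Matrix.trace_add, htr, Matrix.trace_smul, Matrix.trace_one, Fintype.card_fin]
        simp [h2]
      have hBd : B.det = (normalForm a α β).det + s * β + s ^ 2 := by
        rw [hB, Matrix.det_fin_two, Matrix.det_fin_two]
        simp [normalForm]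
        ring
      rw [← psiBracket_add_smul_one ψ _ s, ← hB] at hne ⊢
      have := card_le_of_trace_large hr2 h2 hϖ hψ hB10 hne (by rwa [hBt]) (by rw [hBd]; exact hs)
      rwa [hBt] at this
  · have := card_le_of_two_ne_zero hr hchar hϖ hψ ha hne
    have e : normalForm a α β 1 1 - normalForm a α β 0 0 = β := by simp [normalForm]
    rw [e] at this
    refine this.trans (Nat.mul_le_mul_right _ ?_)
    exact Nat.le_self_pow (by norm_num) _

variable {V : Type*} [AddCommGroup V] [Module ℂ V] {ρ : Representation ℂ (SL(2, OMod o r)) V}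

theorem finrank_bounds_normalForm (hr : levelBound o ≤ r) (hϖ : Irreducible ϖ)
    (hψ : ψ (Ideal.Quotient.mk _ (ϖ ^ (r - 1))) ≠ 1) (a : (OMod o r)ˣ) (α β : OMod o r)
    (hρ : LiesOver (psiBracket ψ ((normalForm a α β).map (red o (ellDown_le r)))) ρ) :
    1 / (Nat.card (ResidueField o) : ℝ) ^ 5 * ((Nat.card (SL(2, OMod o r)) : ℝ) /
        Nat.card (stabSL ψ ((normalForm a α β).map (red o (ellDown_le r))))) ≤
      Module.finrank ℂ V ∧
    (Module.finrank ℂ V : ℝ) ≤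
      (Nat.card (SL(2, OMod o r)) : ℝ) / Nat.card (centSL (normalForm a α β)) := by
  obtain ⟨hirr, hne⟩ := liesOver_iff.1 hρ
  have := finiteDimensional_of_irreducible hirr
  set N := normalForm a α β with hN
  set φ := psiBracket ψ (N.map (red o (ellDown_le r))) with hφ
  have hq : (0 : ℝ) < Nat.card (ResidueField o) := Nat.cast_pos.2 Nat.card_pos
  have hS : (0 : ℝ) < Nat.card (stabSL ψ (N.map (red o (ellDown_le r)))) :=
    Nat.cast_pos.2 Nat.card_pos
  constructor
  · have h1 := card_map_translations_le_finrank hr hϖ hψ a α β hne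
    have h2 := card_inertia_normalForm hϖ hψ a α β
    have h3 := Subgroup.card_mul_index (inertia _ φ)
    have h4 := finrank_eq_index_mul hirr hne
    rw [one_div, inv_mul_le_iff₀ (by positivity), div_le_iff₀ hS]
    norm_cast
    rw [← h3, h2, h4]
    calc _ ≤ Nat.card (stabSL ψ (N.map (red o (ellDown_le r)))) *
          (Nat.card (ResidueField o) ^ 5 * Module.finrank ℂ (isoPart φ ρ)) *
            (inertia _ φ).index := by gcongr
      _ = _ := by ring
  · obtain ⟨v, hv, hv0, χ, hχ⟩ := exists_eigenvector hne (centSL N)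
      ((centSL_le_stabSL ψ N).trans (stabSL_le_inertia ψ N))
      (exists_commutator_centSL ψ (B := N) a.isUnit)
    have h1 := finrank_le_index hirr (centSL N) hv0 fun c hc => ⟨χ ⟨c, hc⟩, hχ ⟨c, hc⟩⟩
    have h2 := Subgroup.card_mul_index (centSL N)
    rw [le_div_iff₀ (Nat.cast_pos.2 Nat.card_pos)]
    norm_cast
    rw [← h2, mul_comm]
    exact Nat.mul_le_mul_left _ h1

theorem card_irrOver_normalForm (hr : levelBound o ≤ r) (hϖ : Irreducible ϖ)
    (hψ : ψ (Ideal.Quotient.mk _ (ϖ ^ (r - 1))) ≠ 1) (a : (OMod o r)ˣ) (α β : OMod o r) :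
    (Nat.card (centSL (normalForm a α β)) : ℝ) ^ 2 *
        (Nat.card (ResidueField o) : ℝ) ^ ellUp r /
        (Nat.card (stabSL ψ ((normalForm a α β).map (red o (ellDown_le r)))) *
          Nat.card (groupH a β) * Nat.card (congSL o r (ellUp_le r))) ≤
      Nat.card (IrrOver (psiBracket ψ ((normalForm a α β).map (red o (ellDown_le r))))) ∧
    (Nat.card (IrrOver (psiBracket ψ ((normalForm a α β).map (red o (ellDown_le r))))) : ℝ) ≤
      Nat.card (stabSL ψ ((normalForm a α β).map (red o (ellDown_le r)))) *
        (Nat.card (ResidueField o) : ℝ) ^ (ellUp r + 10) /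
        (Nat.card (groupH a β) * Nat.card (congSL o r (ellUp_le r))) := by
  set N := normalForm a α β with hN
  set φ := psiBracket ψ (N.map (red o (ellDown_le r))) with hφ
  set q : ℝ := ((Nat.card (ResidueField o) : ℕ) : ℝ) with hqdef
  set S : ℝ := ((Nat.card (stabSL ψ (N.map (red o (ellDown_le r)))) : ℕ) : ℝ) with hSdef
  set C : ℝ := ((Nat.card (centSL N) : ℕ) : ℝ) with hCdef
  set G : ℝ := ((Nat.card (SL(2, OMod o r)) : ℕ) : ℝ) with hGdef
  set I : ℝ := (((inertia _ φ).index : ℕ) : ℝ) with hIdef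
  set k : ℝ := ((Nat.card (congSL o r (ellUp_le r)) : ℕ) : ℝ) with hkdef
  set t : ℝ := ((Nat.card ((translations β).map (red o (ellDown_le r)).toAddMonoidHom) : ℕ) : ℝ) with htdef
  have hq : 0 < q := Nat.cast_pos.2 Nat.card_pos
  have hS : 0 < S := Nat.cast_pos.2 Nat.card_pos
  have hC : 0 < C := Nat.cast_pos.2 Nat.card_pos
  have hG : 0 < G := Nat.cast_pos.2 Nat.card_pos
  have hk : 0 < k := Nat.cast_pos.2 Nat.card_pos
  have ht : 0 < t := Nat.cast_pos.2 Nat.card_pos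
  have hI : 0 < I := Nat.cast_pos.2 (Nat.pos_of_ne_zero Subgroup.index_ne_zero_of_finite)
  have hH : (Nat.card (groupH a β) : ℝ) = t * q ^ ellUp r := by
    rw [card_groupH, card_translations hϖ]
    push_cast
    rfl
  have hT : G = S * t * I := by
    have h2 := card_inertia_normalForm hϖ hψ a α β
    have h3 := Subgroup.card_mul_index (inertia _ φ)
    rw [h2] at h3
    have h4 := congrArg (Nat.cast : ℕ → ℝ) h3
    push_cast at h4
    exact h4.symm
  have hKi : ((congSL o r (ellUp_le r)).index : ℝ) = G / k := by
    rw [eq_div_iff hk.ne']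
    have h3 := Subgroup.card_mul_index (congSL o r (ellUp_le r))
    rw [mul_comm] at h3
    have h4 := congrArg (Nat.cast : ℕ → ℝ) h3
    push_cast at h4
    exact h4
  -- By Clifford `dim ρ · dim ρ_φ = (dim ρ)² / I`, so squaring the dimension bounds gives these
  -- constants; the exponent `10` of the final bound is the square of `q⁵`.
  have hbound := card_irrOver_bounds φ ((G / (S * q ^ 5)) ^ 2 / I) ((G / C) ^ 2 / I)
    (fun n ρ hρ => by
      obtain ⟨h1, h2⟩ := finrank_bounds_normalForm hr hϖ hψ a α β hρ
      obtain ⟨hirr, hne⟩ := liesOver_iff.1 hρ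
      have h4 := finrank_eq_index_mul hirr hne
      rw [Module.finrank_fin_fun] at h1 h2 h4
      have h5 : (n : ℝ) = I * Module.finrank ℂ (isoPart φ ρ) := by
        have h6 := congrArg (Nat.cast : ℕ → ℝ) h4
        rwa [Nat.cast_mul] at h6
      have h6 : (n : ℝ) * Module.finrank ℂ (isoPart φ ρ) = (n : ℝ) ^ 2 / I := by
        rw [eq_div_iff hI.ne']
        linear_combination -(n : ℝ) * h5
      have h7 : G / (S * q ^ 5) = 1 / q ^ 5 * (G / S) := by
        field_simp
      rw [h6, h7]
      constructor
      · gcongr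
      · gcongr)
  rw [hKi] at hbound
  obtain ⟨hlow, hup⟩ := hbound
  set n : ℝ := ((Nat.card (IrrOver φ) : ℕ) : ℝ) with hndef
  rw [hH]
  constructor
  · rw [div_le_iff₀ (by positivity)]
    rw [show (G / C) ^ 2 / I * n = G ^ 2 * n / (C ^ 2 * I) by field_simp,
      div_le_div_iff₀ hk (by positivity)] at hup
    have h1 : G * (C ^ 2 * I) ≤ G * (G * n * k) := by linarith
    have h2 := le_of_mul_le_mul_left h1 hG
    rw [hT] at h2
    have h3 : I * C ^ 2 ≤ I * (S * t * n * k) := by linarith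
    have h4 := le_of_mul_le_mul_left h3 hI
    calc C ^ 2 * q ^ ellUp r ≤ (S * t * n * k) * q ^ ellUp r := by gcongr
      _ = _ := by ring
  · rw [le_div_iff₀ (by positivity)]
    rw [div_pow, div_div, div_mul_eq_mul_div, div_le_div_iff₀ (by positivity) hk] at hlow
    have h1 : G * (G * n * k) ≤ G * (I * (S * q ^ 5) ^ 2) := by linarith
    have h2 := le_of_mul_le_mul_left h1 hG
    rw [hT] at h2
    have h3 : (I * S) * (t * n * k) ≤ (I * S) * (S * q ^ 10) := by linarith
    have h4 := le_of_mul_le_mul_left h3 (by positivity)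
    calc n * (t * q ^ ellUp r * k) = (t * n * k) * q ^ ellUp r := by ring
      _ ≤ S * q ^ 10 * q ^ ellUp r := by gcongr
      _ = _ := by ring

end NormalForm

/-! ### Invariance of all quantities under conjugation, and the main theorem. -/

section Conjugation

variable {o : Type*} [CommRing o] [IsDomain o] [IsDiscreteValuationRing o] {r : ℕ}
  (ψ : AddChar (OMod o r) ℂ)
  {A N : Matrix (Fin 2) (Fin 2) (OMod o r)} {g : SL(2, OMod o r)}

theorem conj_symm (hg : (g : Matrix (Fin 2) (Fin 2) (OMod o r)) * A = N * g) :
    ((g⁻¹ : SL(2, OMod o r)) : Matrix (Fin 2) (Fin 2) (OMod o r)) * N =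
      A * (g⁻¹ : SL(2, OMod o r)) := by
  have h1 : ((g⁻¹ : SL(2, OMod o r)) : Matrix (Fin 2) (Fin 2) (OMod o r)) * g = 1 := by
    rw [← Matrix.SpecialLinearGroup.coe_mul, inv_mul_cancel, Matrix.SpecialLinearGroup.coe_one]
  have h2 : (g : Matrix (Fin 2) (Fin 2) (OMod o r)) * (g⁻¹ : SL(2, OMod o r)) = 1 := by
    rw [← Matrix.SpecialLinearGroup.coe_mul, mul_inv_cancel, Matrix.SpecialLinearGroup.coe_one]
  calc ((g⁻¹ : SL(2, OMod o r)) : Matrix (Fin 2) (Fin 2) (OMod o r)) * N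
      = (g⁻¹ : SL(2, OMod o r)) * (N * g) * (g⁻¹ : SL(2, OMod o r)) := by
        rw [← Matrix.mul_assoc, Matrix.mul_assoc _ (g : Matrix (Fin 2) (Fin 2) (OMod o r)), h2,
          Matrix.mul_one]
    _ = _ := by rw [← hg, ← Matrix.mul_assoc, h1, Matrix.one_mul]

theorem psiLift_of_conj (hg : (g : Matrix (Fin 2) (Fin 2) (OMod o r)) * A = N * g)
    (m : congGL o r (ellUp_le r)) :
    psiLift ψ A m = psiLift ψ N (MulAut.conjNormal (Matrix.SpecialLinearGroup.toGL g) m) := by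
  have h1 : ((g⁻¹ : SL(2, OMod o r)) : Matrix (Fin 2) (Fin 2) (OMod o r)) * g = 1 := by
    rw [← Matrix.SpecialLinearGroup.coe_mul, inv_mul_cancel, Matrix.SpecialLinearGroup.coe_one]
  have h2 : ((g⁻¹ : SL(2, OMod o r)) : Matrix (Fin 2) (Fin 2) (OMod o r)) * N * g = A := by
    rw [Matrix.mul_assoc, ← hg, ← Matrix.mul_assoc, h1, Matrix.one_mul]
  rw [psiLift_conj, coe_toGL_inv]
  exact congrArg (fun B => psiLift ψ B m) h2.symm

theorem conj_mem_stabSL (hg : (g : Matrix (Fin 2) (Fin 2) (OMod o r)) * A = N * g)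
    {t : SL(2, OMod o r)} (ht : t ∈ stabSL ψ (A.map (red o (ellDown_le r)))) :
    MulAut.conj g t ∈ stabSL ψ (N.map (red o (ellDown_le r))) := by
  rw [mem_stabSL_iff] at ht ⊢
  intro m
  have h := ht (MulAut.conjNormal (Matrix.SpecialLinearGroup.toGL g)⁻¹ m)
  rw [psiLift_of_conj ψ hg, psiLift_of_conj ψ hg, ← MulAut.mul_apply, ← MulAut.mul_apply,
    ← map_mul, ← map_mul, ← MulAut.mul_apply, ← map_mul, ← map_mul MulAut.conjNormal,
    mul_inv_cancel, map_one, MulAut.one_apply] at h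
  rw [← h, MulAut.conj_apply, map_mul Matrix.SpecialLinearGroup.toGL, map_inv]

theorem conj_mem_centSL (hg : (g : Matrix (Fin 2) (Fin 2) (OMod o r)) * A = N * g)
    {t : SL(2, OMod o r)} (ht : t ∈ centSL A) : MulAut.conj g t ∈ centSL N := by
  rw [mem_centSL_iff] at ht ⊢
  obtain ⟨z, hz, m, hm, hzm⟩ := Subgroup.mem_sup_of_normal_right.1 ht
  set γ := Matrix.SpecialLinearGroup.toGL g with hγ
  have e : Matrix.SpecialLinearGroup.toGL (MulAut.conj g t) = (γ * z * γ⁻¹) * (γ * m * γ⁻¹) := by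
    rw [MulAut.conj_apply, map_mul, map_mul, map_inv, ← hzm, ← hγ]
    group
  rw [e]
  refine Subgroup.mul_mem_sup ?_ (Subgroup.Normal.conj_mem inferInstance _ hm _)
  have hz : (z : Matrix (Fin 2) (Fin 2) (OMod o r)) * A = A * z := hz
  have hs := conj_symm hg
  change ((γ * z * γ⁻¹ : GL (Fin 2) (OMod o r)) : Matrix (Fin 2) (Fin 2) (OMod o r)) * N =
    N * (γ * z * γ⁻¹ : GL (Fin 2) (OMod o r))
  rw [Units.val_mul, Units.val_mul, hγ, coe_toGL_inv, Matrix.mul_assoc, hs, ← Matrix.mul_assoc,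
    Matrix.mul_assoc _ _ A, hz, ← Matrix.mul_assoc, ← Matrix.mul_assoc, ← Matrix.mul_assoc]
  congr 2

theorem isoPart_ne_bot_of_conj (hg : (g : Matrix (Fin 2) (Fin 2) (OMod o r)) * A = N * g)
    {V : Type*} [AddCommGroup V] [Module ℂ V] {ρ : Representation ℂ (SL(2, OMod o r)) V}
    (h : isoPart (psiBracket ψ (A.map (red o (ellDown_le r)))) ρ ≠ ⊥) :
    isoPart (psiBracket ψ (N.map (red o (ellDown_le r)))) ρ ≠ ⊥ := by
  obtain ⟨v, hv, hv0⟩ := Submodule.exists_mem_ne_zero_of_ne_bot h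
  refine Submodule.ne_bot_iff _ |>.2 ⟨ρ g v, fun k => ?_, fun h0 => hv0 ?_⟩
  · change ρ (k : SL(2, OMod o r)) (ρ g v) = _
    rw [conj_mem_isoPart (MulAut.conjNormal g⁻¹ k) (by simp [mul_assoc]) hv, psiBracket_apply,
      psiBracket_apply, psiLift_of_conj ψ hg, ← congIncl_conj, ← MulAut.mul_apply, ← map_mul,
      mul_inv_cancel, map_one, MulAut.one_apply]
  · have := congrArg (ρ g⁻¹) h0
    rwa [← Module.End.mul_apply, ← map_mul, inv_mul_cancel, map_one, Module.End.one_apply,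
      map_zero] at this

theorem liesOver_of_conj (hg : (g : Matrix (Fin 2) (Fin 2) (OMod o r)) * A = N * g)
    {V : Type*} [AddCommGroup V] [Module ℂ V] {ρ : Representation ℂ (SL(2, OMod o r)) V} :
    LiesOver (psiBracket ψ (A.map (red o (ellDown_le r)))) ρ ↔
      LiesOver (psiBracket ψ (N.map (red o (ellDown_le r)))) ρ := by
  rw [liesOver_iff, liesOver_iff]
  constructor
  · rintro ⟨h1, h2⟩
    exact ⟨h1, isoPart_ne_bot_of_conj ψ hg h2⟩
  · rintro ⟨h1, h2⟩
    exact ⟨h1, isoPart_ne_bot_of_conj ψ (conj_symm hg) h2⟩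

theorem card_subgroup_eq_of_conj {G : Type*} [Group G] {H K : Subgroup G} (g : G)
    (h : ∀ t ∈ H, MulAut.conj g t ∈ K) (h' : ∀ t ∈ K, MulAut.conj g⁻¹ t ∈ H) :
    Nat.card H = Nat.card K := by
  refine Nat.card_congr ((MulAut.conj g).toEquiv.subtypeEquiv fun t => ⟨h t, fun ht => ?_⟩)
  have e : MulAut.conj g⁻¹ (MulAut.conj g t) = t := by
    simp only [MulAut.conj_apply]
    group
  exact e ▸ h' _ ht

theorem card_irrOver_congr {G : Type*} [Group G] {K : Subgroup G} {φ φ' : K →* ℂ}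
    (h : ∀ (n : ℕ) (ρ : Representation ℂ G (Fin n → ℂ)), LiesOver φ ρ ↔ LiesOver φ' ρ) :
    Nat.card (IrrOver φ) = Nat.card (IrrOver φ') :=
  Nat.card_congr
    { toFun := Quotient.map (fun x => ⟨x.1, (h _ _).1 x.2⟩) fun _ _ ⟨e⟩ => ⟨e⟩
      invFun := Quotient.map (fun x => ⟨x.1, (h _ _).2 x.2⟩) fun _ _ ⟨e⟩ => ⟨e⟩
      left_inv := Quotient.ind fun _ => rfl
      right_inv := Quotient.ind fun _ => rfl }

theorem card_stabSL_of_conj (hg : (g : Matrix (Fin 2) (Fin 2) (OMod o r)) * A = N * g) :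
    Nat.card (stabSL ψ (A.map (red o (ellDown_le r)))) =
      Nat.card (stabSL ψ (N.map (red o (ellDown_le r)))) :=
  card_subgroup_eq_of_conj g (fun _ => conj_mem_stabSL ψ hg)
    fun _ => conj_mem_stabSL ψ (conj_symm hg)

theorem card_centSL_of_conj (hg : (g : Matrix (Fin 2) (Fin 2) (OMod o r)) * A = N * g) :
    Nat.card (centSL A) = Nat.card (centSL N) :=
  card_subgroup_eq_of_conj g (fun _ => conj_mem_centSL hg)
    fun _ => conj_mem_centSL (conj_symm hg)

theorem card_irrOver_of_conj (hg : (g : Matrix (Fin 2) (Fin 2) (OMod o r)) * A = N * g) :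
    Nat.card (IrrOver (psiBracket ψ (A.map (red o (ellDown_le r))))) =
      Nat.card (IrrOver (psiBracket ψ (N.map (red o (ellDown_le r))))) :=
  card_irrOver_congr fun _ _ => liesOver_of_conj ψ hg

end Conjugation

end SL2Growth

theorem mainTheorem6 {o : Type*} [CommRing o] [IsDomain o] [IsDiscreteValuationRing o]
    [IsAdicComplete (maximalIdeal o) o] [Finite (ResidueField o)]
    [CharP (ResidueField o) 2]
    (r : ℕ) (hr : levelBound o ≤ r)
    (ϖ : o) (hϖ : Irreducible ϖ) (ψ : AddChar (OMod o r) ℂ)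
    (hψ : ψ (Ideal.Quotient.mk _ (ϖ ^ (r - 1))) ≠ 1)
    (A : Matrix (Fin 2) (Fin 2) (OMod o (ellDown r))) (hA : IsCyclicMatrix A)
    (A' : Matrix (Fin 2) (Fin 2) (OMod o r)) (hA' : A'.map (red o (ellDown_le r)) = A) :
    (∀ (V : Type*) [AddCommGroup V] [Module ℂ V] (ρ : Representation ℂ (SL(2, OMod o r)) V),
      LiesOver (psiBracket ψ A) ρ →
        1 / (Nat.card (ResidueField o) : ℝ) ^ 5 *
            ((Nat.card (SL(2, OMod o r)) : ℝ) / Nat.card (stabSL ψ A)) ≤ Module.finrank ℂ V ∧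
        (Module.finrank ℂ V : ℝ) ≤ (Nat.card (SL(2, OMod o r)) : ℝ) / Nat.card (centSL A')) ∧
    (∀ (g : SL(2, OMod o r)) (a : (OMod o r)ˣ) (α β : OMod o r),
      (g : Matrix (Fin 2) (Fin 2) (OMod o r)) * A' = normalForm a α β * g →
        (Nat.card (centSL A') : ℝ) ^ 2 *
            (Nat.card (ResidueField o) : ℝ) ^ ellUp r /
            (Nat.card (stabSL ψ A) * Nat.card (groupH a β) *
              Nat.card (congSL o r (ellUp_le r))) ≤
          Nat.card (IrrOver (psiBracket ψ A)) ∧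
        (Nat.card (IrrOver (psiBracket ψ A)) : ℝ) ≤
          Nat.card (stabSL ψ A) *
            (Nat.card (ResidueField o) : ℝ) ^ (ellUp r + 10) /
            (Nat.card (groupH a β) * Nat.card (congSL o r (ellUp_le r)))) := by
  subst hA'
  constructor
  · intro V _ _ ρ hρ
    obtain ⟨g, a, α, β, hg⟩ := exists_conj_normalForm (two_le_of_levelBound_le hr hϖ) hA rfl
    rw [card_stabSL_of_conj ψ hg, card_centSL_of_conj hg]
    exact finrank_bounds_normalForm hr hϖ hψ a α β ((liesOver_of_conj ψ hg).1 hρ)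
  · intro g a α β hg
    rw [card_stabSL_of_conj ψ hg, card_centSL_of_conj hg, card_irrOver_of_conj ψ hg]
    exact card_irrOver_normalForm hr hϖ hψ a α β
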